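/- Let $K$ be a field, let $\mathbf A$ be a $K$-linear abelian category with finite-dimensional Hom-spaces, and let $\mathbf E\subseteq\mathbf A$ be a full exact subcategory, i.e. a full additive subcategory closed under extensions, whose conflations are the sequences in $\mathbf E$ that are short exact in $\mathbf A$. Let $D^b(\mathbf E)$ be its bounded derived category, i.e. the quotient of the bounded homotopy category $K^b(\mathbf E)$ by the complexes homotopy equivalent to acyclic ones (those whose differentials $X^n\to X^{n+1}$ factor through objects $Z^{n+1}\in\mathbf E$ with all $Z^n\to X^n\to Z^{n+1}$ conflations). Cohomology objects $H^n(C)\in\mathbf A$ of $C\in D^b(\mathbf E)$ are computed via the natural functor from $D^b(\mathbf E)$ to the derived category of $\mathbf A$, and $D^b(\mathbf E)\cap\mathbf A$ denotes the objects of $D^b(\mathbf E)$ whose image under this functor is isomorphic to an object of $\mathbf A$ placed in degree $0$. Let $\{P_i\}_{i\in I}$ be a family of objects of $\mathbf E$. For $X\in\mathbf A$ and $i\in I$ consider the properties: (1) the natural morphism $\mathrm{Hom}_{\mathbf A}(P_i,X)\otimes_K P_i\to X$ is an epimorphism; (2) there are $k\in\mathbb N$ and an epimorphism $P_i^{\oplus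 k}\to X$ such that the induced map $\mathrm{Hom}(X,X[m])\to\mathrm{Hom}(P_i^{\oplus k},X[m])$ (Hom in the derived category of $\mathbf A$) is zero for all integers $m\neq0$. Assume: (E1) a morphism of $\mathbf E$ is an admissible epimorphism (the second map of a conflation) if and only if it is an epimorphism in $\mathbf A$; (E2) for every $X\in\mathbf A$ there is $i\in I$ satisfying (1) and (2) for $X$; (E3) for every $A\in D^b(\mathbf E)\cap\mathbf A$ there is an integer $N(A)$ such that $\mathrm{Hom}(A,B[j])=0$ (Hom in the derived category of $\mathbf A$) for all $j>N(A)$ and all $B\in D^b(\mathbf E)\cap\mathbf A$. Let $\mathbf T$ be a triangulated category, let $F_1,F_2\colon D^b(\mathbf E)\to\mathbf T$ be exact functors, let $\mathbf C$ be the full subcategory of $\mathbf A$ with objects $\{P_i\}_{i\in I}$, and let $f\colon F_1|_{\mathbf C}\to F_2|_{\mathbf C}$ be a natural transformation. Natural transformations of exact functors are required to be compatible with shifts. (a) Assume that (i) $\mathrm{Hom}_{\mathbf T}(F_p(A),F_q(B)[k])=0$ for $(p,q)\in\{(1,1),(2,2),(1,2)\}$, all $A,B\in D^b(\mathbf E)\cap\mathbf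 A$ and all integers $k<0$; (ii) for every $C\in D^b(\mathbf E)$ with cohomology in non-positive degrees there is $i\in I$ such that $\mathrm{Hom}_{\mathbf T}(F_1(C),F_2(P_i))=0$ and $i$ satisfies (1) and (2) for $H^0(C)$. Then there exists a unique natural transformation of exact functors $g\colon F_1\to F_2$ extending $f$. (b) Assume instead that $f$ is an isomorphism and that $F_1$ satisfies $(\vartriangle)$, that is: $\mathrm{Hom}_{\mathbf T}(F_1(A),F_1(B)[k])=0$ for all $A,B\in D^b(\mathbf E)\cap\mathbf A$ and all integers $k<0$, and for every $C\in D^b(\mathbf E)$ with cohomology in non-positive degrees there is $i\in I$ such that $\mathrm{Hom}_{\mathbf T}(F_1(C),F_1(P_i))=0$ and $i$ satisfies (1) and (2) for $H^0(C)$. Then there exists a unique natural transformation of exact functors $g\colon F_1\to F_2$ extending $f$, and $g$ is an isomorphism. -/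

import Mathlib

open CategoryTheory Category Limits Pretriangulated ZeroObject

universe w v u

namespace ExactCat

/-! ### Full exact subcategories of an abelian category -/

section Basic

variable {A : Type u} [Category.{v} A] [Abelian A]

/-- A full exact subcategory of an abelian category `A`: a full additive subcategory which is
closed under extensions. -/
class IsExactSubcategory (E : ObjectProperty A) : Prop
    extends E.ContainsZero, E.IsClosedUnderExtensions

variable (E : ObjectProperty A)

instance [IsExactSubcategory E] : E.IsClosedUnderIsomorphisms where
  of_iso {X Y} e hX := by
    obtain ⟨Z, hZ, hZ'⟩ := E.exists_prop_of_containsZero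
    let S : ShortComplex A := ShortComplex.mk e.hom (0 : Y ⟶ Z) (by simp)
    have hS : S.ShortExact :=
      { exact := (ShortComplex.exact_iff_epi S rfl).2 (by dsimp [S]; infer_instance)
        mono_f := by dsimp [S]; infer_instance
        epi_g := ⟨fun _ _ _ => hZ.eq_of_src _ _⟩ }
    exact E.prop_X₂_of_shortExact hS hX hZ'

instance [IsExactSubcategory E] : E.IsClosedUnderBinaryProducts where
  limitsOfShape_le := by
    rintro X ⟨p⟩
    refine E.prop_of_iso ?_ (E.prop_biprod (p.prop_diag_obj (.mk .left))
      (p.prop_diag_obj (.mk .right)))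
    exact IsLimit.conePointUniqueUpToIso (BinaryBiproduct.isLimit _ _)
      ((IsLimit.postcomposeHomEquiv (diagramIsoPair p.diag) _).2 p.isLimit)

instance [IsExactSubcategory E] : E.IsClosedUnderFiniteProducts := .mk'

instance [IsExactSubcategory E] : HasBinaryBiproducts E.FullSubcategory :=
  HasBinaryBiproducts.of_hasBinaryProducts

/-- The conflations (admissible short exact sequences) of the exact category `E`: the sequences
`X₁ ⟶ X₂ ⟶ X₃` in `E` which are short exact in the ambient abelian category. -/
def IsConflation (S : ShortComplex E.FullSubcategory) : Prop :=
  (S.map E.ι).ShortExact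

/-- Admissible epimorphisms (deflations) of `E`: the second morphisms of conflations. -/
def IsAdmissibleEpi {X Y : E.FullSubcategory} (p : X ⟶ Y) : Prop :=
  ∃ (Z : E.FullSubcategory) (i : Z ⟶ X) (w : i ≫ p = 0), IsConflation E (ShortComplex.mk i p w)

/-- A complex in the exact category `E` is acyclic if each differential `X n ⟶ X (n + 1)` factors
as `X n ⟶ Z (n + 1) ⟶ X (n + 1)` in such a way that all the sequences
`Z n ⟶ X n ⟶ Z (n + 1)` are conflations of `E`. -/
def IsAcyclic (X : CochainComplex E.FullSubcategory ℤ) : Prop :=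
  ∃ (Z : ℤ → E.FullSubcategory) (i : ∀ n, Z n ⟶ X.X n) (p : ∀ n, X.X n ⟶ Z (n + 1))
    (w : ∀ n, i n ≫ p n = 0),
    (∀ n, p n ≫ i (n + 1) = X.d n (n + 1)) ∧
      ∀ n, IsConflation E (ShortComplex.mk (i n) (p n) (w n))

/-- Auxiliary description of acyclicity inside the ambient abelian category: the complex is exact
and its cycles belong to `E`. -/
def HasCyclesIn (K : CochainComplex A ℤ) : Prop :=
  ∀ n, K.ExactAt n ∧ E (K.cycles n)

section

variable {E}

lemma HasCyclesIn.of_iso [E.IsClosedUnderIsomorphisms] {K L : CochainComplex A ℤ}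
    (h : HasCyclesIn E K) (e : K ≅ L) : HasCyclesIn E L := fun n =>
  ⟨(h n).1.of_iso e,
    E.prop_of_iso ((HomologicalComplex.cyclesFunctor A (.up ℤ) n).mapIso e) (h n).2⟩

lemma HasCyclesIn.shift [E.IsClosedUnderIsomorphisms] {K : CochainComplex A ℤ}
    (h : HasCyclesIn E K) (a : ℤ) : HasCyclesIn E (K⟦a⟧) := fun n => by
  have e : (K⟦a⟧).sc n ≅ K.sc (a + n) :=
    (CochainComplex.shiftShortComplexFunctorIso A a n (a + n) rfl).app K
  exact ⟨(ShortComplex.exact_iff_of_iso e).2 (h (a + n)).1,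
    E.prop_of_iso (ShortComplex.cyclesMapIso e).symm (h (a + n)).2⟩

lemma HasCyclesIn.ext [E.IsClosedUnderExtensions] {S : ShortComplex (CochainComplex A ℤ)}
    (hS : S.ShortExact) (h₁ : HasCyclesIn E S.X₁) (h₃ : HasCyclesIn E S.X₃) :
    HasCyclesIn E S.X₂ := fun n => by
  have := hS.mono_f
  have := hS.epi_g
  refine ⟨?_, ?_⟩
  · rw [HomologicalComplex.exactAt_iff_isZero_homology]
    exact (hS.homology_exact₂ n).isZero_of_both_zeros
      ((h₁ n).1.isZero_homology.eq_of_src _ _) ((h₃ n).1.isZero_homology.eq_of_tgt _ _)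
  · let T : ShortComplex A := ShortComplex.mk (HomologicalComplex.cyclesMap S.f n)
      (HomologicalComplex.cyclesMap S.g n)
      (by rw [← HomologicalComplex.cyclesMap_comp, S.zero, HomologicalComplex.cyclesMap_zero])
    have hT : T.ShortExact :=
      { exact := HomologicalComplex.cycles_left_exact S hS.exact n
        mono_f := by dsimp [T]; infer_instance
        epi_g := by
          have h : Epi (S.X₃.sc n).toCycles := (h₃ n).1.epi_toCycles
          have h' : Epi ((HomologicalComplex.shortComplexFunctor A (.up ℤ) n).map S.g).τ₁ :=
            inferInstanceAs (Epi (S.g.f _))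
          have fac := ShortComplex.toCycles_naturality
            ((HomologicalComplex.shortComplexFunctor A (.up ℤ) n).map S.g)
          have : Epi ((S.X₂.sc n).toCycles ≫ ShortComplex.cyclesMap
              ((HomologicalComplex.shortComplexFunctor A (.up ℤ) n).map S.g)) := by
            rw [fac]; exact epi_comp _ _
          exact @epi_of_epi _ _ _ _ _ (S.X₂.sc n).toCycles _ this }
    exact E.prop_X₂_of_shortExact hT (h₁ n).2 (h₃ n).2

lemma HasCyclesIn.mappingCone [E.IsClosedUnderIsomorphisms] [E.IsClosedUnderExtensions]
    {K L : CochainComplex A ℤ} (φ : K ⟶ L) (hK : HasCyclesIn E K) (hL : HasCyclesIn E L) :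
    HasCyclesIn E (CochainComplex.mappingCone φ) := by
  have hS : (CochainComplex.mappingCone.triangleRotateShortComplex φ).ShortExact :=
    HomologicalComplex.shortExact_of_degreewise_shortExact _ fun n =>
      (CochainComplex.mappingCone.triangleRotateShortComplexSplitting φ n).shortExact
  exact HasCyclesIn.ext hS hL (hK.shift 1)

end

lemma isAcyclic_iff [E.IsClosedUnderIsomorphisms] (X : CochainComplex E.FullSubcategory ℤ) :
    IsAcyclic E X ↔ HasCyclesIn E ((E.ι.mapHomologicalComplex (.up ℤ)).obj X) := by
  set K := (E.ι.mapHomologicalComplex (.up ℤ)).obj X with hK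
  constructor
  · rintro ⟨Z, i, p, w, fac, hS⟩
    have hd (n : ℤ) : (p n).hom ≫ (i (n + 1)).hom = K.d n (n + 1) :=
      congr_arg (fun φ => φ.hom) (fac n)
    have hw (n : ℤ) : (i n).hom ≫ (p n).hom = 0 := congr_arg (fun φ => φ.hom) (w n)
    have hS' (n : ℤ) : (ShortComplex.mk (i n).hom (p n).hom (hw n)).ShortExact := hS n
    have hi (n : ℤ) : Mono (i n).hom := (hS' n).mono_f
    have hp (n : ℤ) : Epi (p n).hom := (hS' n).epi_g
    intro n
    refine ⟨?_, ?_⟩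
    · obtain ⟨m, rfl⟩ : ∃ m, n = m + 1 := ⟨n - 1, by lia⟩
      rw [K.exactAt_iff' m (m + 1) (m + 1 + 1) (by simp) (by simp)]
      let S : ShortComplex A := ShortComplex.mk (K.d m (m + 1)) (p (m + 1)).hom
        ((congr_arg (fun f => f ≫ (p (m + 1)).hom) (hd m)).symm.trans ((assoc _ _ _).trans
          ((congr_arg (fun f => (p m).hom ≫ f) (hw (m + 1))).trans comp_zero)))
      let φ : S ⟶ K.sc' m (m + 1) (m + 1 + 1) :=
        { τ₁ := 𝟙 _
          τ₂ := 𝟙 _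
          τ₃ := (i (m + 1 + 1)).hom
          comm₁₂ := (id_comp _).trans (comp_id _).symm
          comm₂₃ := (id_comp _).trans (hd (m + 1)).symm }
      let ψ : S ⟶ ShortComplex.mk (i (m + 1)).hom (p (m + 1)).hom (hw (m + 1)) :=
        { τ₁ := (p m).hom
          τ₂ := 𝟙 _
          τ₃ := 𝟙 _
          comm₁₂ := (hd m).trans (comp_id _).symm
          comm₂₃ := (id_comp _).trans (comp_id _).symm }
      have : Epi φ.τ₁ := inferInstanceAs (Epi (𝟙 _))
      have : IsIso φ.τ₂ := inferInstanceAs (IsIso (𝟙 _))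
      have : Mono φ.τ₃ := hi _
      have : Epi ψ.τ₁ := hp _
      have : IsIso ψ.τ₂ := inferInstanceAs (IsIso (𝟙 _))
      have : Mono ψ.τ₃ := inferInstanceAs (Mono (𝟙 _))
      rw [← ShortComplex.exact_iff_of_epi_of_isIso_of_mono φ,
        ShortComplex.exact_iff_of_epi_of_isIso_of_mono ψ]
      exact (hS' (m + 1)).exact
    · have h₁ := K.cyclesIsKernel n (n + 1) (by simp)
      have h₂ := isKernelCompMono (hS' n).fIsKernel (i (n + 1)).hom (hd n).symm
      exact E.prop_of_iso (IsLimit.conePointUniqueUpToIso h₂ h₁) (Z n).property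
  · intro h
    have w (n : ℤ) : K.iCycles n ≫ K.toCycles n (n + 1) = 0 := by
      rw [← cancel_mono (K.iCycles (n + 1))]
      simp
    refine ⟨fun n => ⟨K.cycles n, (h n).2⟩, fun n => ObjectProperty.homMk (K.iCycles n),
      fun n => ObjectProperty.homMk (K.toCycles n (n + 1)), ?_, ?_, ?_⟩
    · intro n
      ext
      exact w n
    · intro n
      ext
      exact K.toCycles_i n (n + 1)
    · intro n
      have hT : (ShortComplex.mk (K.iCycles n) (K.toCycles n (n + 1)) (w n)).ShortExact :=
        { exact := by
            apply ShortComplex.exact_of_f_is_kernel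
            exact KernelFork.IsLimit.ofι' _ _ (fun {T} k hk => by
              refine ⟨K.liftCycles k (n + 1) (by simp) ?_, K.liftCycles_i _ _ _ _⟩
              rw [← K.toCycles_i n (n + 1), reassoc_of% hk, zero_comp])
          mono_f := by dsimp; infer_instance
          epi_g := by
            exact Preadditive.epi_of_isZero_cokernel' _
              (K.homologyIsCokernel n (n + 1) (by simp)) (h (n + 1)).1.isZero_homology }
      exact hT

end Basic

/-! ### The bounded homotopy category of an additive category -/

section Bounded

variable (C : Type u) [Category.{v} C] [Preadditive C]

/-- The objects of the homotopy category whose underlying complex is bounded on both sides. -/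
def boundedComplexes : ObjectProperty (HomotopyCategory C (ComplexShape.up ℤ)) := fun K =>
  ∃ a b : ℤ, CochainComplex.IsStrictlyGE K.as a ∧ CochainComplex.IsStrictlyLE K.as b

instance [HasZeroObject C] : (boundedComplexes C).ContainsZero where
  exists_zero := by
    have h : IsZero (0 : CochainComplex C ℤ) := isZero_zero _
    refine ⟨(HomotopyCategory.quotient _ _).obj 0, Functor.map_isZero _ h, 0, 0, ?_, ?_⟩
    · exact inferInstanceAs (CochainComplex.IsStrictlyGE (0 : CochainComplex C ℤ) 0)
    · exact inferInstanceAs (CochainComplex.IsStrictlyLE (0 : CochainComplex C ℤ) 0)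

instance : (boundedComplexes C).IsStableUnderShift ℤ where
  isStableUnderShiftBy n :=
    { le_shift := by
        intro K hK
        obtain ⟨K : CochainComplex _ _, rfl⟩ := K.quotient_obj_surjective
        obtain ⟨a, b, ha, hb⟩ := hK
        have ha' : K.IsStrictlyGE a := ha
        have hb' : K.IsStrictlyLE b := hb
        rw [ObjectProperty.prop_shift_iff, HomotopyCategory.shift_quotient_obj]
        exact ⟨a - n, b - n, K.isStrictlyGE_shift a n (a - n) (by lia),
          K.isStrictlyLE_shift b n (b - n) (by lia)⟩ }

instance [HasZeroObject C] [HasBinaryBiproducts C] :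
    (boundedComplexes C).IsTriangulatedClosed₃ where
  ext₃' := fun T hT ⟨a₁, b₁, ha₁, hb₁⟩ ⟨a₂, b₂, ha₂, hb₂⟩ => by
      obtain ⟨f : T.obj₁.as ⟶ T.obj₂.as, hf⟩ :=
        (HomotopyCategory.quotient _ _).map_surjective T.mor₁
      refine ⟨(HomotopyCategory.quotient _ _).obj (CochainComplex.mappingCone f), ?_,
        ⟨Triangle.π₃.mapIso (isoTriangleOfIso₁₂ T _ hT
          (HomotopyCategory.mappingCone_triangleh_distinguished f)
          (Iso.refl _) (Iso.refl _) ((comp_id _).trans (hf.symm.trans (id_comp _).symm)))⟩⟩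
      refine ⟨min (a₁ - 1) a₂, max b₁ b₂, ?_, ?_⟩
      · exact CochainComplex.isStrictlyGE_mappingCone f a₁ a₂ _ (by simp) (by simp)
      · refine (CochainComplex.isStrictlyLE_iff (CochainComplex.mappingCone f) _).2 ?_
        intro i hi
        simp only [max_lt_iff] at hi
        rw [CochainComplex.mappingCone.isZero_X_iff]
        exact ⟨CochainComplex.isZero_of_isStrictlyLE T.obj₁.as b₁ _ (by lia),
          CochainComplex.isZero_of_isStrictlyLE T.obj₂.as b₂ _ (by lia)⟩

instance [HasZeroObject C] [HasBinaryBiproducts C] : (boundedComplexes C).IsTriangulated where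
  toIsTriangulatedClosed₂ := .of_isTriangulatedClosed₃

end Bounded

/-! ### The bounded derived category of an exact category -/

section Derived

variable {A : Type u} [Category.{v} A] [Abelian A] (E : ObjectProperty A)

/-- The bounded homotopy category `K^b(E)`. -/
abbrev Kb := (boundedComplexes E.FullSubcategory).FullSubcategory

/-- The objects of the homotopy category `K(E)` whose underlying complex is acyclic. -/
def acyclicComplexes : ObjectProperty (HomotopyCategory E.FullSubcategory (ComplexShape.up ℤ)) :=
  fun K => IsAcyclic E K.as

variable [IsExactSubcategory E]

instance : (acyclicComplexes E).ContainsZero where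
  exists_zero := by
    have h : IsZero (0 : CochainComplex E.FullSubcategory ℤ) := isZero_zero _
    refine ⟨(HomotopyCategory.quotient _ _).obj 0, Functor.map_isZero _ h,
      (isAcyclic_iff E (0 : CochainComplex E.FullSubcategory ℤ)).2 fun n => ?_⟩
    have h' := (E.ι.mapHomologicalComplex (.up ℤ)).map_isZero h
    have hX := (HomologicalComplex.eval A (.up ℤ) n).map_isZero h'
    exact ⟨.of_isZero hX, E.prop_of_isZero
      ((HomologicalComplex.cyclesFunctor A (.up ℤ) n).map_isZero h')⟩

instance : (acyclicComplexes E).IsStableUnderShift ℤ where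
  isStableUnderShiftBy n :=
    { le_shift := by
        intro K hK
        obtain ⟨K : CochainComplex _ _, rfl⟩ := K.quotient_obj_surjective
        have h : IsAcyclic E K := hK
        rw [isAcyclic_iff] at h
        rw [ObjectProperty.prop_shift_iff, HomotopyCategory.shift_quotient_obj]
        exact (isAcyclic_iff E (K⟦n⟧)).2 ((h.shift n).of_iso
          (((E.ι.mapHomologicalComplex (.up ℤ)).commShiftIso n).app K).symm) }

instance : (acyclicComplexes E).IsTriangulatedClosed₃ where
  ext₃' T hT h₁ h₂ := by
    obtain ⟨f : T.obj₁.as ⟶ T.obj₂.as, hf⟩ :=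
      (HomotopyCategory.quotient _ _).map_surjective T.mor₁
    refine ⟨(HomotopyCategory.quotient _ _).obj (CochainComplex.mappingCone f), ?_,
      ⟨Triangle.π₃.mapIso (isoTriangleOfIso₁₂ T _ hT
        (HomotopyCategory.mappingCone_triangleh_distinguished f)
        (Iso.refl _) (Iso.refl _) ((comp_id _).trans (hf.symm.trans (id_comp _).symm)))⟩⟩
    refine (isAcyclic_iff E (CochainComplex.mappingCone f)).2 ?_
    have h₁' := (isAcyclic_iff E T.obj₁.as).1 h₁
    have h₂' := (isAcyclic_iff E T.obj₂.as).1 h₂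
    exact (HasCyclesIn.mappingCone _ h₁' h₂').of_iso
      (CochainComplex.mappingCone.mapHomologicalComplexIso f E.ι).symm

instance : (acyclicComplexes E).IsTriangulated where
  toIsTriangulatedClosed₂ := .of_isTriangulatedClosed₃

/-- The objects of `K^b(E)` which are homotopy equivalent to an acyclic complex. -/
def acyclicKb : ObjectProperty (Kb E) :=
  (acyclicComplexes E).isoClosure.inverseImage (boundedComplexes E.FullSubcategory).ι

instance : (acyclicKb E).IsTriangulated :=
  inferInstanceAs (((acyclicComplexes E).isoClosure.inverseImage
    (boundedComplexes E.FullSubcategory).ι).IsTriangulated)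

/-- The bounded derived category `D^b(E)` of the exact category `E`: the Verdier quotient of
`K^b(E)` by the acyclic complexes. -/
abbrev Db := (acyclicKb E).trW.Localization

/-- The canonical functor from `E` to `K^b(E)`, sending an object to the corresponding complex
concentrated in degree zero. -/
noncomputable def toKb : E.FullSubcategory ⥤ Kb E :=
  ObjectProperty.lift _ (HomotopyCategory.singleFunctor E.FullSubcategory 0) fun X =>
    ⟨0, 0,
      inferInstanceAs (CochainComplex.IsStrictlyGE
        ((CochainComplex.singleFunctor E.FullSubcategory 0).obj X) 0),
      inferInstanceAs (CochainComplex.IsStrictlyLE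
        ((CochainComplex.singleFunctor E.FullSubcategory 0).obj X) 0)⟩

/-- The canonical functor from `E` to `D^b(E)`. -/
noncomputable def toDb : E.FullSubcategory ⥤ Db E :=
  toKb E ⋙ (acyclicKb E).trW.Q

variable [HasDerivedCategory.{w} A]

/-- The functor `K^b(E) ⥤ D(A)` sending a complex in `E` to the same complex in `A`. -/
noncomputable def KbToDerived : Kb E ⥤ DerivedCategory A :=
  (boundedComplexes E.FullSubcategory).ι ⋙ E.ι.mapHomotopyCategory (ComplexShape.up ℤ) ⋙
    DerivedCategory.Qh

lemma KbToDerived_inverts : (acyclicKb E).trW.IsInvertedBy (KbToDerived E) := by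
  let F : Kb E ⥤ HomotopyCategory A (ComplexShape.up ℤ) :=
    (boundedComplexes E.FullSubcategory).ι ⋙ E.ι.mapHomotopyCategory (ComplexShape.up ℤ)
  have hle : acyclicKb E ≤ (HomotopyCategory.subcategoryAcyclic A).inverseImage F := by
    rintro K ⟨L, hL, ⟨e⟩⟩
    refine (HomotopyCategory.subcategoryAcyclic A).prop_of_iso
      ((E.ι.mapHomotopyCategory (ComplexShape.up ℤ)).mapIso e).symm ?_
    obtain ⟨L : CochainComplex _ _, rfl⟩ := L.quotient_obj_surjective
    have h : IsAcyclic E L := hL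
    rw [isAcyclic_iff] at h
    exact (HomotopyCategory.quotient_obj_mem_subcategoryAcyclic_iff_exactAt
      ((E.ι.mapHomologicalComplex (.up ℤ)).obj L)).2 fun n => (h n).1
  intro X Y f hf
  exact (HomotopyCategory.subcategoryAcyclic A).inverseImage_trW_isInverted F DerivedCategory.Qh f
    (ObjectProperty.trW_monotone hle _ hf)

/-- The comparison functor `D^b(E) ⥤ D(A)` induced by the inclusion of `E` in `A`. -/
noncomputable def comparison : Db E ⥤ DerivedCategory A :=
  Localization.lift (KbToDerived E) (KbToDerived_inverts E) (acyclicKb E).trW.Q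

/-- The objects of `D^b(E)` belonging to `D^b(E) ∩ A`, i.e. those whose image in `D(A)` is
isomorphic to an object of `A` placed in degree zero. -/
def IsInHeart (X : Db E) : Prop :=
  (DerivedCategory.singleFunctor A 0).essImage ((comparison E).obj X)

/-- The `n`-th cohomology object, in `A`, of an object of `D^b(E)`. -/
noncomputable def cohomology (n : ℤ) (X : Db E) : A :=
  (DerivedCategory.homologyFunctor A n).obj ((comparison E).obj X)

end Derived

/-! ### The conditions on the exact subcategory and on the set of objects `P i` -/

section Conditions

attribute [local instance] Abelian.hasFiniteBiproducts

variable (K : Type*) [Field K] {A : Type u} [Category.{v} A] [Abelian A] [Linear K A]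
  [∀ X Y : A, Module.Finite K (X ⟶ Y)]

/-- The object `Hom(P, X) ⊗ P`: a direct sum of copies of `P` indexed by a `K`-basis of
`Hom(P, X)`. -/
noncomputable def homTensor (P X : A) : A :=
  ⨁ fun _ : Fin (Module.finrank K (P ⟶ X)) => P

/-- The natural (evaluation) morphism `Hom(P, X) ⊗ P ⟶ X`. -/
noncomputable def homTensorEv (P X : A) : homTensor K P X ⟶ X :=
  biproduct.desc fun j => Module.finBasis K (P ⟶ X) j

/-- The natural morphism `Hom(P, X) ⊗ P ⟶ X` is surjective. -/
def EvSurjective (P X : A) : Prop := Epi (homTensorEv K P X)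

/-- There are `k : ℕ` and an epimorphism `P^k ⟶ X` such that the induced map
`Hom(X, X[m]) ⟶ Hom(P^k, X[m])` is zero for all integers `m ≠ 0`. -/
def HasExtKillingEpi [HasDerivedCategory.{w} A] (P X : A) : Prop :=
  ∃ (k : ℕ) (p : (⨁ fun _ : Fin k => P) ⟶ X), Epi p ∧ ∀ m : ℤ, m ≠ 0 →
    ∀ φ : (DerivedCategory.singleFunctor A 0).obj X ⟶
        ((DerivedCategory.singleFunctor A 0).obj X)⟦m⟧,
      (DerivedCategory.singleFunctor A 0).map p ≫ φ = 0

variable (E : ObjectProperty A)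

/-- A morphism of `E` is an admissible epimorphism if and only if it is an epimorphism in `A`. -/
def ConditionE1 : Prop :=
  ∀ ⦃X Y : E.FullSubcategory⦄ (p : X ⟶ Y), IsAdmissibleEpi E p ↔ Epi (E.ι.map p)

/-- Every object `X` of `A` admits an index `i` such that `P i` satisfies both `EvSurjective` and
`HasExtKillingEpi` for `X`. -/
def ConditionE2 [HasDerivedCategory.{w} A] {I : Type*} (P : I → E.FullSubcategory) : Prop :=
  ∀ X : A, ∃ i : I, EvSurjective K (P i).obj X ∧ HasExtKillingEpi (P i).obj X

/-- For every `X` in `D^b(E) ∩ A` there is an integer `N` such that `Hom(X, Y[i]) = 0` (in the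
derived category of `A`) for all `i > N` and all `Y` in `D^b(E) ∩ A`. -/
def ConditionE3 [IsExactSubcategory E] [HasDerivedCategory.{w} A] : Prop :=
  ∀ X : Db E, IsInHeart E X → ∃ N : ℤ, ∀ i : ℤ, N < i → ∀ Y : Db E, IsInHeart E Y →
    ∀ φ : (comparison E).obj X ⟶ ((comparison E).obj Y)⟦i⟧, φ = 0

end Conditions

/-! ### Conditions on exact functors and extensions of natural transformations -/

section Functors

variable (K : Type*) [Field K] {A : Type u} [Category.{v} A] [Abelian A] [Linear K A]
  [∀ X Y : A, Module.Finite K (X ⟶ Y)] [HasDerivedCategory.{w} A]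
  (E : ObjectProperty A) [IsExactSubcategory E] {I : Type*} (P : I → E.FullSubcategory)
  {T : Type*} [Category* T] [Preadditive T] [HasShift T ℤ]

/-- `Hom(F X, (G Y)[k]) = 0` for all `X`, `Y` in `D^b(E) ∩ A` and all integers `k < 0`. -/
def NoNegativeHoms (F G : Db E ⥤ T) : Prop :=
  ∀ X Y : Db E, IsInHeart E X → IsInHeart E Y → ∀ k : ℤ, k < 0 →
    ∀ φ : F.obj X ⟶ (G.obj Y)⟦k⟧, φ = 0

/-- For every `C` in `D^b(E)` with cohomology in non-positive degrees there is `i` such that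
`Hom(F C, G (P i)) = 0` and `P i` satisfies `EvSurjective` and `HasExtKillingEpi` for `H^0(C)`. -/
def HomVanishing (F G : Db E ⥤ T) : Prop :=
  ∀ C : Db E, (∀ n : ℤ, 0 < n → IsZero (cohomology E n C)) →
    ∃ i : I, (∀ φ : F.obj C ⟶ G.obj ((toDb E).obj (P i)), φ = 0) ∧
      EvSurjective K (P i).obj (cohomology E 0 C) ∧
      HasExtKillingEpi (P i).obj (cohomology E 0 C)

/-- The condition `(△)` on an exact functor `F`. -/
def ConditionTriangle (F : Db E ⥤ T) : Prop :=
  NoNegativeHoms E F F ∧ HomVanishing K E P F F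

/-- The inclusion in `D^b(E)` of the full subcategory with objects `P i`, `i : I`. -/
noncomputable def inclusionDb : (ObjectProperty.ofObj P).FullSubcategory ⥤ Db E :=
  (ObjectProperty.ofObj P).ι ⋙ toDb E

/-- `g` is a natural transformation of exact functors (i.e. compatible with shifts) which
restricts to `f` on the full subcategory with objects `P i`. -/
def IsExactExtension {F₁ F₂ : Db E ⥤ T} [F₁.CommShift ℤ] [F₂.CommShift ℤ]
    (f : inclusionDb E P ⋙ F₁ ⟶ inclusionDb E P ⋙ F₂) (g : F₁ ⟶ F₂) : Prop :=
  NatTrans.CommShift g ℤ ∧ Functor.whiskerLeft (inclusionDb E P) g = f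

end Functors

end ExactCat

set_option linter.unusedSectionVars false

namespace ExactCat

/-! ### Exactness properties of distinguished triangles -/

section Triangles

variable {D : Type*} [Category* D] [Preadditive D] [HasZeroObject D] [HasShift D ℤ]
  [∀ n : ℤ, (shiftFunctor D n).Additive] [Pretriangulated D]

/-! Write `J` for the embedding of E in D^b(E). In part (a) the hypotheses act through two
consequences: `HasNoShiftedHoms`, that maps F₁(M[1]) → F₂(N) vanish for M, N in E, and
`HasVanishingCovers`, that each M in E is covered by a finite sum Q of objects P i with Hom(F₁ Y, F₂
Q) = 0, for any prescribed complex Y in nonpositive degrees. Let `W n` be the class of complexes in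
degrees [-n, 0]. Every X in `W (n + 1)` sits in a triangle Q → X → C[1] → Q[1] with C in `W n`,
where Q may be any admissible cover of X⁰. `isResolving_toDb` collects this and the other facts
needed about D^b(E); the gluing then happens in an abstract triangulated category.

On E itself, f is extended by descending along covers Q → M. If K is the kernel, uniqueness and
naturality hold because maps F₁(K[1]) → F₂(N) vanish. For X in `W (n + 1)`, completing a morphism of
triangles gives F₁ X → F₂ X. Once Hom(F₁ X, F₂ Q) = 0, composition with F₂ X → F₂(C[1]) is injective
on maps from F₁ X, so the completion is unique; covers that also kill prescribed maps out of X give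
independence of choices and naturality (`HasVanishingCovers.exists_extension`). Every object has a
shift in some `W n`, so these extensions glue (`IsExtensionSequence.exists_natTrans`), and the same
injectivity gives uniqueness (`natTrans_ext_of_family`).

In part (b) the vanishing of Hom(F₁ C, F₁ P i) transfers to F₂ P i through f, but Hom(F₁(M[1]), F₂
N) = 0 is not immediate. A truncated resolution R of N by finite sums gives a triangle M'[m] → R → N
→ M'[m + 1], and F₁ R ≅ F₂ R is built cone by cone. For large m the last map is zero by (E3), so N
is a direct summand of R. This yields the vanishing, and also that the extension is an isomorphism
on N (`exists_retract`). Since (E3) concerns D(A), it is first carried to D^b(E) by dimension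
shifting (`isBijectiveOn_comparison`): classes of positive degree are killed by covers, in D(A) by
property (2). -/

lemma dist_comp₁₂ {X Y Z : D} {f : X ⟶ Y} {g : Y ⟶ Z} {h : Z ⟶ X⟦(1 : ℤ)⟧}
    (hT : Triangle.mk f g h ∈ distTriang D) : f ≫ g = 0 :=
  comp_distTriang_mor_zero₁₂ _ hT

lemma dist_comp₃₁ {X Y Z : D} {f : X ⟶ Y} {g : Y ⟶ Z} {h : Z ⟶ X⟦(1 : ℤ)⟧}
    (hT : Triangle.mk f g h ∈ distTriang D) : h ≫ f⟦(1 : ℤ)⟧' = 0 :=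
  comp_distTriang_mor_zero₃₁ _ hT

lemma dist_desc₂ {X Y Z W : D} {f : X ⟶ Y} {g : Y ⟶ Z} {h : Z ⟶ X⟦(1 : ℤ)⟧}
    (hT : Triangle.mk f g h ∈ distTriang D) (φ : Y ⟶ W) (hφ : f ≫ φ = 0) :
    ∃ ψ : Z ⟶ W, φ = g ≫ ψ :=
  Triangle.yoneda_exact₂ _ hT φ hφ

lemma dist_desc₃ {X Y Z W : D} {f : X ⟶ Y} {g : Y ⟶ Z} {h : Z ⟶ X⟦(1 : ℤ)⟧}
    (hT : Triangle.mk f g h ∈ distTriang D) (φ : Z ⟶ W) (hφ : g ≫ φ = 0) :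
    ∃ ψ : X⟦(1 : ℤ)⟧ ⟶ W, φ = h ≫ ψ :=
  Triangle.yoneda_exact₃ _ hT φ hφ

lemma dist_desc₁ {X Y Z W : D} {f : X ⟶ Y} {g : Y ⟶ Z} {h : Z ⟶ X⟦(1 : ℤ)⟧}
    (hT : Triangle.mk f g h ∈ distTriang D) (φ : X⟦(1 : ℤ)⟧ ⟶ W) (hφ : h ≫ φ = 0) :
    ∃ ψ : Y⟦(1 : ℤ)⟧ ⟶ W, φ = f⟦(1 : ℤ)⟧' ≫ ψ := by
  obtain ⟨ψ, hψ⟩ := Triangle.yoneda_exact₂ _ (rot_of_distTriang _ (rot_of_distTriang _ hT)) φ hφ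
  exact ⟨-(show Y⟦(1 : ℤ)⟧ ⟶ W from ψ), hψ.trans ((Preadditive.neg_comp _ _).trans
    (Preadditive.comp_neg _ _).symm)⟩

lemma dist_lift₂ {X Y Z W : D} {f : X ⟶ Y} {g : Y ⟶ Z} {h : Z ⟶ X⟦(1 : ℤ)⟧}
    (hT : Triangle.mk f g h ∈ distTriang D) (φ : W ⟶ Y) (hφ : φ ≫ g = 0) :
    ∃ ψ : W ⟶ X, φ = ψ ≫ f :=
  Triangle.coyoneda_exact₂ _ hT φ hφ

lemma dist_lift₃ {X Y Z W : D} {f : X ⟶ Y} {g : Y ⟶ Z} {h : Z ⟶ X⟦(1 : ℤ)⟧}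
    (hT : Triangle.mk f g h ∈ distTriang D) (φ : W ⟶ Z) (hφ : φ ≫ h = 0) :
    ∃ ψ : W ⟶ Y, φ = ψ ≫ g :=
  Triangle.coyoneda_exact₃ _ hT φ hφ

lemma dist_shift {X Y Z : D} {f : X ⟶ Y} {g : Y ⟶ Z} {h : Z ⟶ X⟦(1 : ℤ)⟧}
    (hT : Triangle.mk f g h ∈ distTriang D) (n : ℤ) :
    ∃ h' : Z⟦n⟧ ⟶ (X⟦n⟧)⟦(1 : ℤ)⟧, Triangle.mk (f⟦n⟧') (g⟦n⟧') h' ∈ distTriang D ∧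
      h' = n.negOnePow • (h⟦n⟧' ≫ (shiftFunctorComm D 1 n).hom.app X) := by
  refine ⟨n.negOnePow • (h⟦n⟧' ≫ (shiftFunctorComm D 1 n).hom.app X), ?_, rfl⟩
  refine isomorphic_distinguished _ (Triangle.shift_distinguished _ hT n) _ ?_
  have e : n.negOnePow * n.negOnePow = 1 := by
    rw [← Int.negOnePow_add, ← two_mul, Int.negOnePow_two_mul]
  -- The shifted triangle carries the sign (-1)^n on all three maps. Changing the sign of the middle
  -- object cancels it on the first two and leaves it on the third.
  refine Triangle.isoMk _ _ (Iso.refl (X⟦n⟧)) (n.negOnePow • Iso.refl (Y⟦n⟧))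
    (Iso.refl (Z⟦n⟧)) ?_ ?_ ?_
  · change f⟦n⟧' ≫ (n.negOnePow • Iso.refl (Y⟦n⟧)).hom = 𝟙 _ ≫ (n.negOnePow • f⟦n⟧')
    simp
  · change g⟦n⟧' ≫ 𝟙 _ = (n.negOnePow • Iso.refl (Y⟦n⟧)).hom ≫ (n.negOnePow • g⟦n⟧')
    simp [smul_smul, e]
  · change (n.negOnePow • (h⟦n⟧' ≫ (shiftFunctorComm D 1 n).hom.app X)) ≫ (𝟙 (X⟦n⟧))⟦1⟧' =
      𝟙 _ ≫ (n.negOnePow • (h⟦n⟧' ≫ (shiftFunctorComm D 1 n).hom.app X))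
    rw [CategoryTheory.Functor.map_id]
    exact (comp_id _).trans (id_comp _).symm

end Triangles

/-! ### The action of shifts on morphisms between values of functors -/

section ShiftHom

variable {D T : Type*} [Category* D] [HasShift D ℤ] [Category* T] [HasShift T ℤ]
  {F₁ F₂ : D ⥤ T} [F₁.CommShift ℤ] [F₂.CommShift ℤ]

/-- The morphism `F₁ (X⟦a⟧) ⟶ F₂ (X⟦a⟧)` obtained by shifting a morphism `F₁ X ⟶ F₂ X`. -/
noncomputable def shiftHom (a : ℤ) {X : D} (α : F₁.obj X ⟶ F₂.obj X) :
    F₁.obj (X⟦a⟧) ⟶ F₂.obj (X⟦a⟧) :=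
  (F₁.commShiftIso a).hom.app X ≫ α⟦a⟧' ≫ (F₂.commShiftIso a).inv.app X

lemma shiftHom_naturality (a : ℤ) {X Y : D} {h : X ⟶ Y} {α : F₁.obj X ⟶ F₂.obj X}
    {β : F₁.obj Y ⟶ F₂.obj Y} (comm : F₁.map h ≫ β = α ≫ F₂.map h) :
    F₁.map (h⟦a⟧') ≫ shiftHom a β = shiftHom a α ≫ F₂.map (h⟦a⟧') := by
  have := congr_arg (fun φ => φ⟦a⟧') comm
  simp only [Functor.map_comp] at this
  simp only [shiftHom, assoc, Functor.commShiftIso_hom_naturality_assoc, reassoc_of% this,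
    Functor.commShiftIso_inv_naturality]

lemma shiftHom_injective (a : ℤ) {X : D} {α β : F₁.obj X ⟶ F₂.obj X}
    (h : shiftHom a α = shiftHom a β) : α = β := by
  apply (shiftFunctor T a).map_injective
  unfold shiftHom at h
  rwa [cancel_epi, cancel_mono] at h

lemma shiftHom_surjective (a : ℤ) {X : D} (β : F₁.obj (X⟦a⟧) ⟶ F₂.obj (X⟦a⟧)) :
    ∃ α : F₁.obj X ⟶ F₂.obj X, shiftHom a α = β :=
  ⟨(shiftFunctor T a).preimage
    ((F₁.commShiftIso a).inv.app X ≫ β ≫ (F₂.commShiftIso a).hom.app X), by simp [shiftHom]⟩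

lemma shiftHom_add (a b c : ℤ) (h : a + b = c) {X : D} (α : F₁.obj X ⟶ F₂.obj X) :
    F₁.map ((shiftFunctorAdd' D a b c h).hom.app X) ≫ shiftHom b (shiftHom a α) =
      shiftHom c α ≫ F₂.map ((shiftFunctorAdd' D a b c h).hom.app X) := by
  have e := (shiftFunctorAdd' T a b c h).hom.naturality α
  dsimp at e
  simp only [shiftHom, Functor.commShiftIso_add' _ h, Functor.CommShift.isoAdd'_hom_app,
    Functor.CommShift.isoAdd'_inv_app, assoc, Functor.map_comp, ← F₂.map_comp,
    Iso.inv_hom_id_app, Functor.comp_obj]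
  simp [reassoc_of% e]

lemma isIso_shiftHom (a : ℤ) {X : D} (α : F₁.obj X ⟶ F₂.obj X) [IsIso α] :
    IsIso (shiftHom a α) := by
  unfold shiftHom
  infer_instance

lemma isIso_of_isIso_shiftHom (a : ℤ) {X : D} (α : F₁.obj X ⟶ F₂.obj X)
    [IsIso (shiftHom a α)] : IsIso α := by
  have : α⟦a⟧' = (F₁.commShiftIso a).inv.app X ≫ shiftHom a α ≫
      (F₂.commShiftIso a).hom.app X := by simp [shiftHom]
  have : IsIso (α⟦a⟧') := by rw [this]; infer_instance
  exact isIso_of_reflects_iso α (shiftFunctor T a)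

lemma natTrans_app_shift {g : F₁ ⟶ F₂} (hg : NatTrans.CommShift g ℤ) (a : ℤ) (X : D) :
    g.app (X⟦a⟧) = shiftHom a (g.app X) :=
  NatTrans.app_shift g a X

lemma commShift_of_app_shift {g : F₁ ⟶ F₂}
    (hg : ∀ (a : ℤ) (X : D), g.app (X⟦a⟧) = shiftHom a (g.app X)) : NatTrans.CommShift g ℤ where
  shift_comm a := by
    ext X
    simp [hg, shiftHom]

end ShiftHom

/-! ### Morphisms between the images of a triangle under two exact functors -/

section TriangleHom

variable {D T : Type*} [Category* D] [Preadditive D] [HasZeroObject D] [HasShift D ℤ]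
  [∀ n : ℤ, (shiftFunctor D n).Additive] [Pretriangulated D]
  [Category* T] [Preadditive T] [HasZeroObject T] [HasShift T ℤ]
  [∀ n : ℤ, (shiftFunctor T n).Additive] [Pretriangulated T]

lemma map_dist (F : D ⥤ T) [F.CommShift ℤ] [F.IsTriangulated]
    {X Y Z : D} {f : X ⟶ Y} {g : Y ⟶ Z} {h : Z ⟶ X⟦(1 : ℤ)⟧}
    (hT : Triangle.mk f g h ∈ distTriang D) :
    Triangle.mk (F.map f) (F.map g) (F.map h ≫ (F.commShiftIso (1 : ℤ)).hom.app X) ∈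
      distTriang T :=
  F.map_distinguished _ hT

variable {F₁ F₂ : D ⥤ T} [F₁.CommShift ℤ] [F₂.CommShift ℤ] [F₁.IsTriangulated]
  [F₂.IsTriangulated] {X Y Z : D} {f : X ⟶ Y} {g : Y ⟶ Z} {h : Z ⟶ X⟦(1 : ℤ)⟧}

/-- `shiftHom 1` absorbs the isomorphisms `commShiftIso` occurring in the image triangles, so that
all three squares take the form of naturality squares for F₁ and F₂. -/
lemma exists_hom₂ (hT : Triangle.mk f g h ∈ distTriang D) (α : F₁.obj X ⟶ F₂.obj X)
    (γ : F₁.obj Z ⟶ F₂.obj Z) (comm : F₁.map h ≫ shiftHom 1 α = γ ≫ F₂.map h) :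
    ∃ β : F₁.obj Y ⟶ F₂.obj Y, F₁.map f ≫ β = α ≫ F₂.map f ∧ F₁.map g ≫ γ = β ≫ F₂.map g := by
  refine complete_distinguished_triangle_morphism₂ _ _ (map_dist F₁ hT) (map_dist F₂ hT) α γ ?_
  change (F₁.map h ≫ (F₁.commShiftIso (1 : ℤ)).hom.app X) ≫ α⟦1⟧' =
    γ ≫ F₂.map h ≫ (F₂.commShiftIso (1 : ℤ)).hom.app X
  rw [← reassoc_of% comm]
  simp [shiftHom]

lemma exists_hom₃ (hT : Triangle.mk f g h ∈ distTriang D) (α : F₁.obj X ⟶ F₂.obj X)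
    (β : F₁.obj Y ⟶ F₂.obj Y) (comm : F₁.map f ≫ β = α ≫ F₂.map f) :
    ∃ γ : F₁.obj Z ⟶ F₂.obj Z, F₁.map g ≫ γ = β ≫ F₂.map g ∧
      F₁.map h ≫ shiftHom 1 α = γ ≫ F₂.map h := by
  obtain ⟨γ, h₁, h₂⟩ : ∃ γ : F₁.obj Z ⟶ F₂.obj Z, F₁.map g ≫ γ = β ≫ F₂.map g ∧
      (F₁.map h ≫ (F₁.commShiftIso (1 : ℤ)).hom.app X) ≫ α⟦1⟧' =
        γ ≫ F₂.map h ≫ (F₂.commShiftIso (1 : ℤ)).hom.app X :=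
    complete_distinguished_triangle_morphism _ _ (map_dist F₁ hT) (map_dist F₂ hT) α β comm
  refine ⟨γ, h₁, ?_⟩
  have h₃ : γ ≫ F₂.map h = (γ ≫ F₂.map h ≫ (F₂.commShiftIso (1 : ℤ)).hom.app X) ≫
      (F₂.commShiftIso (1 : ℤ)).inv.app X := by simp
  rw [h₃, ← h₂]
  simp [shiftHom]

lemma isIso_hom₂ (hT : Triangle.mk f g h ∈ distTriang D) (α : F₁.obj X ⟶ F₂.obj X)
    (β : F₁.obj Y ⟶ F₂.obj Y) (γ : F₁.obj Z ⟶ F₂.obj Z) (comm₁ : F₁.map f ≫ β = α ≫ F₂.map f)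
    (comm₂ : F₁.map g ≫ γ = β ≫ F₂.map g) (comm₃ : F₁.map h ≫ shiftHom 1 α = γ ≫ F₂.map h)
    [IsIso α] [IsIso γ] : IsIso β := by
  have h₃ : (F₁.map h ≫ (F₁.commShiftIso (1 : ℤ)).hom.app X) ≫ α⟦1⟧' =
    γ ≫ F₂.map h ≫ (F₂.commShiftIso (1 : ℤ)).hom.app X := by
      rw [← reassoc_of% comm₃]
      simp [shiftHom]
  exact isIso₂_of_isIso₁₃ (T := Triangle.mk _ _ _) (T' := Triangle.mk _ _ _)
    { hom₁ := α, hom₂ := β, hom₃ := γ, comm₁ := comm₁, comm₂ := comm₂, comm₃ := h₃ }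
    (map_dist F₁ hT) (map_dist F₂ hT) ‹_› ‹_›

lemma isIso_hom₃ (hT : Triangle.mk f g h ∈ distTriang D) (α : F₁.obj X ⟶ F₂.obj X)
    (β : F₁.obj Y ⟶ F₂.obj Y) (γ : F₁.obj Z ⟶ F₂.obj Z) (comm₁ : F₁.map f ≫ β = α ≫ F₂.map f)
    (comm₂ : F₁.map g ≫ γ = β ≫ F₂.map g) (comm₃ : F₁.map h ≫ shiftHom 1 α = γ ≫ F₂.map h)
    [IsIso α] [IsIso β] : IsIso γ := by
  have h₃ : (F₁.map h ≫ (F₁.commShiftIso (1 : ℤ)).hom.app X) ≫ α⟦1⟧' =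
    γ ≫ F₂.map h ≫ (F₂.commShiftIso (1 : ℤ)).hom.app X := by
      rw [← reassoc_of% comm₃]
      simp [shiftHom]
  exact isIso₃_of_isIso₁₂ (T := Triangle.mk _ _ _) (T' := Triangle.mk _ _ _)
    { hom₁ := α, hom₂ := β, hom₃ := γ, comm₁ := comm₁, comm₂ := comm₂, comm₃ := h₃ }
    (map_dist F₁ hT) (map_dist F₂ hT) ‹_› ‹_›

end TriangleHom

/-! ### Resolving subcategories of triangulated categories -/

section Covers

variable {B D T : Type*} [Category* B] [Preadditive B]
  [Category* D] [Preadditive D] [HasZeroObject D] [HasShift D ℤ]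
  [∀ n : ℤ, (shiftFunctor D n).Additive] [Pretriangulated D]
  [Category* T] [Preadditive T] [HasZeroObject T] [HasShift T ℤ]
  [∀ n : ℤ, (shiftFunctor T n).Additive] [Pretriangulated T]

/-- Axioms satisfied by the embedding `J : B ⥤ D` of an exact category in its bounded derived
category, the class `e` of admissible epimorphisms, and the objects `W n` of `D` that are
represented by complexes concentrated in degrees `-n, …, 0`. -/
structure IsResolving (J : B ⥤ D) (e : MorphismProperty B) (W : ℕ → ObjectProperty D) : Prop where
  full : J.Full
  faithful : J.Faithful
  additive : J.Additive
  comp {X Y Z : B} (p : X ⟶ Y) (q : Y ⟶ Z) : e p → e q → e (p ≫ q)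
  kernel {X Y : B} (p : X ⟶ Y) : e p → ∃ (N : B) (i : N ⟶ X) (δ : J.obj Y ⟶ (J.obj N)⟦(1 : ℤ)⟧),
    Triangle.mk (J.map i) (J.map p) δ ∈ distTriang D
  iso (n : ℕ) : (W n).IsClosedUnderIsomorphisms
  mono (n : ℕ) : W n ≤ W (n + 1)
  shift (n : ℕ) (X : D) : W n X → W (n + 1) (X⟦(1 : ℤ)⟧)
  mem (M : B) : W 0 (J.obj M)
  zero (X : D) : W 0 X → ∃ M : B, Nonempty (J.obj M ≅ X)
  -- For complexes, `M` is the degree zero term. Quantifying over all admissible `p` after `M` is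
  -- fixed is what later allows a cover to be refined.
  succ (n : ℕ) (X : D) : W (n + 1) X → ∃ (M : B) (i : J.obj M ⟶ X), ∀ (P : B) (p : P ⟶ M), e p →
    ∃ (C : D) (c : X ⟶ C⟦(1 : ℤ)⟧) (w : C⟦(1 : ℤ)⟧ ⟶ (J.obj P)⟦(1 : ℤ)⟧), W n C ∧
      Triangle.mk (J.map p ≫ i) c w ∈ distTriang D
  -- Effaceability: maps into complexes in negative degrees die on a cover.
  kill (n : ℕ) (C : D) (M : B) (v : J.obj M ⟶ C⟦(1 : ℤ)⟧) : W n C →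
    ∃ (P : B) (p : P ⟶ M), e p ∧ J.map p ≫ v = 0
  exhaust (X : D) : ∃ (n : ℕ) (m : ℤ), W n (X⟦m⟧)

/-- `Q` is a direct summand of a finite direct sum of objects `P i`. -/
def IsFiniteSum {I : Type*} (P : I → B) (Q : B) : Prop :=
  ∃ (k : ℕ) (i : Fin k → I) (π : ∀ j, Q ⟶ P (i j)) (ι : ∀ j, P (i j) ⟶ Q), ∑ j, π j ≫ ι j = 𝟙 Q

variable {J : B ⥤ D} {e : MorphismProperty B} {W : ℕ → ObjectProperty D} {I : Type*} {P : I → B}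
  {F₁ F₂ : D ⥤ T} [F₁.CommShift ℤ] [F₁.IsTriangulated] [F₂.CommShift ℤ] [F₂.IsTriangulated]

variable (J P F₁ F₂) in
/-- Every object of `B` is covered by a finite direct sum `Q` of objects `P i` such that
`Hom(F₁ Y, F₂ Q) = 0`. -/
def HasVanishingCovers (e : MorphismProperty B) (W : ℕ → ObjectProperty D) : Prop :=
  ∀ (n : ℕ) (Y : D), W n Y → ∀ M : B, ∃ (Q : B) (p : Q ⟶ M), e p ∧ IsFiniteSum P Q ∧
    ∀ φ : F₁.obj Y ⟶ F₂.obj (J.obj Q), φ = 0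

variable (J F₁ F₂) in
/-- `Hom(F₁ M[1], F₂ N) = 0` for all `M`, `N` in `B`. -/
def HasNoShiftedHoms : Prop :=
  ∀ (M N : B) (φ : F₁.obj ((J.obj M)⟦(1 : ℤ)⟧) ⟶ F₂.obj (J.obj N)), φ = 0

lemma IsResolving.le_add (S : IsResolving J e W) (n k : ℕ) : W n ≤ W (n + k) := by
  induction k with
  | zero => exact le_rfl
  | succ k ih => exact ih.trans (S.mono _)

/-- The obstruction to lifting `u` through `p` is `J.map u ≫ δ`, which `kill` removes after passing
to a cover of Z; fullness brings the lift back to `B`. -/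
lemma IsResolving.exists_factor (S : IsResolving J e W) {X Y N Z : B} {p : X ⟶ Y} {i : N ⟶ X}
    {δ : J.obj Y ⟶ (J.obj N)⟦(1 : ℤ)⟧} (hT : Triangle.mk (J.map i) (J.map p) δ ∈ distTriang D)
    (u : Z ⟶ Y) : ∃ (R : B) (r : R ⟶ Z) (s : R ⟶ X), e r ∧ s ≫ p = r ≫ u := by
  have := S.full
  have := S.faithful
  obtain ⟨R, r, hr, h⟩ := S.kill 0 (J.obj N) Z (J.map u ≫ δ) (S.mem N)
  obtain ⟨t, ht⟩ := dist_lift₃ hT (J.map (r ≫ u)) (by rw [Functor.map_comp, assoc, h])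
  refine ⟨R, r, J.preimage t, hr, J.map_injective ?_⟩
  rw [ht, Functor.map_comp, J.map_preimage]

lemma HasVanishingCovers.exists_cover (S : IsResolving J e W)
    (hcov : HasVanishingCovers J P F₁ F₂ e W) (M : B) :
    ∃ (Q : B) (p : Q ⟶ M), e p ∧ IsFiniteSum P Q := by
  obtain ⟨Q, p, hp, hQ, -⟩ := hcov 0 (J.obj M) (S.mem M) M
  exact ⟨Q, p, hp, hQ⟩

/-- A morphism killed by `p` factors through F₁(K[1]), where K is the kernel of `p`, and there are
no nonzero maps from there to F₂ N. -/
lemma eq_zero_of_map_epi_comp (S : IsResolving J e W) (hneg : HasNoShiftedHoms J F₁ F₂)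
    {Q M N : B} (p : Q ⟶ M) (hp : e p) (φ : F₁.obj (J.obj M) ⟶ F₂.obj (J.obj N))
    (h : F₁.map (J.map p) ≫ φ = 0) : φ = 0 := by
  obtain ⟨K, i, δ, hT⟩ := S.kernel p hp
  obtain ⟨ψ, rfl⟩ := dist_desc₃ (map_dist F₁ hT) φ h
  rw [assoc, hneg _ _ ((F₁.commShiftIso (1 : ℤ)).hom.app _ ≫ ψ), comp_zero]

/-- A family of morphisms `F₁ (P i) ⟶ F₂ (P i)` which is natural with respect to the morphisms
between the objects `P i`. -/
def IsNaturalFamily (J : B ⥤ D) (fam : ∀ i : I, F₁.obj (J.obj (P i)) ⟶ F₂.obj (J.obj (P i))) :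
    Prop :=
  ∀ (i j : I) (u : P i ⟶ P j), F₁.map (J.map u) ≫ fam j = fam i ≫ F₂.map (J.map u)

section Family

variable {fam : ∀ i : I, F₁.obj (J.obj (P i)) ⟶ F₂.obj (J.obj (P i))}

lemma map_finiteSum [J.Additive] (F : D ⥤ T) [F.Additive] {M Q : B} {k : ℕ} {i : Fin k → I}
    {π : ∀ j, Q ⟶ P (i j)} {ι : ∀ j, P (i j) ⟶ Q} (hsum : ∑ j, π j ≫ ι j = 𝟙 Q) (p : Q ⟶ M) :
    F.map (J.map p) = ∑ j, F.map (J.map (π j)) ≫ F.map (J.map (ι j ≫ p)) := by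
  have h : p = ∑ j, π j ≫ ι j ≫ p := by
    simp only [← assoc, ← Preadditive.sum_comp, hsum, id_comp]
  conv_lhs => rw [h]
  simp only [Functor.map_sum, Functor.map_comp]

lemma map_finiteSum_comp_eq_zero [J.Additive] {M Q : B} (hQ : IsFiniteSum P Q) (p : Q ⟶ M) {Y : T}
    (φ : F₁.obj (J.obj M) ⟶ Y) (h : ∀ (i : I) (u : P i ⟶ M), F₁.map (J.map u) ≫ φ = 0) :
    F₁.map (J.map p) ≫ φ = 0 := by
  obtain ⟨k, i, π, ι, hsum⟩ := hQ
  rw [map_finiteSum F₁ hsum p, Preadditive.sum_comp]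
  exact Finset.sum_eq_zero fun j _ => by rw [assoc, h, comp_zero]

lemma eq_zero_of_family (S : IsResolving J e W) (hneg : HasNoShiftedHoms J F₁ F₂)
    (hgen : ∀ M : B, ∃ (Q : B) (p : Q ⟶ M), e p ∧ IsFiniteSum P Q)
    {M N : B} (φ : F₁.obj (J.obj M) ⟶ F₂.obj (J.obj N))
    (h : ∀ (i : I) (u : P i ⟶ M), F₁.map (J.map u) ≫ φ = 0) : φ = 0 := by
  have := S.additive
  obtain ⟨Q, p, hp, hQ⟩ := hgen M
  exact eq_zero_of_map_epi_comp S hneg p hp φ (map_finiteSum_comp_eq_zero hQ p φ h)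

lemma eq_of_family (S : IsResolving J e W) (hneg : HasNoShiftedHoms J F₁ F₂)
    (hgen : ∀ M : B, ∃ (Q : B) (p : Q ⟶ M), e p ∧ IsFiniteSum P Q)
    {M N : B} (φ ψ : F₁.obj (J.obj M) ⟶ F₂.obj (J.obj N))
    (h : ∀ (i : I) (u : P i ⟶ M), F₁.map (J.map u) ≫ φ = F₁.map (J.map u) ≫ ψ) : φ = ψ := by
  rw [← sub_eq_zero]
  exact eq_zero_of_family S hneg hgen _ fun i u => by rw [Preadditive.comp_sub, h, sub_self]

/-- The family is transported along the chosen decomposition of Q; naturality applied to the maps `u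
≫ π j` makes it compatible with every `u`, whatever the decomposition. -/
lemma exists_hom_finiteSum [J.Additive] (hfam : IsNaturalFamily J fam) {Q : B}
    (hQ : IsFiniteSum P Q) : ∃ γ : F₁.obj (J.obj Q) ⟶ F₂.obj (J.obj Q),
      ∀ (i : I) (u : P i ⟶ Q), F₁.map (J.map u) ≫ γ = fam i ≫ F₂.map (J.map u) := by
  obtain ⟨k, i, π, ι, hsum⟩ := hQ
  refine ⟨∑ j, F₁.map (J.map (π j)) ≫ fam (i j) ≫ F₂.map (J.map (ι j)), fun l u => ?_⟩
  have h (j) : F₁.map (J.map u) ≫ F₁.map (J.map (π j)) ≫ fam (i j) ≫ F₂.map (J.map (ι j)) =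
      fam l ≫ F₂.map (J.map (u ≫ π j ≫ ι j)) := by
    rw [← F₁.map_comp_assoc, ← J.map_comp, reassoc_of% hfam l (i j) (u ≫ π j), ← F₂.map_comp,
      ← J.map_comp, assoc]
  simp only [Preadditive.comp_sum, h]
  simp only [← Preadditive.comp_sum, ← Functor.map_sum, hsum, comp_id]

lemma exists_hom_of_family (S : IsResolving J e W) (hneg : HasNoShiftedHoms J F₁ F₂)
    (hgen : ∀ M : B, ∃ (Q : B) (p : Q ⟶ M), e p ∧ IsFiniteSum P Q)
    (hfam : IsNaturalFamily J fam) (M : B) : ∃ g : F₁.obj (J.obj M) ⟶ F₂.obj (J.obj M),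
      ∀ (i : I) (u : P i ⟶ M), F₁.map (J.map u) ≫ g = fam i ≫ F₂.map (J.map u) := by
  have := S.additive
  obtain ⟨Q, p, hp, hQ⟩ := hgen M
  obtain ⟨γ, hγ⟩ := exists_hom_finiteSum hfam hQ
  obtain ⟨K, i, δ, hT⟩ := S.kernel p hp
  have hip : i ≫ p = 0 := S.faithful.map_injective (by
    rw [J.map_comp, dist_comp₁₂ hT, J.map_zero])
  -- To descend along `p`, the composite must vanish on F₁ K. This is tested on maps from the
  -- objects P l to K, where γ turns into `fam l` and `i ≫ p = 0` applies.
  obtain ⟨g, hg⟩ := dist_desc₂ (map_dist F₁ hT) (γ ≫ F₂.map (J.map p))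
    (eq_zero_of_family S hneg hgen _ fun l u => by
      rw [← assoc, ← F₁.map_comp, ← J.map_comp, ← assoc, hγ, assoc, ← F₂.map_comp, ← J.map_comp,
        assoc, hip]
      simp)
  refine ⟨g, fun l u => ?_⟩
  -- `u` need not lift along `p`, but it does after a cover `r`, and equality may be tested after
  -- `r`.
  obtain ⟨R, r, s, hr, hs⟩ := S.exists_factor hT u
  rw [← sub_eq_zero]
  refine eq_zero_of_map_epi_comp S hneg r hr _ (eq_zero_of_family S hneg hgen _ fun j w => ?_)
  have h₁ : F₁.map (J.map w) ≫ F₁.map (J.map r) ≫ F₁.map (J.map u) ≫ g =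
      fam j ≫ F₂.map (J.map (w ≫ r ≫ u)) := by
    rw [← F₁.map_comp_assoc (J.map r), ← J.map_comp, ← hs, J.map_comp, F₁.map_comp, assoc, ← hg,
      ← F₁.map_comp_assoc, ← J.map_comp, reassoc_of% hγ j (w ≫ s), ← F₂.map_comp, ← J.map_comp,
      assoc]
  have h₂ : F₁.map (J.map w) ≫ F₁.map (J.map r) ≫ fam l ≫ F₂.map (J.map u) =
      fam j ≫ F₂.map (J.map (w ≫ r ≫ u)) := by
    rw [← F₁.map_comp_assoc, ← J.map_comp, reassoc_of% hfam j l (w ≫ r), ← F₂.map_comp,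
      ← J.map_comp, assoc]
  rw [Preadditive.comp_sub, Preadditive.comp_sub, h₁, h₂, sub_self]

end Family

/-- A family of morphisms `F₁ X ⟶ F₂ X` is natural on the full subcategory given by `V`. -/
def NaturalOn (V : ObjectProperty D) (τ : ∀ X : D, F₁.obj X ⟶ F₂.obj X) : Prop :=
  ∀ ⦃X Y : D⦄ (h : X ⟶ Y), V X → V Y → F₁.map h ≫ τ Y = τ X ≫ F₂.map h

lemma exists_naturalOn_zero (S : IsResolving J e W) (hneg : HasNoShiftedHoms J F₁ F₂)
    (hgen : ∀ M : B, ∃ (Q : B) (p : Q ⟶ M), e p ∧ IsFiniteSum P Q)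
    {fam : ∀ i : I, F₁.obj (J.obj (P i)) ⟶ F₂.obj (J.obj (P i))} (hfam : IsNaturalFamily J fam) :
    ∃ τ : ∀ X : D, F₁.obj X ⟶ F₂.obj X, NaturalOn (W 0) τ ∧ ∀ i, τ (J.obj (P i)) = fam i := by
  have := S.full
  choose g hg using exists_hom_of_family S hneg hgen hfam
  have nat {M N : B} (u : M ⟶ N) : F₁.map (J.map u) ≫ g N = g M ≫ F₂.map (J.map u) :=
    eq_of_family S hneg hgen _ _ fun i w => by
      rw [← F₁.map_comp_assoc, ← J.map_comp, hg, reassoc_of% hg M i w, ← F₂.map_comp, ← J.map_comp]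
  have key (X : D) : ∃ α : F₁.obj X ⟶ F₂.obj X, W 0 X → ∀ (M : B) (v : J.obj M ⟶ X),
      F₁.map v ≫ α = g M ≫ F₂.map v := by
    by_cases hX : W 0 X
    · obtain ⟨N, ⟨ε⟩⟩ := S.zero X hX
      refine ⟨F₁.map ε.inv ≫ g N ≫ F₂.map ε.hom, fun _ M v => ?_⟩
      obtain ⟨u, hu⟩ := J.map_surjective (v ≫ ε.inv)
      rw [← F₁.map_comp_assoc, ← hu, reassoc_of% nat u, ← F₂.map_comp, hu, assoc, ε.inv_hom_id,
        comp_id]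
    -- The family is a total function on `D`; outside the relevant class its value is a dummy.
    · exact ⟨0, fun h => (hX h).elim⟩
  choose τ hτ using key
  refine ⟨τ, fun X Y h hX hY => ?_, fun i => ?_⟩
  · obtain ⟨N, ⟨ε⟩⟩ := S.zero X hX
    rw [← cancel_epi (F₁.map ε.hom), ← F₁.map_comp_assoc, hτ Y hY, reassoc_of% hτ X hX,
      F₂.map_comp]
  · have h₁ := hτ _ (S.mem (P i)) (P i) (𝟙 _)
    have h₂ := hg (P i) i (𝟙 _)
    simp only [CategoryTheory.Functor.map_id, id_comp, comp_id] at h₁ h₂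
    rw [h₁, h₂]

lemma HasVanishingCovers.exists_triangle (S : IsResolving J e W)
    (hcov : HasVanishingCovers J P F₁ F₂ e W) {n m : ℕ} {X Y : D} (hX : W (n + 1) X)
    (hY : W m Y) : ∃ (Q : B) (p : J.obj Q ⟶ X) (C : D) (c : X ⟶ C⟦(1 : ℤ)⟧)
      (w : C⟦(1 : ℤ)⟧ ⟶ (J.obj Q)⟦(1 : ℤ)⟧), W n C ∧ Triangle.mk p c w ∈ distTriang D ∧
        ∀ φ : F₁.obj Y ⟶ F₂.obj (J.obj Q), φ = 0 := by
  obtain ⟨M, i, hM⟩ := S.succ n X hX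
  obtain ⟨Q, q, hq, -, hQ⟩ := hcov m Y hY M
  obtain ⟨C, c, w, hC, hT⟩ := hM Q q hq
  exact ⟨Q, _, C, c, w, hC, hT, hQ⟩

/-- Since `succ` accepts every admissible epimorphism onto M, covers can be composed: one kills
`u₁`, the next kills `u₂`, and the last one provides the vanishing. -/
lemma HasVanishingCovers.exists_triangle_of_comp_eq_zero (S : IsResolving J e W)
    (hcov : HasVanishingCovers J P F₁ F₂ e W) {n m : ℕ} {X Y Z₁ Z₂ : D} (hX : W (n + 1) X)
    (hY : W m Y) (h₁ : W n Z₁) (h₂ : W n Z₂) (u₁ : X ⟶ Z₁⟦(1 : ℤ)⟧) (u₂ : X ⟶ Z₂⟦(1 : ℤ)⟧) :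
    ∃ (Q : B) (p : J.obj Q ⟶ X) (C : D) (c : X ⟶ C⟦(1 : ℤ)⟧)
      (w : C⟦(1 : ℤ)⟧ ⟶ (J.obj Q)⟦(1 : ℤ)⟧), W n C ∧ Triangle.mk p c w ∈ distTriang D ∧
        p ≫ u₁ = 0 ∧ p ≫ u₂ = 0 ∧ ∀ φ : F₁.obj Y ⟶ F₂.obj (J.obj Q), φ = 0 := by
  obtain ⟨M, i, hM⟩ := S.succ n X hX
  obtain ⟨Q₁, q₁, hq₁, e₁⟩ := S.kill n Z₁ M (i ≫ u₁) h₁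
  obtain ⟨Q₂, q₂, hq₂, e₂⟩ := S.kill n Z₂ Q₁ (J.map q₁ ≫ i ≫ u₂) h₂
  obtain ⟨Q₃, q₃, hq₃, -, hQ₃⟩ := hcov m Y hY Q₂
  obtain ⟨C, c, w, hC, hT⟩ := hM Q₃ (q₃ ≫ q₂ ≫ q₁) (S.comp _ _ hq₃ (S.comp _ _ hq₂ hq₁))
  refine ⟨Q₃, _, C, c, w, hC, hT, ?_, ?_, hQ₃⟩
  · simp only [J.map_comp, assoc, e₁, comp_zero]
  · simp only [J.map_comp, assoc, e₂, comp_zero]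

/-- The difference of the two maps factors through F₂ A. This is the rigidity behind every
uniqueness statement in positive length. -/
lemma eq_of_comp_map_of_vanishing {X Y C A : D} {p : A ⟶ X} {c : X ⟶ C} {w : C ⟶ A⟦(1 : ℤ)⟧}
    (hT : Triangle.mk p c w ∈ distTriang D) (h : ∀ φ : F₁.obj Y ⟶ F₂.obj A, φ = 0)
    (α β : F₁.obj Y ⟶ F₂.obj X) (hαβ : α ≫ F₂.map c = β ≫ F₂.map c) : α = β := by
  obtain ⟨ψ, hψ⟩ := dist_lift₂ (map_dist F₂ hT) (α - β) (by
    rw [Preadditive.sub_comp, hαβ, sub_self])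
  rw [← sub_eq_zero, hψ, h ψ, zero_comp]

lemma NaturalOn.shiftHom {V : ObjectProperty D} {τ : ∀ X : D, F₁.obj X ⟶ F₂.obj X}
    (hτ : NaturalOn V τ) {X Y : D} (hX : V X) (hY : V Y) {a : ℤ} (h : X⟦a⟧ ⟶ Y⟦a⟧) :
    F₁.map h ≫ shiftHom a (τ Y) = ExactCat.shiftHom a (τ X) ≫ F₂.map h := by
  obtain ⟨h, rfl⟩ := (shiftFunctor D a).map_surjective h
  exact shiftHom_naturality a (hτ h hX hY)

/-- The inductive step on length. Compatibility with every map from X to some Z[1], rather than only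
with the one in the chosen triangle, is what makes the extension natural and independent of choices.
-/
lemma HasVanishingCovers.exists_extension (S : IsResolving J e W)
    (hcov : HasVanishingCovers J P F₁ F₂ e W) {n : ℕ} {τ : ∀ X : D, F₁.obj X ⟶ F₂.obj X}
    (hτ : NaturalOn (W n) τ) : ∃ τ' : ∀ X : D, F₁.obj X ⟶ F₂.obj X, NaturalOn (W (n + 1)) τ' ∧
      ∀ X, W (n + 1) X → ∀ Z, W n Z → ∀ c : X ⟶ Z⟦(1 : ℤ)⟧,
        F₁.map c ≫ shiftHom 1 (τ Z) = τ' X ≫ F₂.map c := by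
  have hJ (Q : B) : W n (J.obj Q) := by simpa using S.le_add 0 n _ (S.mem Q)
  have key (X : D) : ∃ α : F₁.obj X ⟶ F₂.obj X, W (n + 1) X → ∀ Z, W n Z →
      ∀ c : X ⟶ Z⟦(1 : ℤ)⟧, F₁.map c ≫ shiftHom 1 (τ Z) = α ≫ F₂.map c := by
    by_cases hX : W (n + 1) X
    · obtain ⟨Q, p, C, c, w, hC, hT, hQ⟩ := hcov.exists_triangle S hX hX
      obtain ⟨α, -, hα⟩ := exists_hom₂ hT (τ _) (shiftHom 1 (τ C)) (hτ.shiftHom hC (hJ _) w)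
      refine ⟨α, fun _ Z hZ d => ?_⟩
      -- The second cover kills both `c` and `d`, so both factor through `c'` and `α'` is compatible
      -- with both. Compatibility with `c`, together with the vanishing for the first cover, then
      -- forces `α = α'`.
      obtain ⟨Q', p', C', c', w', hC', hT', hc, hd, -⟩ :=
        hcov.exists_triangle_of_comp_eq_zero S hX hX hC hZ c d
      obtain ⟨α', -, hα'⟩ := exists_hom₂ hT' (τ _) (shiftHom 1 (τ C')) (hτ.shiftHom hC' (hJ _) w')
      have factor {Z' : D} (hZ' : W n Z') (x : X ⟶ Z'⟦(1 : ℤ)⟧) (hx : p' ≫ x = 0) :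
          F₁.map x ≫ shiftHom 1 (τ Z') = α' ≫ F₂.map x := by
        obtain ⟨y, rfl⟩ := dist_desc₂ hT' x hx
        rw [F₁.map_comp, assoc, hτ.shiftHom hC' hZ' y, reassoc_of% hα', F₂.map_comp]
      rw [factor hZ d hd, eq_of_comp_map_of_vanishing hT hQ α α' (by rw [← hα, factor hC c hc])]
    · exact ⟨0, fun h => (hX h).elim⟩
  choose τ' hτ' using key
  refine ⟨τ', fun X Y h hX hY => ?_, hτ'⟩
  -- The cover is one of Y, with vanishing tested against F₁ X: naturality of `h` may then be
  -- checked after `c`, where `h ≫ c` is itself a map from X to C[1].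
  obtain ⟨Q, p, C, c, w, hC, hT, hQ⟩ := hcov.exists_triangle S hY hX
  refine eq_of_comp_map_of_vanishing hT hQ _ _ ?_
  rw [assoc, ← hτ' Y hY C hC c, assoc, ← F₂.map_comp, ← hτ' X hX C hC, F₁.map_comp, assoc]

end Covers

/-! ### Gluing the extensions over the length filtration, and uniqueness -/

section Gluing

variable {B D T : Type*} [Category* B] [Preadditive B]
  [Category* D] [Preadditive D] [HasZeroObject D] [HasShift D ℤ]
  [∀ n : ℤ, (shiftFunctor D n).Additive] [Pretriangulated D]
  [Category* T] [Preadditive T] [HasZeroObject T] [HasShift T ℤ]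
  [∀ n : ℤ, (shiftFunctor T n).Additive] [Pretriangulated T]
  {J : B ⥤ D} {e : MorphismProperty B} {W : ℕ → ObjectProperty D} {I : Type*} {P : I → B}
  {F₁ F₂ : D ⥤ T} [F₁.CommShift ℤ] [F₁.IsTriangulated] [F₂.CommShift ℤ] [F₂.IsTriangulated]

lemma IsResolving.shift_add (S : IsResolving J e W) {X : D} {n : ℕ} {m : ℤ} (h : W n (X⟦m⟧))
    (k : ℕ) : W (n + k) (X⟦m + k⟧) := by
  induction k with
  | zero => simpa using h
  | succ k ih =>
    have := S.iso (n + (k + 1))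
    refine ObjectProperty.prop_of_iso _ ?_ (S.shift _ _ ih)
    exact ((shiftFunctorAdd' D (m + k) 1 (m + (k + 1 : ℕ)) (by push_cast; ring)).app X).symm

lemma IsResolving.exists_common (S : IsResolving J e W) (X Y : D) :
    ∃ (n : ℕ) (m : ℤ), W n (X⟦m⟧) ∧ W n (Y⟦m⟧) := by
  obtain ⟨n, m, h⟩ := S.exhaust X
  obtain ⟨n', m', h'⟩ := S.exhaust Y
  have h₁ := S.shift_add h (m' - m).toNat
  have h₂ := S.shift_add h' (m - m').toNat
  have e₁ : m + (m' - m).toNat = max m m' := by lia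
  have e₂ : m' + (m - m').toNat = max m m' := by lia
  rw [e₁] at h₁
  rw [e₂] at h₂
  refine ⟨n + (m' - m).toNat + (n' + (m - m').toNat), max m m', S.le_add _ _ _ h₁, ?_⟩
  rw [add_comm]
  exact S.le_add _ _ _ h₂

lemma IsResolving.eq_zero_of_zero (S : IsResolving J e W) (hneg : HasNoShiftedHoms J F₁ F₂)
    {X Y : D} (hX : W 0 X) (hY : W 0 Y) (φ : F₁.obj (X⟦(1 : ℤ)⟧) ⟶ F₂.obj Y) : φ = 0 := by
  obtain ⟨M, ⟨a⟩⟩ := S.zero X hX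
  obtain ⟨N, ⟨b⟩⟩ := S.zero Y hY
  have h := hneg M N (F₁.map (a.hom⟦(1 : ℤ)⟧') ≫ φ ≫ F₂.map b.inv)
  rw [← cancel_epi (F₁.map (a.hom⟦(1 : ℤ)⟧')), ← cancel_mono (F₂.map b.inv), assoc, h]
  simp

/-- A sequence of families of morphisms `F₁ X ⟶ F₂ X` such that the `n`th one is natural on `W n`
and two consecutive ones are compatible with the shift. -/
structure IsExtensionSequence (W : ℕ → ObjectProperty D)
    (τ : ℕ → ∀ X : D, F₁.obj X ⟶ F₂.obj X) : Prop where
  natural (n : ℕ) : NaturalOn (W n) (τ n)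
  comm (n : ℕ) (X : D) (hX : W (n + 1) X) (Z : D) (hZ : W n Z) (c : X ⟶ Z⟦(1 : ℤ)⟧) :
    F₁.map c ≫ shiftHom 1 (τ n Z) = τ (n + 1) X ≫ F₂.map c
  succ (n : ℕ) (X : D) (hX : W n X) : τ (n + 1) X = τ n X

lemma exists_isExtensionSequence (S : IsResolving J e W) (hneg : HasNoShiftedHoms J F₁ F₂)
    (hcov : HasVanishingCovers J P F₁ F₂ e W) {τ₀ : ∀ X : D, F₁.obj X ⟶ F₂.obj X}
    (hτ₀ : NaturalOn (W 0) τ₀) : ∃ τ : ℕ → ∀ X : D, F₁.obj X ⟶ F₂.obj X,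
      IsExtensionSequence W τ ∧ τ 0 = τ₀ := by
  choose next hnext hcomm using fun (n : ℕ) (t : {τ : ∀ X : D, F₁.obj X ⟶ F₂.obj X //
    NaturalOn (W n) τ}) => hcov.exists_extension S t.2
  let s : ∀ n : ℕ, {τ : ∀ X : D, F₁.obj X ⟶ F₂.obj X // NaturalOn (W n) τ} :=
    fun n => Nat.rec ⟨τ₀, hτ₀⟩ (fun n t => ⟨next n t, hnext n t⟩) n
  have comm (n : ℕ) (X : D) (hX : W (n + 1) X) (Z : D) (hZ : W n Z) (c : X ⟶ Z⟦(1 : ℤ)⟧) :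
    F₁.map c ≫ shiftHom 1 ((s n).1 Z) = (s (n + 1)).1 X ≫ F₂.map c := hcomm n (s n) X hX Z hZ c
  refine ⟨fun n => (s n).1, ⟨fun n => (s n).2, comm, fun n => ?_⟩, rfl⟩
  induction n with
  -- No earlier compatibility is available here. The completion `α` is compared with both families:
  -- it equals the new one by the vanishing for Q, and the old one because the difference factors
  -- through a map F₁(C[1]) → F₂ X, which is zero.
  | zero =>
    intro X hX
    obtain ⟨Q, p, C, c, w, hC, hT, hQ⟩ := hcov.exists_triangle S (S.mono _ _ hX) (S.mono _ _ hX)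
    obtain ⟨α, h₁, h₂⟩ := exists_hom₂ hT ((s 0).1 _) (shiftHom 1 ((s 0).1 C))
      ((s 0).2.shiftHom hC (S.mem Q) w)
    have eq₁ : α = (s 1).1 X := eq_of_comp_map_of_vanishing hT hQ _ _ (by
      rw [← h₂, comm 0 X (S.mono _ _ hX) C hC]
      rfl)
    have eq₂ : α = (s 0).1 X := by
      obtain ⟨ψ, hψ⟩ := dist_desc₂ (map_dist F₁ hT) (α - (s 0).1 X) (by
        rw [Preadditive.comp_sub, h₁, (s 0).2 p (S.mem Q) hX, sub_self])
      rw [← sub_eq_zero, hψ, S.eq_zero_of_zero hneg hC hX ψ, comp_zero]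
    exact eq₁.symm.trans eq₂
  | succ n ih =>
    intro X hX
    obtain ⟨Q, p, C, c, w, hC, hT, hQ⟩ := hcov.exists_triangle S hX hX
    -- Both families are compatible with `c`, and by induction they agree on C.
    refine eq_of_comp_map_of_vanishing hT hQ _ _ ?_
    rw [← comm (n + 1) X (S.mono _ _ hX) C (S.mono _ _ hC), ih C hC, comm n X hX C hC]

section

variable {τ : ℕ → ∀ X : D, F₁.obj X ⟶ F₂.obj X}

lemma IsExtensionSequence.app_shift (hτ : IsExtensionSequence W τ) (S : IsResolving J e W)
    {n : ℕ} {X : D} (hX : W n X) : τ (n + 1) (X⟦(1 : ℤ)⟧) = shiftHom 1 (τ n X) := by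
  simpa using (hτ.comm n (X⟦(1 : ℤ)⟧) (S.shift n X hX) X hX (𝟙 _)).symm

lemma IsExtensionSequence.eq_add (hτ : IsExtensionSequence W τ) (S : IsResolving J e W)
    {n : ℕ} {X : D} (hX : W n X) (k : ℕ) : τ (n + k) X = τ n X := by
  induction k with
  | zero => rfl
  | succ k ih => exact (hτ.succ (n + k) X (S.le_add _ _ _ hX)).trans ih

lemma IsExtensionSequence.eq (hτ : IsExtensionSequence W τ) (S : IsResolving J e W)
    {n n' : ℕ} {X : D} (hX : W n X) (hX' : W n' X) : τ n X = τ n' X := by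
  rw [← hτ.eq_add S hX n', ← hτ.eq_add S hX' n, add_comm]

/-- One step towards showing that the morphism on X read off from `τ n (X⟦m⟧)` depends neither on
`n` nor on `m`. -/
lemma IsExtensionSequence.shiftHom_succ_iff (hτ : IsExtensionSequence W τ)
    (S : IsResolving J e W) {n : ℕ} {m m' : ℤ} (hm : m + 1 = m') {X : D} (hX : W n (X⟦m⟧))
    (hX' : W (n + 1) (X⟦m'⟧)) (α : F₁.obj X ⟶ F₂.obj X) :
    shiftHom m' α = τ (n + 1) (X⟦m'⟧) ↔ shiftHom m α = τ n (X⟦m⟧) := by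
  have h₁ := shiftHom_add m 1 m' hm α
  have h₂ := hτ.natural (n + 1) ((shiftFunctorAdd' D m 1 m' hm).hom.app X) hX' (S.shift _ _ hX)
  constructor
  · intro h
    apply shiftHom_injective 1
    rw [← hτ.app_shift S hX, ← cancel_epi (F₁.map ((shiftFunctorAdd' D m 1 m' hm).hom.app X))]
    exact h₁.trans (Eq.trans (by rw [h]) h₂.symm)
  · intro h
    rw [← cancel_mono (F₂.map ((shiftFunctorAdd' D m 1 m' hm).hom.app X))]
    refine h₁.symm.trans (Eq.trans ?_ h₂)
    rw [h, ← hτ.app_shift S hX]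
    rfl

lemma IsExtensionSequence.shiftHom_add_iff (hτ : IsExtensionSequence W τ)
    (S : IsResolving J e W) {n : ℕ} {m : ℤ} {X : D} (hX : W n (X⟦m⟧))
    (α : F₁.obj X ⟶ F₂.obj X) (k : ℕ) :
    shiftHom (m + k) α = τ (n + k) (X⟦m + k⟧) ↔ shiftHom m α = τ n (X⟦m⟧) := by
  induction k with
  | zero =>
    have (m' : ℤ) (h : m = m') :
        shiftHom m' α = τ n (X⟦m'⟧) ↔ shiftHom m α = τ n (X⟦m⟧) := by subst h; rfl
    exact this _ (by simp)
  | succ k ih =>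
    rw [← ih]
    exact hτ.shiftHom_succ_iff S (by push_cast; ring) (S.shift_add hX k) (S.shift_add hX (k + 1)) α

lemma IsExtensionSequence.shiftHom_eq (hτ : IsExtensionSequence W τ)
    (S : IsResolving J e W) {n n' : ℕ} {m m' : ℤ} {X : D} (hX : W n (X⟦m⟧)) (hX' : W n' (X⟦m'⟧))
    (α : F₁.obj X ⟶ F₂.obj X) (hα : shiftHom m α = τ n (X⟦m⟧)) :
    shiftHom m' α = τ n' (X⟦m'⟧) := by
  -- Both shifts are raised to `max m m'`; one of the two increments is zero.
  rw [← hτ.shiftHom_add_iff S hX α (m' - m).toNat] at hα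
  rw [← hτ.shiftHom_add_iff S hX' α (m - m').toNat]
  have h₁ := S.shift_add hX (m' - m).toNat
  have h₂ := S.shift_add hX' (m - m').toNat
  have e₁ : m + (m' - m).toNat = m' + (m - m').toNat := by lia
  rw [e₁] at h₁ hα
  rw [hα, hτ.eq S h₁ h₂]

/-- Each component is read off on any shift lying in some `W n`. Naturality is checked after a shift
that brings both objects into the same `W n`. -/
lemma IsExtensionSequence.exists_natTrans (hτ : IsExtensionSequence W τ)
    (S : IsResolving J e W) : ∃ g : F₁ ⟶ F₂, NatTrans.CommShift g ℤ ∧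
      ∀ X, W 0 X → g.app X = τ 0 X := by
  have key (X : D) : ∃ α : F₁.obj X ⟶ F₂.obj X, ∀ (n : ℕ) (m : ℤ), W n (X⟦m⟧) →
      shiftHom m α = τ n (X⟦m⟧) := by
    obtain ⟨n, m, h⟩ := S.exhaust X
    obtain ⟨α, hα⟩ := shiftHom_surjective m (τ n (X⟦m⟧))
    exact ⟨α, fun n' m' h' => hτ.shiftHom_eq S h h' α hα⟩
  choose g hg using key
  let γ : F₁ ⟶ F₂ :=
    { app := g
      naturality X Y h := by
        obtain ⟨n, m, hX, hY⟩ := S.exists_common X Y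
        have h' := hτ.natural n (h⟦m⟧') hX hY
        rw [← hg X n m hX, ← hg Y n m hY] at h'
        apply (shiftFunctor T m).map_injective
        rw [← cancel_epi ((F₁.commShiftIso m).hom.app X),
          ← cancel_mono ((F₂.commShiftIso m).inv.app Y)]
        simpa [shiftHom] using h' }
  refine ⟨γ, commShift_of_app_shift fun a X => ?_, fun X hX => ?_⟩
  · obtain ⟨n, m, h⟩ := S.exhaust (X⟦a⟧)
    apply shiftHom_injective m
    refine (hg _ n m h).trans ?_
    have := S.iso n
    have h' : W n (X⟦a + m⟧) := ObjectProperty.prop_of_iso _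
      ((shiftFunctorAdd' D a m _ rfl).app X).symm h
    have h₁ := shiftHom_add a m _ rfl (g X)
    have h₂ := hτ.natural n ((shiftFunctorAdd' D a m _ rfl).hom.app X) h' h
    rw [← cancel_epi (F₁.map ((shiftFunctorAdd' D a m _ rfl).hom.app X))]
    exact h₂.trans (Eq.trans (by rw [hg X n _ h']) h₁.symm)
  -- Comparing on X[1], which lies in `W 1`, avoids the identification of X[0] with X.
  · apply shiftHom_injective 1
    rw [← hτ.app_shift S hX]
    exact hg X 1 1 (S.shift 0 X hX)

end

lemma natTrans_ext_of_family (S : IsResolving J e W) (hneg : HasNoShiftedHoms J F₁ F₂)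
    (hcov : HasVanishingCovers J P F₁ F₂ e W) {g g' : F₁ ⟶ F₂} (hg : NatTrans.CommShift g ℤ)
    (hg' : NatTrans.CommShift g' ℤ) (h : ∀ i, g.app (J.obj (P i)) = g'.app (J.obj (P i))) :
    g = g' := by
  have key (n : ℕ) : ∀ X, W n X → g.app X = g'.app X := by
    induction n with
    | zero =>
      intro X hX
      obtain ⟨M, ⟨ε⟩⟩ := S.zero X hX
      have hM : g.app (J.obj M) = g'.app (J.obj M) :=
        eq_of_family S hneg (hcov.exists_cover S) _ _ fun i u => by
          rw [g.naturality, g'.naturality, h]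
      rw [← cancel_epi (F₁.map ε.hom), g.naturality, g'.naturality, hM]
    | succ n ih =>
      intro X hX
      obtain ⟨Q, p, C, c, w, hC, hT, hQ⟩ := hcov.exists_triangle S hX hX
      refine eq_of_comp_map_of_vanishing hT hQ _ _ ?_
      rw [← g.naturality, ← g'.naturality, natTrans_app_shift hg, natTrans_app_shift hg', ih C hC]
  ext X
  obtain ⟨n, m, hX⟩ := S.exhaust X
  apply shiftHom_injective m
  rw [← natTrans_app_shift hg, ← natTrans_app_shift hg', key n _ hX]

theorem existsUnique_natTrans_of_family (S : IsResolving J e W)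
    (hneg : HasNoShiftedHoms J F₁ F₂) (hcov : HasVanishingCovers J P F₁ F₂ e W)
    {fam : ∀ i : I, F₁.obj (J.obj (P i)) ⟶ F₂.obj (J.obj (P i))} (hfam : IsNaturalFamily J fam) :
    ∃! g : F₁ ⟶ F₂, NatTrans.CommShift g ℤ ∧ ∀ i, g.app (J.obj (P i)) = fam i := by
  obtain ⟨τ₀, hτ₀, h₀⟩ := exists_naturalOn_zero S hneg (hcov.exists_cover S) hfam
  obtain ⟨τ, hτ, rfl⟩ := exists_isExtensionSequence S hneg hcov hτ₀
  obtain ⟨g, hg, hgτ⟩ := hτ.exists_natTrans S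
  refine ⟨g, ⟨hg, fun i => by rw [hgτ _ (S.mem _), h₀]⟩, fun g' hg' => ?_⟩
  exact natTrans_ext_of_family S hneg hcov hg'.1 hg fun i => by
    rw [hg'.2, hgτ _ (S.mem _), h₀]

end Gluing

/-! ### Truncated resolutions by finite sums, and isomorphisms -/

section Approximation

variable {B D T : Type*} [Category* B] [Preadditive B]
  [Category* D] [Preadditive D] [HasZeroObject D] [HasShift D ℤ]
  [∀ n : ℤ, (shiftFunctor D n).Additive] [Pretriangulated D]
  [Category* T] [Preadditive T] [HasZeroObject T] [HasShift T ℤ]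
  [∀ n : ℤ, (shiftFunctor T n).Additive] [Pretriangulated T]

/-- Puts a rotated and shifted triangle in the form required by the octahedral axiom. The sign `ε`
is harmless: it is later absorbed into a morphism of `B`. -/
lemma dist_rotate_shift {X Y Z : D} {f : X ⟶ Y} {g : Y ⟶ Z} {h : Z ⟶ X⟦(1 : ℤ)⟧}
    (hT : Triangle.mk f g h ∈ distTriang D) (m m' : ℤ) (hm : m + 1 = m') :
    ∃ (ε : ℤˣ) (v : Z⟦m⟧ ⟶ X⟦m'⟧), Triangle.mk (g⟦m⟧') v
      (ε • f⟦m'⟧' ≫ (shiftFunctorAdd' D m 1 m' hm).hom.app Y) ∈ distTriang D := by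
  have hT' : Triangle.mk g h (-f⟦(1 : ℤ)⟧') ∈ distTriang D := rot_of_distTriang _ hT
  obtain ⟨h', hT'', rfl⟩ := dist_shift hT' m
  let a : (X⟦(1 : ℤ)⟧)⟦m⟧ ≅ X⟦m'⟧ := ((shiftFunctorAdd' D 1 m m' (by lia)).app X).symm
  refine ⟨-m.negOnePow, h⟦m⟧' ≫ a.hom, isomorphic_distinguished _ hT'' _ ?_⟩
  refine Triangle.isoMk _ _ (Iso.refl (Y⟦m⟧)) (Iso.refl (Z⟦m⟧)) a.symm ?_ ?_ ?_
  · exact (comp_id _).trans (id_comp _).symm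
  · exact (assoc _ _ _).trans ((congr_arg (fun k => h⟦m⟧' ≫ k) a.hom_inv_id).trans
      ((comp_id _).trans (id_comp _).symm))
  · have nat := (shiftFunctorAdd' D 1 m m' (by lia)).hom.naturality f
    dsimp at nat
    have hcomm : (shiftFunctorComm D 1 m).hom.app Y =
        (shiftFunctorAdd' D 1 m m' (by lia)).inv.app Y ≫
          (shiftFunctorAdd' D m 1 m' hm).hom.app Y := by
      rw [shiftFunctorComm_eq D 1 m m' (by lia)]
      rfl
    change (-m.negOnePow • f⟦m'⟧' ≫ (shiftFunctorAdd' D m 1 m' hm).hom.app Y) ≫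
      (𝟙 (Y⟦m⟧))⟦1⟧' = (shiftFunctorAdd' D 1 m m' (by lia)).hom.app X ≫
        (m.negOnePow • (((-f⟦(1 : ℤ)⟧')⟦m⟧' ≫ (shiftFunctorComm D 1 m).hom.app Y)))
    rw [CategoryTheory.Functor.map_id, hcomm]
    refine (comp_id _).trans ?_
    rw [Functor.map_neg, Preadditive.neg_comp, Linear.comp_units_smul, Preadditive.comp_neg,
      ← reassoc_of% nat, Iso.hom_inv_id_app_assoc, Units.neg_smul, smul_neg]

lemma eq_zero_shift {G₁ G₂ : D ⥤ T} [G₁.CommShift ℤ] [G₂.CommShift ℤ] {X Y : D}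
    (h : ∀ φ : G₁.obj X ⟶ G₂.obj Y, φ = 0) (t : ℤ) (φ : G₁.obj (X⟦t⟧) ⟶ G₂.obj (Y⟦t⟧)) :
    φ = 0 := by
  have h' := h ((shiftFunctor T t).preimage
    ((G₁.commShiftIso t).inv.app X ≫ φ ≫ (G₂.commShiftIso t).hom.app Y))
  have h'' := congr_arg (fun k => k⟦t⟧') h'
  simp only [Functor.map_preimage, Functor.map_zero] at h''
  rw [← cancel_epi ((G₁.commShiftIso t).inv.app X), ← cancel_mono ((G₂.commShiftIso t).hom.app Y),
    assoc, h'']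
  simp

lemma eq_zero_shift' {G₁ G₂ : D ⥤ T} [G₁.CommShift ℤ] [G₂.CommShift ℤ] {X Y : D} (s t r : ℤ)
    (hr : r + t = s) (h : ∀ φ : G₁.obj (X⟦r⟧) ⟶ G₂.obj Y, φ = 0)
    (φ : G₁.obj (X⟦s⟧) ⟶ G₂.obj (Y⟦t⟧)) : φ = 0 := by
  have h' := eq_zero_shift h t (G₁.map ((shiftFunctorAdd' D r t s hr).inv.app X) ≫ φ)
  rw [← cancel_epi (G₁.map ((shiftFunctorAdd' D r t s hr).inv.app X)), h', comp_zero]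

variable {J : B ⥤ D} {e : MorphismProperty B} {W : ℕ → ObjectProperty D} {I : Type*} {P : I → B}
  {F₁ F₂ : D ⥤ T} [F₁.CommShift ℤ] [F₁.IsTriangulated] [F₂.CommShift ℤ] [F₂.IsTriangulated]

lemma isIso_app_of_isFiniteSum [J.Additive] {g : F₁ ⟶ F₂}
    (hg : ∀ i, IsIso (g.app (J.obj (P i)))) {Q : B} (hQ : IsFiniteSum P Q) :
    IsIso (g.app (J.obj Q)) := by
  obtain ⟨k, i, π, ι, hsum⟩ := hQ
  have h (F : D ⥤ T) [F.Additive] : ∑ l, F.map (J.map (π l)) ≫ F.map (J.map (ι l)) = 𝟙 _ := by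
    have := map_finiteSum (J := J) F hsum (𝟙 Q)
    simpa using this.symm
  refine ⟨∑ l, F₂.map (J.map (π l)) ≫ inv (g.app (J.obj (P (i l)))) ≫ F₁.map (J.map (ι l)), ?_, ?_⟩
  · rw [Preadditive.comp_sum, ← h F₁]
    refine Finset.sum_congr rfl fun l _ => ?_
    rw [← g.naturality_assoc, IsIso.hom_inv_id_assoc]
  · rw [Preadditive.sum_comp, ← h F₂]
    refine Finset.sum_congr rfl fun l _ => ?_
    rw [assoc, assoc, g.naturality, IsIso.inv_hom_id_assoc]

/-- The inverse on Q comes from the same construction applied to the inverse family; the two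
composites are compared with the identity on maps from the objects P i. -/
lemma exists_isIso_finiteSum [J.Additive]
    {fam : ∀ i : I, F₁.obj (J.obj (P i)) ⟶ F₂.obj (J.obj (P i))} (hfam : IsNaturalFamily J fam)
    (hiso : ∀ i, IsIso (fam i)) : ∃ ψ : ∀ Q : B, F₁.obj (J.obj Q) ⟶ F₂.obj (J.obj Q),
      (∀ Q, IsFiniteSum P Q → IsIso (ψ Q)) ∧ ∀ Q Q', IsFiniteSum P Q → IsFiniteSum P Q' →
        ∀ u : Q ⟶ Q', F₁.map (J.map u) ≫ ψ Q' = ψ Q ≫ F₂.map (J.map u) := by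
  have key (Q : B) : ∃ γ : F₁.obj (J.obj Q) ⟶ F₂.obj (J.obj Q), IsFiniteSum P Q →
      ∀ (i : I) (u : P i ⟶ Q), F₁.map (J.map u) ≫ γ = fam i ≫ F₂.map (J.map u) := by
    by_cases hQ : IsFiniteSum P Q
    · obtain ⟨γ, hγ⟩ := exists_hom_finiteSum hfam hQ
      exact ⟨γ, fun _ => hγ⟩
    · exact ⟨0, fun h => (hQ h).elim⟩
  choose ψ hψ using key
  refine ⟨ψ, fun Q hQ => ?_, fun Q Q' hQ hQ' u => ?_⟩
  · have hfam' : IsNaturalFamily J (fun i => inv (fam i)) := fun i j u => by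
      rw [← cancel_epi (fam i), ← reassoc_of% hfam i j u]
      simp
    obtain ⟨γ, hγ⟩ := exists_hom_finiteSum hfam' hQ
    refine ⟨γ, ?_, ?_⟩
    · have h := map_finiteSum_comp_eq_zero (F₁ := F₁) hQ (𝟙 Q) (ψ Q ≫ γ - 𝟙 _) fun i u => by
        rw [Preadditive.comp_sub, reassoc_of% hψ Q hQ i u, hγ]
        simp
      simpa [sub_eq_zero] using h
    · have h := map_finiteSum_comp_eq_zero (F₁ := F₂) hQ (𝟙 Q) (γ ≫ ψ Q - 𝟙 _) fun i u => by
        rw [Preadditive.comp_sub, reassoc_of% hγ i u, hψ Q hQ]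
        simp
      simpa [sub_eq_zero] using h
  · have h := map_finiteSum_comp_eq_zero (F₁ := F₁) hQ (𝟙 Q)
      (F₁.map (J.map u) ≫ ψ Q' - ψ Q ≫ F₂.map (J.map u)) fun i w => by
        rw [Preadditive.comp_sub, ← F₁.map_comp_assoc, ← J.map_comp, hψ Q' hQ',
          reassoc_of% hψ Q hQ i w, ← F₂.map_comp, ← J.map_comp, sub_self]
    simpa [sub_eq_zero] using h

variable (J P F₁ F₂) in
/-- An approximation `R` of `M₀` by iterated cones of finite sums of objects `P i`, with error term
`M[m + 1]`, together with an isomorphism `F₁ R ≅ F₂ R`. -/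
structure Approximation (ψ : ∀ Q : B, F₁.obj (J.obj Q) ⟶ F₂.obj (J.obj Q)) (M₀ : B) (m : ℤ) where
  -- The model to keep in mind: `R` is a complex Q_m → … → Q_0 resolving `M₀`, `Q` is its last term
  -- Q_m, `x` is the inclusion of the remaining syzygy `M` in `Q`, and `r` projects `R` onto that
  -- last term.
  M : B
  Q : B
  hQ : IsFiniteSum P Q
  R : D
  j : (J.obj M)⟦m⟧ ⟶ R
  q : R ⟶ J.obj M₀
  β : J.obj M₀ ⟶ ((J.obj M)⟦m⟧)⟦(1 : ℤ)⟧
  dist : Triangle.mk j q β ∈ distTriang D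
  r : R ⟶ (J.obj Q)⟦m⟧
  x : M ⟶ Q
  fac : j ≫ r = (J.map x)⟦m⟧'
  φ : F₁.obj R ⟶ F₂.obj R
  isIso : IsIso φ
  comm : F₁.map r ≫ shiftHom m (ψ Q) = φ ≫ F₂.map r
  -- `detect` and `vanish` make the next cone construction possible; `inj` says that passing to the
  -- error term loses no map of degree beyond `m`.
  detect (N : B) (α : F₁.obj ((J.obj N)⟦m⟧) ⟶ F₂.obj R) : α ≫ F₂.map r = 0 → α = 0
  vanish (N : B) (s : ℤ) (hs : m < s) (α : F₁.obj ((J.obj N)⟦s⟧) ⟶ F₂.obj R) : α = 0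
  inj (N : B) (s : ℤ) (hs : m < s) (α : F₁.obj ((J.obj N)⟦s⟧) ⟶ F₂.obj (J.obj M₀)) :
    α ≫ F₂.map β = 0 → α = 0
  isIso_app (g : F₁ ⟶ F₂) : NatTrans.CommShift g ℤ → (∀ i, IsIso (g.app (J.obj (P i)))) →
    IsIso (g.app R)

section

variable {ψ : ∀ Q : B, F₁.obj (J.obj Q) ⟶ F₂.obj (J.obj Q)}
  (hψ : ∀ Q Q', IsFiniteSum P Q → IsFiniteSum P Q' →
    ∀ u : Q ⟶ Q', F₁.map (J.map u) ≫ ψ Q' = ψ Q ≫ F₂.map (J.map u))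
  (hiso : ∀ Q, IsFiniteSum P Q → IsIso (ψ Q))
  (hvan : ∀ (M N : B) (s t : ℤ), t < s → IsFiniteSum P N →
    ∀ φ : F₁.obj ((J.obj M)⟦s⟧) ⟶ F₂.obj ((J.obj N)⟦t⟧), φ = 0)

/-- The empty resolution: `R = 0` and `β` is an isomorphism. `Q` is a placeholder, with `x = 0` and
`r = 0`. -/
lemma Approximation.nonempty_init [J.Additive] (hgen : ∃ Q : B, IsFiniteSum P Q) (M₀ : B) :
    Nonempty (Approximation J P F₁ F₂ ψ M₀ (-1)) := by
  obtain ⟨Q, hQ⟩ := hgen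
  let β : J.obj M₀ ⟶ ((J.obj M₀)⟦(-1 : ℤ)⟧)⟦(1 : ℤ)⟧ :=
    (shiftEquiv D (-1 : ℤ)).unitIso.hom.app (J.obj M₀) ≫ eqToHom (by simp)
  have hβ : IsIso β := by dsimp only [β]; infer_instance
  have hz (F : D ⥤ T) [F.CommShift ℤ] [F.IsTriangulated] : IsZero (F.obj (0 : D)) :=
    F.map_isZero (isZero_zero D)
  exact ⟨{
    M := M₀
    Q := Q
    hQ := hQ
    R := 0
    j := 0
    q := 0
    β := β
    dist := (Triangle.distinguished_iff_of_isZero₂ (Triangle.mk 0 0 β) (isZero_zero D)).2 hβ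
    r := 0
    x := 0
    fac := by simp
    φ := 0
    isIso := ⟨0, (hz F₁).eq_of_src _ _, (hz F₂).eq_of_src _ _⟩
    comm := (hz F₁).eq_of_src _ _
    detect := fun N α _ => (hz F₂).eq_of_tgt _ _
    vanish := fun N s _ α => (hz F₂).eq_of_tgt _ _
    inj := fun N s _ α h => by
      rwa [← cancel_mono (F₂.map β), zero_comp]
    isIso_app := fun g _ _ => ⟨0, (hz F₁).eq_of_src _ _, (hz F₂).eq_of_src _ _⟩ }⟩

include hψ hiso hvan in
-- The resolution is lengthened by covering the syzygy `A.M` by Q. The new `R` is the cone of Q[m] →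
-- A.M[m] → A.R, and the octahedral axiom identifies the new error term as N[m + 1], with N the next
-- syzygy.
lemma Approximation.nonempty_succ [IsTriangulated D] [J.Additive] {M₀ : B} {m m' : ℤ}
    (hm : m + 1 = m') (A : Approximation J P F₁ F₂ ψ M₀ m) {Q N : B} (hQ : IsFiniteSum P Q)
    (p : Q ⟶ A.M) (i : N ⟶ Q) (δ : J.obj A.M ⟶ (J.obj N)⟦(1 : ℤ)⟧)
    (hT : Triangle.mk (J.map i) (J.map p) δ ∈ distTriang D) :
    Nonempty (Approximation J P F₁ F₂ ψ M₀ m') := by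
  have := A.isIso
  have := hiso Q hQ
  obtain ⟨ε, v, h₁₂⟩ := dist_rotate_shift hT m m' hm
  let a : (J.obj Q)⟦m⟧ ⟶ A.R := (J.map p)⟦m⟧' ≫ A.j
  obtain ⟨R, r₀, r₁, h₁₃⟩ := distinguished_cocone_triangle a
  have o := Triangulated.someOctahedron (u₁₃ := a) rfl h₁₂ A.dist h₁₃
  -- After composing with `F₂.map A.r` the square is naturality of `ψ` for `p ≫ A.x`, and `detect`
  -- allows `A.r` to be cancelled.
  have ha : F₁.map a ≫ A.φ = shiftHom m (ψ Q) ≫ F₂.map a := by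
    rw [← sub_eq_zero]
    refine A.detect _ _ ?_
    have h₁ : a ≫ A.r = (J.map (p ≫ A.x))⟦m⟧' := by
      rw [assoc, A.fac, ← Functor.map_comp, ← J.map_comp]
    rw [Preadditive.sub_comp, assoc, ← A.comm, ← F₁.map_comp_assoc, h₁, assoc, ← F₂.map_comp, h₁,
      shiftHom_naturality m (hψ _ _ hQ A.hQ (p ≫ A.x)), sub_self]
  obtain ⟨φ, hφ₁, hφ₂⟩ := exists_hom₃ h₁₃ (shiftHom m (ψ Q)) A.φ ha
  have := isIso_shiftHom (F₁ := F₁) (F₂ := F₂) m (ψ Q)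
  let b : (J.obj Q)⟦m'⟧ ≅ ((J.obj Q)⟦m⟧)⟦(1 : ℤ)⟧ := (shiftFunctorAdd' D m 1 m' hm).app _
  have hb : F₁.map b.hom ≫ shiftHom 1 (shiftHom m (ψ Q)) = shiftHom m' (ψ Q) ≫ F₂.map b.hom :=
    shiftHom_add m 1 m' hm (ψ Q)
  have hvan' (M : B) (s : ℤ) (hs : m' < s)
      (α : F₁.obj ((J.obj M)⟦s⟧) ⟶ F₂.obj (((J.obj Q)⟦m⟧)⟦(1 : ℤ)⟧)) : α = 0 := by
    rw [← cancel_mono (F₂.map b.inv), hvan M Q s m' hs hQ (α ≫ F₂.map b.inv), zero_comp]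
  -- A map killed by the projection lifts to F₂ A.R, where `A.vanish` applies. The new `detect` is
  -- the case `s = m'`.
  have hdetect (M : B) (s : ℤ) (hs : m < s) (α : F₁.obj ((J.obj M)⟦s⟧) ⟶ F₂.obj R)
      (hα : α ≫ F₂.map r₁ = 0) : α = 0 := by
    obtain ⟨γ, rfl⟩ := dist_lift₃ (map_dist F₂ h₁₃) α (by rw [reassoc_of% hα, zero_comp])
    rw [A.vanish M s hs γ, zero_comp]
  exact ⟨{
    M := N
    Q := Q
    hQ := hQ
    R := R
    j := o.m₁
    q := o.m₃
    β := A.β ≫ v⟦(1 : ℤ)⟧'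
    dist := o.mem
    r := r₁ ≫ b.inv
    x := ε • i
    fac := by
      rw [← assoc, o.comm₂, Linear.units_smul_comp, assoc]
      have : (shiftFunctorAdd' D m 1 m' hm).hom.app (J.obj Q) ≫ b.inv = 𝟙 _ := b.hom_inv_id
      rw [this, comp_id, Functor.map_units_smul, Functor.map_units_smul]
    φ := φ
    isIso := isIso_hom₃ h₁₃ _ _ φ ha hφ₁ hφ₂
    comm := by
      rw [← cancel_mono (F₂.map b.hom), assoc, ← hb, ← F₁.map_comp_assoc, assoc, b.inv_hom_id,
        comp_id, hφ₂, assoc, ← F₂.map_comp, assoc, b.inv_hom_id, comp_id]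
    detect := fun M α hα => by
      refine hdetect M m' (by lia) α ?_
      rw [← cancel_mono (F₂.map b.inv), assoc, ← F₂.map_comp, hα, zero_comp]
    vanish := fun M s hs α => hdetect M s (by lia) α (hvan' M s hs _)
    inj := fun M s hs α hα => by
      refine A.inj M s (by lia) α ?_
      obtain ⟨w, hw, -⟩ := dist_shift h₁₂ 1
      -- The composite with `A.β` factors through F₂(Q[m][1]), which receives no nonzero map from
      -- F₁(M[s]) since `s > m'`.
      obtain ⟨γ, hγ⟩ := dist_lift₂ (map_dist F₂ hw) (α ≫ F₂.map A.β) (by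
        rw [assoc, ← F₂.map_comp, hα])
      rw [hγ, hvan' M s hs γ, zero_comp]
    isIso_app := fun g hg hP => by
      have := A.isIso_app g hg hP
      have := isIso_app_of_isFiniteSum hP hQ
      have h : IsIso (g.app ((J.obj Q)⟦m⟧)) := by
        rw [natTrans_app_shift hg]
        exact isIso_shiftHom m _
      exact isIso_hom₃ h₁₃ (g.app _) (g.app _) (g.app _) (g.naturality _) (g.naturality _) (by
        rw [← natTrans_app_shift hg, g.naturality]) }⟩

include hψ hiso hvan in
lemma Approximation.nonempty [IsTriangulated D] (S : IsResolving J e W)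
    (hgen : ∀ M : B, ∃ (Q : B) (p : Q ⟶ M), e p ∧ IsFiniteSum P Q) (M₀ : B) (k : ℕ) :
    Nonempty (Approximation J P F₁ F₂ ψ M₀ (-1 + k)) := by
  have := S.additive
  induction k with
  | zero =>
    obtain ⟨Q, -, -, hQ⟩ := hgen M₀
    simpa using Approximation.nonempty_init ⟨Q, hQ⟩ M₀
  | succ k ih =>
    obtain ⟨A⟩ := ih
    obtain ⟨Q, p, hp, hQ⟩ := hgen A.M
    obtain ⟨N, i, δ, hT⟩ := S.kernel p hp
    exact Approximation.nonempty_succ hψ hiso hvan (by push_cast; ring) A hQ p i δ hT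

end

variable (J) in
/-- Every object `M` of `B` has finite projective dimension: `Hom(M, N[j]) = 0` for all large `j`
and all `N` in `B`. -/
def HasFiniteDimension : Prop :=
  ∀ M : B, ∃ k : ℤ, ∀ j, k < j → ∀ (N : B) (v : J.obj M ⟶ (J.obj N)⟦j⟧), v = 0

lemma HasFiniteDimension.β_eq_zero {ψ : ∀ Q : B, F₁.obj (J.obj Q) ⟶ F₂.obj (J.obj Q)} {M₀ : B}
    {k m : ℤ} (hk : ∀ j, k < j → ∀ (N : B) (v : J.obj M₀ ⟶ (J.obj N)⟦j⟧), v = 0) (hkm : k ≤ m)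
    (A : Approximation J P F₁ F₂ ψ M₀ m) : A.β = 0 := by
  have h := hk (m + 1) (by lia) A.M (A.β ≫ (shiftFunctorAdd' D m 1 (m + 1) rfl).inv.app _)
  rw [← cancel_mono ((shiftFunctorAdd' D m 1 (m + 1) rfl).inv.app _), h, zero_comp]

variable (J P F₁ F₂) in
/-- For every object `M` of `B` there is `R` having `M` as a direct summand, such that
`F₁ R ≅ F₂ R` and such that natural transformations of exact functors that are isomorphisms on the
objects `P i` are isomorphisms on `R`. -/
lemma exists_retract [IsTriangulated D] (S : IsResolving J e W)
    (hgen : ∀ M : B, ∃ (Q : B) (p : Q ⟶ M), e p ∧ IsFiniteSum P Q)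
    (hdim : HasFiniteDimension J)
    {fam : ∀ i : I, F₁.obj (J.obj (P i)) ⟶ F₂.obj (J.obj (P i))} (hfam : IsNaturalFamily J fam)
    (hiso : ∀ i, IsIso (fam i))
    (hvan : ∀ (M N : B) (s : ℤ), 0 < s → ∀ φ : F₁.obj ((J.obj M)⟦s⟧) ⟶ F₁.obj (J.obj N), φ = 0) :
    HasNoShiftedHoms J F₁ F₂ ∧ ∀ (M : B) (g : F₁ ⟶ F₂), NatTrans.CommShift g ℤ →
      (∀ i, IsIso (g.app (J.obj (P i)))) → IsIso (g.app (J.obj M)) := by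
  have := S.additive
  obtain ⟨ψ, hψ, hψ'⟩ := exists_isIso_finiteSum hfam hiso
  have hvan' (M N : B) (s t : ℤ) (hst : t < s) (hN : IsFiniteSum P N)
      (φ : F₁.obj ((J.obj M)⟦s⟧) ⟶ F₂.obj ((J.obj N)⟦t⟧)) : φ = 0 := by
    have := hψ N hN
    refine eq_zero_shift' s t (s - t) (by ring) (fun φ' => ?_) φ
    -- On finite sums `ψ` identifies F₂ with F₁, so the vanishing for F₁ carries over.
    rw [← cancel_mono (inv (ψ N)), hvan M N (s - t) (by lia) (φ' ≫ inv (ψ N)), zero_comp]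
  have happrox (M : B) : ∃ (k : ℤ), ∀ m, k ≤ m → ∃ A : Approximation J P F₁ F₂ ψ M m, A.β = 0 := by
    obtain ⟨k, hk⟩ := hdim M
    refine ⟨max k 0, fun m hm => ?_⟩
    obtain ⟨A⟩ := Approximation.nonempty hψ' hψ hvan' S hgen M (m + 1).toNat
    have e : -1 + ((m + 1).toNat : ℤ) = m := by lia
    rw [e] at A
    exact ⟨A, HasFiniteDimension.β_eq_zero hk (by lia) A⟩
  refine ⟨fun M N x => ?_, fun M g hg hgP => ?_⟩
  · obtain ⟨k, hk⟩ := happrox N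
    obtain ⟨A, hA⟩ := hk k le_rfl
    -- Two lengths are needed. `A'` exhibits N as a summand of `A'.R`, through which `x` is moved
    -- into F₁; there it comes from the error term in degree `k + 1`. As `A.β = 0`, `A.inj` says
    -- that maps to F₂ N from such a source are zero.
    obtain ⟨A', hA'⟩ := hk (k + 1) (by lia)
    obtain ⟨σ, hσ⟩ := dist_lift₃ A'.dist (𝟙 _) (by rw [hA', comp_zero])
    have := A'.isIso
    obtain ⟨z, hz⟩ := dist_lift₂ (map_dist F₁ A'.dist) (x ≫ F₂.map σ ≫ inv A'.φ)
      (hvan M N 1 one_pos _)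
    have h : F₁.map A'.j ≫ A'.φ ≫ F₂.map A'.q = 0 :=
      A.inj _ (k + 1) (by lia) _ (by rw [hA, F₂.map_zero, comp_zero])
    calc x = (x ≫ F₂.map σ ≫ inv A'.φ) ≫ A'.φ ≫ F₂.map A'.q := by
          simp only [assoc, IsIso.inv_hom_id_assoc, ← F₂.map_comp, ← hσ, F₂.map_id, comp_id]
      _ = 0 := by rw [hz, assoc, h, comp_zero]
  · obtain ⟨k, hk⟩ := happrox M
    obtain ⟨A, hA⟩ := hk k le_rfl
    obtain ⟨σ, hσ⟩ := dist_lift₃ A.dist (𝟙 _) (by rw [hA, comp_zero])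
    have := A.isIso_app g hg hgP
    -- A component at a direct summand of `A.R` is a retract of the component at `A.R`.
    refine ⟨F₂.map σ ≫ inv (g.app A.R) ≫ F₁.map A.q, ?_, ?_⟩
    · rw [← g.naturality_assoc, IsIso.hom_inv_id_assoc, ← F₁.map_comp, ← hσ, F₁.map_id]
    · rw [assoc, assoc, g.naturality, IsIso.inv_hom_id_assoc, ← F₂.map_comp, ← hσ, F₂.map_id]

lemma isIso_of_isIso_app (S : IsResolving J e W) {g : F₁ ⟶ F₂} (hg : NatTrans.CommShift g ℤ)
    (hid : ∀ M : B, ∃ (Q : B) (p : Q ⟶ M), e p)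
    (h : ∀ M : B, IsIso (g.app (J.obj M))) : IsIso g := by
  have key (n : ℕ) : ∀ X, W n X → IsIso (g.app X) := by
    induction n with
    | zero =>
      intro X hX
      obtain ⟨M, ⟨ε⟩⟩ := S.zero X hX
      have h' : g.app X = F₁.map ε.inv ≫ g.app (J.obj M) ≫ F₂.map ε.hom := by
        rw [← g.naturality, ← F₁.map_comp_assoc, ε.inv_hom_id, F₁.map_id, id_comp]
      have := h M
      rw [h']
      infer_instance
    | succ n ih =>
      intro X hX
      obtain ⟨M, i, hM⟩ := S.succ n X hX
      obtain ⟨Q, q, hq⟩ := hid M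
      obtain ⟨C, c, w, hC, hT⟩ := hM Q q hq
      have := ih C hC
      have := h Q
      have : IsIso (g.app (C⟦(1 : ℤ)⟧)) := by
        rw [natTrans_app_shift hg]
        exact isIso_shiftHom 1 _
      exact isIso_hom₂ hT (g.app _) (g.app _) (g.app _) (g.naturality _) (g.naturality _) (by
        rw [← natTrans_app_shift hg, g.naturality])
  have (X : D) : IsIso (g.app X) := by
    obtain ⟨n, m, hX⟩ := S.exhaust X
    have := key n _ hX
    rw [natTrans_app_shift hg] at this
    exact isIso_of_isIso_shiftHom m _
  exact NatIso.isIso_of_isIso_app g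

end Approximation

/-! ### Cycles of bounded above complexes in `E` -/

section Acyclic

variable {A : Type u} [Category.{v} A] [Abelian A] {E : ObjectProperty A} [IsExactSubcategory E]

/-- (E1) provides a kernel in E of the epimorphism, and kernels in A are unique; thus E is closed
under kernels of epimorphisms. -/
lemma ConditionE1.prop_X₁ (hE1 : ConditionE1 E) {S : ShortComplex A} (hS : S.ShortExact)
    (h₂ : E S.X₂) (h₃ : E S.X₃) : E S.X₁ := by
  let p : (⟨S.X₂, h₂⟩ : E.FullSubcategory) ⟶ ⟨S.X₃, h₃⟩ := ObjectProperty.homMk S.g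
  obtain ⟨Z, i, w, hZ⟩ := (hE1 p).2 hS.epi_g
  exact E.prop_of_iso (IsLimit.conePointUniqueUpToIso hZ.fIsKernel hS.fIsKernel) Z.property

lemma shortExact_cycles (K : CochainComplex A ℤ) (n : ℤ) (h : K.ExactAt (n + 1)) :
    ∃ w, (ShortComplex.mk (K.iCycles n) (K.toCycles n (n + 1)) w).ShortExact := by
  have w : K.iCycles n ≫ K.toCycles n (n + 1) = 0 := by
    rw [← cancel_mono (K.iCycles (n + 1))]
    simp
  exact ⟨w,
    { exact := by
        apply ShortComplex.exact_of_f_is_kernel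
        exact KernelFork.IsLimit.ofι' _ _ (fun {T} k hk => by
          refine ⟨K.liftCycles k (n + 1) (by simp) ?_, K.liftCycles_i _ _ _ _⟩
          rw [← K.toCycles_i n (n + 1), reassoc_of% hk, zero_comp])
      mono_f := by dsimp; infer_instance
      epi_g := Preadditive.epi_of_isZero_cokernel' _
        (K.homologyIsCokernel n (n + 1) (by simp)) h.isZero_homology }⟩

lemma ConditionE1.prop_cycles (hE1 : ConditionE1 E) (K : CochainComplex A ℤ) (a b : ℤ)
    [K.IsStrictlyLE b] (hK : ∀ n, E (K.X n)) (hex : ∀ n, a < n → K.ExactAt n) (n : ℤ)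
    (hn : a ≤ n) : E (K.cycles n) := by
  -- Descending induction from degree `b + 1`, where the cycles vanish: Zⁿ is the kernel of Kⁿ →
  -- Zⁿ⁺¹, an epimorphism by exactness in degree n + 1.
  have key (k : ℕ) : ∀ n, a ≤ n → b + 1 - k ≤ n → E (K.cycles n) := by
    induction k with
    | zero =>
      intro n _ hn
      exact E.prop_of_isZero (IsZero.of_mono (K.iCycles n)
        (K.isZero_of_isStrictlyLE b n (by simp at hn; lia)))
    | succ k ih =>
      intro n ha hn
      obtain ⟨w, hS⟩ := shortExact_cycles K n (hex _ (by lia))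
      exact hE1.prop_X₁ hS (hK n) (ih (n + 1) (by lia) (by push_cast at hn; lia))
  exact key (b + 1 - n).toNat n hn (by lia)

lemma ConditionE1.hasCyclesIn (hE1 : ConditionE1 E) (K : CochainComplex A ℤ) (b : ℤ)
    [K.IsStrictlyLE b] (hK : ∀ n, E (K.X n)) (hex : ∀ n, K.ExactAt n) : HasCyclesIn E K :=
  fun n => ⟨hex n, hE1.prop_cycles K (n - 1) b hK (fun n _ => hex n) n (by lia)⟩

end Acyclic

/-! ### The comparison functor is triangulated -/

section Comparison

variable {A : Type u} [Category.{v} A] [Abelian A] (E : ObjectProperty A) [IsExactSubcategory E]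
  [HasDerivedCategory.{w} A]

noncomputable instance : (KbToDerived E).CommShift ℤ :=
  (inferInstance : Functor.CommShift ((boundedComplexes E.FullSubcategory).ι ⋙
    E.ι.mapHomotopyCategory (ComplexShape.up ℤ) ⋙ DerivedCategory.Qh) ℤ)

instance : (KbToDerived E).IsTriangulated :=
  (inferInstance : ((boundedComplexes E.FullSubcategory).ι ⋙
    E.ι.mapHomotopyCategory (ComplexShape.up ℤ) ⋙ DerivedCategory.Qh).IsTriangulated)

noncomputable instance : Localization.Lifting (acyclicKb E).trW.Q (acyclicKb E).trW
    (KbToDerived E) (comparison E) :=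
  inferInstanceAs (Localization.Lifting (acyclicKb E).trW.Q (acyclicKb E).trW
    (KbToDerived E) (Localization.lift (KbToDerived E) (KbToDerived_inverts E) _))

noncomputable def QCompComparison : (acyclicKb E).trW.Q ⋙ comparison E ≅ KbToDerived E :=
  Localization.Lifting.iso _ (acyclicKb E).trW _ _

noncomputable instance : (comparison E).CommShift ℤ :=
  Functor.commShiftOfLocalization (acyclicKb E).trW.Q (acyclicKb E).trW ℤ
    (KbToDerived E) (comparison E)

instance : NatTrans.CommShift (QCompComparison E).hom ℤ :=
  NatTrans.commShift_iso_hom_of_localization (acyclicKb E).trW.Q (acyclicKb E).trW ℤ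
    (KbToDerived E) (comparison E)

instance : (comparison E).IsTriangulated := by
  have : (acyclicKb E).trW.Q.mapArrow.EssSurj :=
    Localization.essSurj_mapArrow _ (acyclicKb E).trW
  exact Functor.isTriangulated_of_precomp_iso (QCompComparison E)

end Comparison

/-! ### Bounded complexes and conservativity of the comparison functor -/

section BoundedComplexes

variable {A : Type u} [Category.{v} A] [Abelian A] (E : ObjectProperty A)

abbrev boundedCochainComplexes : ObjectProperty (CochainComplex E.FullSubcategory ℤ) :=
  fun K => ∃ a b : ℤ, K.IsStrictlyGE a ∧ K.IsStrictlyLE b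

/-- The category of bounded cochain complexes in `E`. -/
abbrev Cb := (boundedCochainComplexes E).FullSubcategory

/-- The quotient functor `C^b(E) ⥤ K^b(E)`. -/
noncomputable def Cb.toKb : Cb E ⥤ Kb E :=
  ObjectProperty.lift _ ((boundedCochainComplexes E).ι ⋙ HomotopyCategory.quotient _ _)
    fun K => K.property

instance : (Cb.toKb E).Full where
  map_surjective f := by
    obtain ⟨g, hg⟩ := (HomotopyCategory.quotient _ _).map_surjective f.hom
    exact ⟨ObjectProperty.homMk g, by ext; exact hg⟩

lemma Cb.toKb_obj_surjective (X : Kb E) : ∃ K : Cb E, (Cb.toKb E).obj K = X := by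
  obtain ⟨X, hX⟩ := X
  obtain ⟨K : CochainComplex _ _, rfl⟩ := X.quotient_obj_surjective
  exact ⟨⟨K, hX⟩, rfl⟩

/-- The functor sending a bounded complex in `E` to the same complex in `A`. -/
noncomputable abbrev Cb.toCochainComplex : Cb E ⥤ CochainComplex A ℤ :=
  (boundedCochainComplexes E).ι ⋙ E.ι.mapHomologicalComplex (.up ℤ)

variable [IsExactSubcategory E]

/-- The canonical functor `C^b(E) ⥤ D^b(E)`. -/
noncomputable def Cb.toDb : Cb E ⥤ Db E := Cb.toKb E ⋙ (acyclicKb E).trW.Q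

lemma Cb.exists_toDb_obj_iso (X : Db E) : ∃ K : Cb E, Nonempty ((Cb.toDb E).obj K ≅ X) := by
  have := Localization.essSurj (acyclicKb E).trW.Q (acyclicKb E).trW
  obtain ⟨K, hK⟩ := Cb.toKb_obj_surjective E ((acyclicKb E).trW.Q.objPreimage X)
  exact ⟨K, ⟨(acyclicKb E).trW.Q.mapIso (eqToIso hK) ≪≫
    (acyclicKb E).trW.Q.objObjPreimageIso X⟩⟩

/-- The inclusion of `E` in `C^b(E)`. -/
noncomputable def Cb.single : E.FullSubcategory ⥤ Cb E :=
  ObjectProperty.lift _ (CochainComplex.singleFunctor E.FullSubcategory 0) fun _ =>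
    ⟨0, 0, inferInstance, inferInstance⟩

noncomputable def Cb.singleCompToDb : Cb.single E ⋙ Cb.toDb E ≅ ExactCat.toDb E := Iso.refl _

variable [HasDerivedCategory.{w} A]

noncomputable def Cb.toDbCompComparison :
    Cb.toDb E ⋙ comparison E ≅ Cb.toCochainComplex E ⋙ DerivedCategory.Q :=
  Functor.isoWhiskerLeft (Cb.toKb E) (QCompComparison E) ≪≫
    Functor.isoWhiskerLeft (Cb.toCochainComplex E) (DerivedCategory.quotientCompQhIso A)

noncomputable def toDbCompComparison :
    toDb E ⋙ comparison E ≅ E.ι ⋙ DerivedCategory.singleFunctor A 0 :=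
  Functor.isoWhiskerLeft (Cb.single E) (Cb.toDbCompComparison E) ≪≫
    Functor.isoWhiskerRight (HomologicalComplex.singleMapHomologicalComplex E.ι (.up ℤ) 0)
      DerivedCategory.Q

lemma isInHeart_toDb_obj (M : E.FullSubcategory) : IsInHeart E ((toDb E).obj M) :=
  ⟨_, ⟨((toDbCompComparison E).app M).symm⟩⟩

variable {E}

/-- By (E1), a bounded complex in E that is exact in A has its cycles in E, hence is acyclic in E.
Conservativity of the comparison functor follows by taking cones. -/
lemma Cb.isZero_toDb_obj (hE1 : ConditionE1 E) (K : Cb E)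
    (hK : ∀ n, ((Cb.toCochainComplex E).obj K).ExactAt n) : IsZero ((Cb.toDb E).obj K) := by
  obtain ⟨a, b, ha, hb⟩ := K.property
  have : ((Cb.toCochainComplex E).obj K).IsStrictlyLE b :=
    (CochainComplex.isStrictlyLE_mapHomologicalComplex_obj_iff K.obj E.ι b).2 hb
  have h : acyclicComplexes E ((HomotopyCategory.quotient _ _).obj K.obj) :=
    (isAcyclic_iff E K.obj).2 (hE1.hasCyclesIn _ b (fun n => (K.obj.X n).property) hK)
  have h' : acyclicKb E ((Cb.toKb E).obj K) := ⟨_, h, ⟨Iso.refl _⟩⟩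
  let z : (Cb.toKb E).obj K ⟶ 0 := 0
  have : IsIso ((acyclicKb E).trW.Q.map z) :=
    Localization.inverts _ (acyclicKb E).trW _
      ((acyclicKb E).trW_iff' _ |>.2 ⟨_, 𝟙 _, 0, contractible_distinguished _, h'⟩)
  exact IsZero.of_iso ((acyclicKb E).trW.Q.map_isZero (isZero_zero _))
    (@asIso _ _ _ _ _ this)

lemma isZero_of_isZero_comparison_obj (hE1 : ConditionE1 E) (X : Db E)
    (hX : IsZero ((comparison E).obj X)) : IsZero X := by
  obtain ⟨K, ⟨e⟩⟩ := Cb.exists_toDb_obj_iso E X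
  refine IsZero.of_iso (Cb.isZero_toDb_obj hE1 K fun n => ?_) e.symm
  have h := IsZero.of_iso hX (((Cb.toDbCompComparison E).app K).symm ≪≫ (comparison E).mapIso e)
  rw [HomologicalComplex.exactAt_iff_isZero_homology]
  exact IsZero.of_iso ((DerivedCategory.homologyFunctor A n).map_isZero h)
    ((DerivedCategory.homologyFunctorFactors A n).app _).symm

lemma isIso_of_isIso_comparison_map (hE1 : ConditionE1 E) {X Y : Db E} (f : X ⟶ Y)
    (hf : IsIso ((comparison E).map f)) : IsIso f := by
  obtain ⟨Z, g, h, hT⟩ := distinguished_cocone_triangle f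
  refine (Triangle.isZero₃_iff_isIso₁ _ hT).1 (isZero_of_isZero_comparison_obj hE1 _ ?_)
  exact (Triangle.isZero₃_iff_isIso₁ _ ((comparison E).map_distinguished _ hT)).2 hf

lemma Cb.isIso_toDb_map (hE1 : ConditionE1 E) {K L : Cb E} (f : K ⟶ L)
    (hf : QuasiIso ((Cb.toCochainComplex E).map f)) : IsIso ((Cb.toDb E).map f) := by
  refine isIso_of_isIso_comparison_map hE1 _ ?_
  have : IsIso (DerivedCategory.Q.map ((Cb.toCochainComplex E).map f)) :=
    (DerivedCategory.isIso_Q_map_iff_quasiIso A _).2 hf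
  exact (NatIso.isIso_map_iff (Cb.toDbCompComparison E) f).2 this

lemma Cb.quasiIso_of_isIso_toDb_map {K L : Cb E} (f : K ⟶ L) (hf : IsIso ((Cb.toDb E).map f)) :
    QuasiIso ((Cb.toCochainComplex E).map f) := by
  rw [← DerivedCategory.isIso_Q_map_iff_quasiIso]
  exact (NatIso.isIso_map_iff (Cb.toDbCompComparison E) f).1
    (inferInstanceAs (IsIso ((comparison E).map _)))

end BoundedComplexes

/-! ### Canonical truncation of complexes in `E` -/

section Truncation

variable {A : Type u} [Category.{v} A] [Abelian A] {E : ObjectProperty A}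

/-- A complex in `A` whose terms are in `E`, considered as a complex in `E`. -/
def liftCochainComplex (L : CochainComplex A ℤ) (hL : ∀ n, E (L.X n)) :
    CochainComplex E.FullSubcategory ℤ where
  X n := ⟨L.X n, hL n⟩
  d i j := ObjectProperty.homMk (L.d i j)
  shape i j h := by ext; exact L.shape i j h
  d_comp_d' i j k _ _ := by ext; exact L.d_comp_d i j k

/-- `K` is concentrated in degrees `≥ a` and `≤ b`. -/
structure Cb.IsIn (K : Cb E) (a b : ℤ) : Prop where
  ge : K.obj.IsStrictlyGE a
  le : K.obj.IsStrictlyLE b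

variable [IsExactSubcategory E]

/-- Truncation changes terms only in degrees ≥ b. The term in degree b becomes the cycles, which
remain in E because the complex is exact above b. -/
lemma Cb.exists_truncation (hE1 : ConditionE1 E) (K : Cb E) (a b : ℤ)
    (ha : K.obj.IsStrictlyGE a) (hb : ((Cb.toCochainComplex E).obj K).IsLE b) :
    ∃ (K' : Cb E) (f : K' ⟶ K), K'.IsIn a b ∧ QuasiIso ((Cb.toCochainComplex E).map f) := by
  obtain ⟨-, c, -, hc⟩ := K.property
  set L := (Cb.toCochainComplex E).obj K with hL
  have hcL : L.IsStrictlyLE c :=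
    (CochainComplex.isStrictlyLE_mapHomologicalComplex_obj_iff K.obj E.ι c).2 hc
  have haL : L.IsStrictlyGE a :=
    (CochainComplex.isStrictlyGE_mapHomologicalComplex_obj_iff K.obj E.ι a).2 ha
  have hE (n : ℤ) : E ((L.truncLE b).X n) := by
    obtain hn | rfl | hn := lt_trichotomy n b
    · exact E.prop_of_iso (L.truncLEXIso b n hn).symm (K.obj.X n).property
    · refine E.prop_of_iso (L.truncLEXIsoCycles n).symm ?_
      exact hE1.prop_cycles L n c (fun n => (K.obj.X n).property)
        (fun m hm => L.exactAt_of_isLE n m hm) n le_rfl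
    · exact E.prop_of_isZero ((L.truncLE b).isZero_of_isStrictlyLE b n hn)
  have hge : (liftCochainComplex (L.truncLE b) hE).IsStrictlyGE a :=
    (CochainComplex.isStrictlyGE_mapHomologicalComplex_obj_iff _ E.ι a).1
      (inferInstanceAs ((L.truncLE b).IsStrictlyGE a))
  have hle : (liftCochainComplex (L.truncLE b) hE).IsStrictlyLE b :=
    (CochainComplex.isStrictlyLE_mapHomologicalComplex_obj_iff _ E.ι b).1
      (inferInstanceAs ((L.truncLE b).IsStrictlyLE b))
  refine ⟨⟨liftCochainComplex (L.truncLE b) hE, a, b, hge, hle⟩, ObjectProperty.homMk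
    { f n := ObjectProperty.homMk ((L.ιTruncLE b).f n)
      comm' i j _ := by ext; exact (L.ιTruncLE b).comm i j }, ⟨hge, hle⟩, ?_⟩
  exact (inferInstance : QuasiIso (L.ιTruncLE b))

end Truncation

lemma dist_of_iso₃ {C : Type*} [Category* C] [Preadditive C] [HasZeroObject C] [HasShift C ℤ]
    [∀ n : ℤ, (shiftFunctor C n).Additive] [Pretriangulated C] {X Y Z Z' : C} {f : X ⟶ Y}
    {g : Y ⟶ Z} {h : Z ⟶ X⟦(1 : ℤ)⟧} (hT : Triangle.mk f g h ∈ distTriang C) (e : Z' ≅ Z) :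
    Triangle.mk f (g ≫ e.inv) (e.hom ≫ h) ∈ distTriang C :=
  isomorphic_distinguished _ hT _ (Triangle.isoMk _ _ (Iso.refl _) (Iso.refl _) e
    (by change f ≫ 𝟙 Y = 𝟙 X ≫ f; simp)
    (by change (g ≫ e.inv) ≫ e.hom = 𝟙 Y ≫ g; simp)
    (by change (e.hom ≫ h) ≫ (𝟙 X)⟦(1 : ℤ)⟧' = e.hom ≫ h; simp))

/-! ### Mapping cones and right fractions -/

section Cone

variable {A : Type u} [Category.{v} A] [Abelian A] {E : ObjectProperty A}
  [IsExactSubcategory E]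

lemma isStrictlyLE_mappingCone {K L : CochainComplex E.FullSubcategory ℤ} (f : K ⟶ L) (a b c : ℤ)
    (hK : K.IsStrictlyLE a) (hL : L.IsStrictlyLE b) (ha : a - 1 ≤ c) (hb : b ≤ c) :
    CochainComplex.IsStrictlyLE (CochainComplex.mappingCone f) c := by
  refine (CochainComplex.isStrictlyLE_iff (CochainComplex.mappingCone f) _).2 fun i hi => ?_
  rw [CochainComplex.mappingCone.isZero_X_iff]
  exact ⟨CochainComplex.isZero_of_isStrictlyLE K a _ (by lia),
    CochainComplex.isZero_of_isStrictlyLE L b _ (by lia)⟩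

/-- The mapping cone of a morphism of bounded complexes. -/
noncomputable def Cb.cone {K L : Cb E} (f : K ⟶ L) : Cb E :=
  ⟨CochainComplex.mappingCone f.hom, by
    obtain ⟨a₁, b₁, ha₁, hb₁⟩ := K.property
    obtain ⟨a₂, b₂, ha₂, hb₂⟩ := L.property
    exact ⟨min (a₁ - 1) a₂, max b₁ b₂,
      CochainComplex.isStrictlyGE_mappingCone f.hom a₁ a₂ _ (by simp) (by simp),
      isStrictlyLE_mappingCone f.hom b₁ b₂ _ hb₁ hb₂ (by lia) (by lia)⟩⟩

lemma Cb.IsIn.cone {K L : Cb E} (f : K ⟶ L) {a₁ b₁ a₂ b₂ : ℤ} (hK : K.IsIn a₁ b₁)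
    (hL : L.IsIn a₂ b₂) (a b : ℤ) (h₁ : a ≤ a₁ - 1) (h₂ : a ≤ a₂) (h₃ : b₁ - 1 ≤ b)
    (h₄ : b₂ ≤ b) : (Cb.cone f).IsIn a b where
  ge := by
    have := hK.ge
    have := hL.ge
    exact CochainComplex.isStrictlyGE_mappingCone f.hom a₁ a₂ _ (by lia) h₂
  le := isStrictlyLE_mappingCone f.hom b₁ b₂ _ hK.le hL.le h₃ h₄

lemma Cb.exists_distinguished {K L : Cb E} (f : K ⟶ L) :
    ∃ (g : (Cb.toDb E).obj L ⟶ (Cb.toDb E).obj (Cb.cone f))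
      (h : (Cb.toDb E).obj (Cb.cone f) ⟶ ((Cb.toDb E).obj K)⟦(1 : ℤ)⟧),
      Triangle.mk ((Cb.toDb E).map f) g h ∈ distTriang (Db E) := by
  obtain ⟨Z, g, h, hT⟩ := distinguished_cocone_triangle ((Cb.toKb E).map f)
  have hT' := (boundedComplexes E.FullSubcategory).ι.map_distinguished _ hT
  obtain ⟨e⟩ : Nonempty ((Cb.toKb E).obj (Cb.cone f) ≅ Z) :=
    ⟨(boundedComplexes E.FullSubcategory).ι.preimageIso
      (Triangle.π₃.mapIso (isoTriangleOfIso₁₂ _ _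
        (HomotopyCategory.mappingCone_triangleh_distinguished f.hom) hT'
        (Iso.refl _) (Iso.refl _) ((comp_id _).trans (id_comp _).symm)))⟩
  exact ⟨_, _, (acyclicKb E).trW.Q.map_distinguished _ (dist_of_iso₃ hT e)⟩

lemma Cb.exists_rightFraction (hE1 : ConditionE1 E) {K L : Cb E} (b : ℤ)
    [HasDerivedCategory.{w} A]
    (hK : ((Cb.toCochainComplex E).obj K).IsLE b)
    (v : (Cb.toDb E).obj K ⟶ (Cb.toDb E).obj L) :
    ∃ (Z : Cb E) (s : Z ⟶ K) (a : Z ⟶ L), Z.obj.IsStrictlyLE b ∧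
      QuasiIso ((Cb.toCochainComplex E).map s) ∧
      (Cb.toDb E).map s ≫ v = (Cb.toDb E).map a := by
  obtain ⟨φ, hφ⟩ := Localization.exists_rightFraction (acyclicKb E).trW.Q (acyclicKb E).trW v
  obtain ⟨Y, hY⟩ := Cb.toKb_obj_surjective E φ.X'
  obtain ⟨s, hs⟩ := (Cb.toKb E).map_surjective (eqToHom hY ≫ φ.s)
  obtain ⟨a, ha⟩ := (Cb.toKb E).map_surjective (eqToHom hY ≫ φ.f)
  have fac : (Cb.toDb E).map s ≫ v = (Cb.toDb E).map a := by
    change (acyclicKb E).trW.Q.map ((Cb.toKb E).map s) ≫ _ =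
      (acyclicKb E).trW.Q.map ((Cb.toKb E).map a)
    rw [hs, ha, hφ, CategoryTheory.Functor.map_comp, CategoryTheory.Functor.map_comp, assoc]
    congr 1
    exact MorphismProperty.RightFraction.map_s_comp_map _ _ _
  have hs' : QuasiIso ((Cb.toCochainComplex E).map s) := by
    refine Cb.quasiIso_of_isIso_toDb_map s ?_
    change IsIso ((acyclicKb E).trW.Q.map ((Cb.toKb E).map s))
    rw [hs]
    have := Localization.inverts (acyclicKb E).trW.Q (acyclicKb E).trW φ.s φ.hs
    rw [CategoryTheory.Functor.map_comp]
    infer_instance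
  obtain ⟨c, d, hc, hd⟩ := Y.property
  -- The apex of the roof is quasi-isomorphic to K, so truncating it still gives a roof.
  have hYb : ((Cb.toCochainComplex E).obj Y).IsLE b := by
    rw [CochainComplex.isLE_iff] at hK ⊢
    intro i hi
    rw [HomologicalComplex.exactAt_iff_isZero_homology]
    exact IsZero.of_iso ((hK i hi).isZero_homology)
      (isoOfQuasiIsoAt ((Cb.toCochainComplex E).map s) i)
  obtain ⟨Z, t, hZ, ht⟩ := Y.exists_truncation hE1 c b hc hYb
  refine ⟨Z, t ≫ s, t ≫ a, hZ.le, ?_, ?_⟩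
  · rw [CategoryTheory.Functor.map_comp]
    infer_instance
  · simp [fac]

end Cone

/-! ### Lifting distinguished triangles along a conservative functor -/

section Reflects

variable {C D : Type*} [Category* C] [Preadditive C] [HasZeroObject C] [HasShift C ℤ]
  [∀ n : ℤ, (shiftFunctor C n).Additive] [Pretriangulated C]
  [Category* D] [Preadditive D] [HasZeroObject D] [HasShift D ℤ]
  [∀ n : ℤ, (shiftFunctor D n).Additive] [Pretriangulated D]

/-- If W is a cone of `f`, then `g` induces `q : W ⟶ Z`. Its image is the isomorphism supplied by
the target triangle, since their difference factors through a map X'[1] → Z'. Conservativity makes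
`q` an isomorphism. -/
lemma exists_distinguished_of_map (G : C ⥤ D) [G.CommShift ℤ] [G.IsTriangulated]
    {X Y Z : C} {f : X ⟶ Y} {g : Y ⟶ Z} (w : f ≫ g = 0)
    (hG : ∀ (W : C) (q : W ⟶ Z), IsIso (G.map q) → IsIso q)
    {X' Y' Z' : D} {f' : X' ⟶ Y'} {g' : Y' ⟶ Z'} {h' : Z' ⟶ X'⟦(1 : ℤ)⟧}
    (hT' : Triangle.mk f' g' h' ∈ distTriang D) (a : G.obj X ≅ X') (b : G.obj Y ≅ Y')
    (c : G.obj Z ≅ Z') (comm₁ : G.map f ≫ b.hom = a.hom ≫ f')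
    (comm₂ : G.map g ≫ c.hom = b.hom ≫ g') (hvan : ∀ φ : X'⟦(1 : ℤ)⟧ ⟶ Z', φ = 0) :
    ∃ δ : Z ⟶ X⟦(1 : ℤ)⟧, Triangle.mk f g δ ∈ distTriang C := by
  obtain ⟨W, u, v, hT⟩ : ∃ (W : C) (u : Y ⟶ W) (v : W ⟶ X⟦(1 : ℤ)⟧),
    Triangle.mk f u v ∈ distTriang C := distinguished_cocone_triangle f
  obtain ⟨q, hq⟩ := dist_desc₂ hT g w
  obtain ⟨θ, hθ, hθ', hi⟩ : ∃ θ : G.obj W ⟶ Z', G.map u ≫ θ = b.hom ≫ g' ∧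
      (G.map v ≫ (G.commShiftIso (1 : ℤ)).hom.app X) ≫ a.hom⟦1⟧' = θ ≫ h' ∧ IsIso θ := by
    let e := isoTriangleOfIso₁₂ _ _ (map_dist G hT) hT' a b comm₁
    exact ⟨e.hom.hom₃, e.hom.comm₂, e.hom.comm₃,
      (inferInstance : IsIso (Triangle.π₃.map e.hom))⟩
  have key : G.map q ≫ c.hom = θ := by
    obtain ⟨ψ, hψ⟩ := dist_desc₃ (map_dist G hT) (G.map q ≫ c.hom - θ) (by
      rw [Preadditive.comp_sub, hθ, ← G.map_comp_assoc, ← hq, comm₂, sub_self])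
    have hψ₀ : ψ = 0 := by
      rw [← cancel_epi ((shiftFunctor D (1 : ℤ)).map a.inv), hvan (a.inv⟦1⟧' ≫ ψ), comp_zero]
    rw [← sub_eq_zero, hψ, hψ₀, comp_zero]
  have hq' : IsIso q := hG _ q (by
    have : IsIso (G.map q ≫ c.hom) := by rwa [key]
    exact IsIso.of_isIso_comp_right _ c.hom)
  subst hq
  exact ⟨_, dist_of_iso₃ hT (asIso q).symm⟩

end Reflects

/-! ### The filtration of `D^b(E)` by the length of complexes -/

section Resolving

variable {A : Type u} [Category.{v} A] [Abelian A] {E : ObjectProperty A}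

lemma Cb.IsIn.mono {K : Cb E} {a b a' b' : ℤ} (h : K.IsIn a b) (ha : a' ≤ a) (hb : b ≤ b') :
    K.IsIn a' b' where
  ge := by
    have := h.ge
    exact K.obj.isStrictlyGE_of_ge a' a ha
  le := by
    have := h.le
    exact K.obj.isStrictlyLE_of_le b b' hb

lemma Cb.exists_isIn (K : Cb E) : ∃ a b, K.IsIn a b := by
  obtain ⟨a, b, ha, hb⟩ := K.property
  exact ⟨a, b, ha, hb⟩

lemma Cb.IsIn.isStrictlyLE {K : Cb E} {a b : ℤ} (h : K.IsIn a b) :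
    ((Cb.toCochainComplex E).obj K).IsStrictlyLE b :=
  (CochainComplex.isStrictlyLE_mapHomologicalComplex_obj_iff K.obj E.ι b).2 h.le

variable [IsExactSubcategory E]

lemma Cb.isIn_single (M : E.FullSubcategory) : ((Cb.single E).obj M).IsIn 0 0 where
  ge := inferInstanceAs
    (CochainComplex.IsStrictlyGE ((CochainComplex.singleFunctor E.FullSubcategory 0).obj M) 0)
  le := inferInstanceAs
    (CochainComplex.IsStrictlyLE ((CochainComplex.singleFunctor E.FullSubcategory 0).obj M) 0)

lemma Cb.exists_shift (K : Cb E) {a b : ℤ} (hK : K.IsIn a b) (n : ℤ) :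
    ∃ L : Cb E, L.IsIn (a - n) (b - n) ∧
      Nonempty ((Cb.toDb E).obj L ≅ ((Cb.toDb E).obj K)⟦n⟧) := by
  have := hK.ge
  have := hK.le
  have hge := K.obj.isStrictlyGE_shift a n (a - n) (by lia)
  have hle := K.obj.isStrictlyLE_shift b n (b - n) (by lia)
  let L : Cb E := ⟨K.obj⟦n⟧, a - n, b - n, hge, hle⟩
  let e : (Cb.toKb E).obj L ≅ ((Cb.toKb E).obj K)⟦n⟧ :=
    (boundedComplexes E.FullSubcategory).ι.preimageIso
      (((HomotopyCategory.quotient E.FullSubcategory (.up ℤ)).commShiftIso n).app K.obj ≪≫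
        (((boundedComplexes E.FullSubcategory).ι.commShiftIso n).app
          ((Cb.toKb E).obj K)).symm)
  exact ⟨L, ⟨hge, hle⟩, ⟨(acyclicKb E).trW.Q.mapIso e ≪≫
    ((acyclicKb E).trW.Q.commShiftIso n).app _⟩⟩

variable (E) in
/-- The objects of `D^b(E)` represented by complexes concentrated in degrees `≥ a` and `≤ b`. -/
def IsRepresentedIn (a b : ℤ) : ObjectProperty (Db E) := fun X =>
  ∃ K : Cb E, K.IsIn a b ∧ Nonempty ((Cb.toDb E).obj K ≅ X)

instance (a b : ℤ) : (IsRepresentedIn E a b).IsClosedUnderIsomorphisms where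
  of_iso e := fun ⟨K, hK, ⟨e'⟩⟩ => ⟨K, hK, ⟨e' ≪≫ e⟩⟩

lemma IsRepresentedIn.mono {X : Db E} {a b a' b' : ℤ} (h : IsRepresentedIn E a b X)
    (ha : a' ≤ a) (hb : b ≤ b') : IsRepresentedIn E a' b' X := by
  obtain ⟨K, hK, e⟩ := h
  exact ⟨K, hK.mono ha hb, e⟩

lemma IsRepresentedIn.shift {X : Db E} {a b : ℤ} (h : IsRepresentedIn E a b X) (n a' b' : ℤ)
    (ha : a' + n = a) (hb : b' + n = b) : IsRepresentedIn E a' b' (X⟦n⟧) := by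
  obtain ⟨K, hK, ⟨e⟩⟩ := h
  obtain ⟨L, hL, ⟨e'⟩⟩ := K.exists_shift hK n
  obtain rfl : a' = a - n := by lia
  obtain rfl : b' = b - n := by lia
  exact ⟨L, hL, ⟨e' ≪≫ (shiftFunctor _ n).mapIso e⟩⟩

lemma IsRepresentedIn.exists_shift {X : Db E} {a b : ℤ} (h : IsRepresentedIn E a b X)
    (n a' b' : ℤ) (ha : a' = a + n) (hb : b' = b + n) :
    ∃ Y, IsRepresentedIn E a' b' Y ∧ Nonempty (Y⟦n⟧ ≅ X) :=
  ⟨X⟦-n⟧, h.shift (-n) _ _ (by lia) (by lia), ⟨(shiftEquiv _ n).counitIso.app X⟩⟩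

lemma isRepresentedIn_toDb_obj (M : E.FullSubcategory) :
    IsRepresentedIn E 0 0 ((toDb E).obj M) :=
  ⟨(Cb.single E).obj M, Cb.isIn_single M, ⟨(Cb.singleCompToDb E).app M⟩⟩

lemma exists_isRepresentedIn (X : Db E) : ∃ a b, IsRepresentedIn E a b X := by
  obtain ⟨K, e⟩ := Cb.exists_toDb_obj_iso E X
  obtain ⟨a, b, h⟩ := K.exists_isIn
  exact ⟨a, b, K, h, e⟩

lemma IsRepresentedIn.exists_toDb_obj_iso {X : Db E} (h : IsRepresentedIn E 0 0 X) :
    ∃ M, Nonempty ((toDb E).obj M ≅ X) := by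
  obtain ⟨K, hK, ⟨e⟩⟩ := h
  have := hK.ge
  have := hK.le
  obtain ⟨M, ⟨e'⟩⟩ := K.obj.exists_iso_single 0
  let e'' : (Cb.single E).obj M ≅ K := (boundedCochainComplexes E).ι.preimageIso e'.symm
  exact ⟨M, ⟨(Cb.toDb E).mapIso e'' ≪≫ e⟩⟩

instance : (toKb E).Additive where
  map_add := by
    intros
    ext
    exact (HomotopyCategory.singleFunctor E.FullSubcategory 0).map_add

instance : (Cb.toKb E).Additive where
  map_add := by
    intros
    ext
    exact (HomotopyCategory.quotient E.FullSubcategory (.up ℤ)).map_add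

instance : (Cb.toDb E).Additive :=
  inferInstanceAs (Cb.toKb E ⋙ (acyclicKb E).trW.Q).Additive

instance : (toDb E).Additive :=
  inferInstanceAs (toKb E ⋙ (acyclicKb E).trW.Q).Additive

variable [HasDerivedCategory.{w} A]

variable (E) in
lemma faithful_toDb : (toDb E).Faithful :=
  Functor.Faithful.of_comp_iso (toDbCompComparison E)

/-- The apex of a roof can be taken in degrees ≤ b, and then its map to L is zero degree by degree.
-/
lemma Cb.hom_eq_zero (hE1 : ConditionE1 E) {K L : Cb E} (b c : ℤ)
    (hK : K.obj.IsStrictlyLE b) (hL : L.obj.IsStrictlyGE c) (h : b < c)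
    (v : (Cb.toDb E).obj K ⟶ (Cb.toDb E).obj L) : v = 0 := by
  have hK' : ((Cb.toCochainComplex E).obj K).IsStrictlyLE b :=
    (CochainComplex.isStrictlyLE_mapHomologicalComplex_obj_iff K.obj E.ι b).2 hK
  obtain ⟨Z, s, a, hZ, hs, fac⟩ := Cb.exists_rightFraction hE1 b (by infer_instance) v
  have : IsIso ((Cb.toDb E).map s) := Cb.isIso_toDb_map hE1 s hs
  have ha : a = 0 := by
    refine ObjectProperty.hom_ext _ (HomologicalComplex.hom_ext _ _ fun n => ?_)
    by_cases hn : n ≤ b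
    · exact (L.obj.isZero_of_isStrictlyGE c n (by lia)).eq_of_tgt _ _
    · exact (Z.obj.isZero_of_isStrictlyLE b n (by lia)).eq_of_src _ _
  rw [← cancel_epi ((Cb.toDb E).map s), fac, ha, comp_zero, CategoryTheory.Functor.map_zero]

lemma IsRepresentedIn.hom_eq_zero (hE1 : ConditionE1 E) {X Y : Db E} {a b c d : ℤ}
    (hX : IsRepresentedIn E a b X) (hY : IsRepresentedIn E c d Y) (h : b < c) (v : X ⟶ Y) :
    v = 0 := by
  obtain ⟨K, hK, ⟨e⟩⟩ := hX
  obtain ⟨L, hL, ⟨e'⟩⟩ := hY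
  rw [← cancel_epi e.hom, ← cancel_mono e'.inv, comp_zero, zero_comp]
  exact Cb.hom_eq_zero hE1 b c hK.le hL.ge h _

variable (E) in
/-- The morphisms of `E` which are epimorphisms in `A`. -/
def epis : MorphismProperty E.FullSubcategory := fun _ _ p => Epi (E.ι.map p)

lemma epis.exists_kernel (hE1 : ConditionE1 E) {P M : E.FullSubcategory} {p : P ⟶ M}
    (hp : epis E p) : ∃ (N : E.FullSubcategory) (i : N ⟶ P) (w : i ≫ p = 0),
      (ShortComplex.mk i.hom p.hom (congr_arg (fun f => f.hom) w)).ShortExact := by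
  obtain ⟨N, i, w, h⟩ := (hE1 p).2 hp
  exact ⟨N, i, w, h⟩

lemma epis.exists_distinguished (hE1 : ConditionE1 E) {N P M : E.FullSubcategory} {i : N ⟶ P}
    {p : P ⟶ M} (w : i ≫ p = 0)
    (h : (ShortComplex.mk i.hom p.hom (congr_arg (fun f => f.hom) w)).ShortExact) :
    ∃ δ : (toDb E).obj M ⟶ ((toDb E).obj N)⟦(1 : ℤ)⟧,
      Triangle.mk ((toDb E).map i) ((toDb E).map p) δ ∈ distTriang (Db E) := by
  let α := toDbCompComparison E
  refine exists_distinguished_of_map (comparison E) ?_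
    (fun W q => isIso_of_isIso_comparison_map hE1 q) h.singleTriangle_distinguished
    (α.app N) (α.app P) (α.app M) (α.hom.naturality i) (α.hom.naturality p) fun φ => ?_
  · rw [← CategoryTheory.Functor.map_comp, w, CategoryTheory.Functor.map_zero]
  -- The vanishing required is Hom(N[1], M) = 0, which follows from the t-structure of D(A).
  · have : ((shiftFunctor (DerivedCategory A) (1 : ℤ)).obj
        ((DerivedCategory.singleFunctor A 0).obj N.obj)).IsLE (-1) :=
      DerivedCategory.TStructure.t.isLE_shift _ 0 1 (-1) (by lia)
    exact DerivedCategory.TStructure.t.zero φ (-1) 0 (by lia)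

end Resolving

/-! ### Degree zero terms, covers and effaceability in D^b(E) -/

section Resolving

/-- Under these hypotheses K⁰ maps onto H⁰(K), which is isomorphic to H⁰(L), and H⁰(L) is all of L⁰.
-/
lemma epi_f_of_quasiIsoAt {A : Type u} [Category.{v} A] [Abelian A] {K L : CochainComplex A ℤ}
    (φ : K ⟶ L) (h : QuasiIsoAt φ 0) (hK : K.d 0 1 = 0) (hL : L.d 0 1 = 0)
    (hL' : L.d (-1) 0 = 0) : Epi (φ.f 0) := by
  have h₁ : IsIso (L.homologyπ 0) := L.isIso_homologyπ (-1) 0 (by simp) hL'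
  have h₂ : IsIso (L.iCycles 0) := L.isIso_iCycles 0 1 (by simp) hL
  have h₃ : IsIso (K.iCycles 0) := K.isIso_iCycles 0 1 (by simp) hK
  have h₄ : Epi (HomologicalComplex.cyclesMap φ 0) := by
    have : Epi (HomologicalComplex.cyclesMap φ 0 ≫ L.homologyπ 0) := by
      rw [← HomologicalComplex.homologyπ_naturality]
      infer_instance
    have eq : HomologicalComplex.cyclesMap φ 0 =
        (HomologicalComplex.cyclesMap φ 0 ≫ L.homologyπ 0) ≫ inv (L.homologyπ 0) := by simp
    rw [eq]
    infer_instance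
  have : Epi (K.iCycles 0 ≫ φ.f 0) := by
    rw [← HomologicalComplex.cyclesMap_i]
    infer_instance
  exact epi_of_epi (K.iCycles 0) _

variable {A : Type u} [Category.{v} A] [Abelian A] {E : ObjectProperty A}
  [IsExactSubcategory E]

lemma Cb.isLE_cone {K L : Cb E} (f : K ⟶ L) (hK : K.obj.IsStrictlyLE 0)
    (hL : L.obj.IsStrictlyLE 0) (hf : Epi (E.ι.map (f.hom.f 0))) :
    ((Cb.toCochainComplex E).obj (Cb.cone f)).IsLE (-1) := by
  rw [CochainComplex.isLE_iff]
  intro i hi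
  have hle : (Cb.cone f).obj.IsStrictlyLE 0 :=
    isStrictlyLE_mappingCone f.hom 0 0 0 hK hL (by lia) le_rfl
  have hle' : ((Cb.toCochainComplex E).obj (Cb.cone f)).IsStrictlyLE 0 :=
    (CochainComplex.isStrictlyLE_mapHomologicalComplex_obj_iff _ E.ι _).2 hle
  by_cases hi' : 0 < i
  · rw [HomologicalComplex.exactAt_iff]
    exact ShortComplex.exact_of_isZero_X₂ _
      (((Cb.toCochainComplex E).obj (Cb.cone f)).isZero_of_isStrictlyLE 0 i hi')
  · obtain rfl : i = 0 := by lia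
    rw [HomologicalComplex.exactAt_iff' _ (-1) 0 1 (by simp) (by simp),
      ShortComplex.exact_iff_epi _
        ((((Cb.toCochainComplex E).obj (Cb.cone f)).isZero_of_isStrictlyLE 0 1
          (by lia)).eq_of_tgt _ _)]
    -- Degree 0 of the cone is L⁰, and the differential into it restricts to f⁰ on the summand K⁰ of
    -- degree -1. It is therefore an epimorphism.
    have h₁ : (CochainComplex.mappingCone.inl f.hom).v 0 (-1) (by lia) ≫
        (CochainComplex.mappingCone f.hom).d (-1) 0 =
          f.hom.f 0 ≫ (CochainComplex.mappingCone.inr f.hom).f 0 := by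
      rw [CochainComplex.mappingCone.inl_v_d f.hom 0 (-1) 1 (by lia) (by lia),
        (K.obj.isZero_of_isStrictlyLE 0 1 (by lia)).eq_of_tgt (K.obj.d 0 1) 0, zero_comp,
        sub_zero]
    have h₂ : (CochainComplex.mappingCone.snd f.hom).v 0 0 (add_zero 0) ≫
        (CochainComplex.mappingCone.inr f.hom).f 0 = 𝟙 _ := by
      rw [← CochainComplex.mappingCone.id_X f.hom 0 1 (by lia),
        (K.obj.isZero_of_isStrictlyLE 0 1 (by lia)).eq_of_tgt
          ((CochainComplex.mappingCone.fst f.hom).1.v 0 1 (by lia)) 0, zero_comp, zero_add]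
    have h₃ : Epi (E.ι.map ((CochainComplex.mappingCone.inr f.hom).f 0)) :=
      have : IsSplitEpi ((CochainComplex.mappingCone.inr f.hom).f 0) := ⟨⟨_, h₂⟩⟩
      inferInstance
    have h₄ : Epi (E.ι.map ((CochainComplex.mappingCone.inl f.hom).v 0 (-1) (by lia)) ≫
        E.ι.map ((CochainComplex.mappingCone f.hom).d (-1) 0)) := by
      rw [← CategoryTheory.Functor.map_comp, h₁, CategoryTheory.Functor.map_comp]
      exact epi_comp _ _
    exact epi_of_epi (E.ι.map ((CochainComplex.mappingCone.inl f.hom).v 0 (-1) _))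
      (E.ι.map ((CochainComplex.mappingCone f.hom).d (-1) 0))

/-- The inclusion of the degree zero part of a complex concentrated in nonpositive degrees. -/
noncomputable def Cb.fromSingle (K : Cb E) (hK : K.obj.IsStrictlyLE 0) :
    (Cb.single E).obj (K.obj.X 0) ⟶ K :=
  ObjectProperty.homMk (HomologicalComplex.mkHomFromSingle (𝟙 (K.obj.X 0)) fun i hi =>
    (K.obj.isZero_of_isStrictlyLE 0 i (by simp at hi; lia)).eq_of_tgt _ _)

/-- The degree zero part of a single complex. -/
noncomputable def Cb.singleXIso (M : E.FullSubcategory) :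
    ((Cb.single E).obj M).obj.X 0 ≅ M :=
  HomologicalComplex.singleObjXSelf (.up ℤ) 0 M

lemma Cb.single_map_f {P M : E.FullSubcategory} (p : P ⟶ M) :
    ((Cb.single E).map p).hom.f 0 = (singleXIso P).hom ≫ p ≫ (singleXIso M).inv :=
  HomologicalComplex.single_map_f_self (.up ℤ) 0 p

lemma Cb.fromSingle_f (K : Cb E) (hK : K.obj.IsStrictlyLE 0) :
    (K.fromSingle hK).hom.f 0 = (singleXIso _).hom :=
  (HomologicalComplex.mkHomFromSingle_f (𝟙 (K.obj.X 0)) fun i hi =>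
    (K.obj.isZero_of_isStrictlyLE 0 i (by simp at hi; lia)).eq_of_tgt _ _).trans (comp_id _)

lemma Cb.isIso_fromSingle_f (K : Cb E) (hK : K.obj.IsStrictlyLE 0) :
    IsIso ((K.fromSingle hK).hom.f 0) := by
  rw [fromSingle_f]
  infer_instance

lemma Cb.epi_single_map_f {P M : E.FullSubcategory} {p : P ⟶ M} (hp : epis E p) :
    Epi (E.ι.map (((Cb.single E).map p).hom.f 0)) := by
  rw [single_map_f, CategoryTheory.Functor.map_comp, CategoryTheory.Functor.map_comp]
  have : Epi (E.ι.map p) := hp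
  infer_instance

lemma Cb.epis_of_quasiIso {Z : Cb E} (hZ : Z.obj.IsStrictlyLE 0) {M : E.FullSubcategory}
    (s : Z ⟶ (Cb.single E).obj M) (hs : QuasiIso ((Cb.toCochainComplex E).map s))
    (p : Z.obj.X 0 ⟶ M) (hp : (Cb.single E).map p = Z.fromSingle hZ ≫ s) : epis E p := by
  have hZ' : ((Cb.toCochainComplex E).obj Z).IsStrictlyLE 0 :=
    (CochainComplex.isStrictlyLE_mapHomologicalComplex_obj_iff _ E.ι _).2 hZ
  have h₁ : Epi (E.ι.map (s.hom.f 0)) :=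
    epi_f_of_quasiIsoAt ((Cb.toCochainComplex E).map s) inferInstance
      ((((Cb.toCochainComplex E).obj Z).isZero_of_isStrictlyLE 0 1 (by lia)).eq_of_tgt _ _)
      (E.ι.map_zero _ _) (E.ι.map_zero _ _)
  have h₂ : Epi (E.ι.map (((Cb.single E).map p).hom.f 0)) := by
    rw [hp]
    have := Z.isIso_fromSingle_f hZ
    change Epi (E.ι.map ((Z.fromSingle hZ).hom.f 0 ≫ s.hom.f 0))
    rw [CategoryTheory.Functor.map_comp]
    infer_instance
  have h₃ : p = (singleXIso _).inv ≫ ((Cb.single E).map p).hom.f 0 ≫ (singleXIso M).hom := by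
    simp [single_map_f]
  change Epi (E.ι.map p)
  rw [h₃, CategoryTheory.Functor.map_comp, CategoryTheory.Functor.map_comp]
  infer_instance

variable [HasDerivedCategory.{w} A]

/-- M is the degree zero term K⁰. For a cover P → K⁰, the cone of P → K lies in degrees [a, 0] and
has no cohomology in degree 0, so it truncates to degrees [a, -1]. -/
lemma IsRepresentedIn.exists_distinguished (hE1 : ConditionE1 E) {X : Db E} {a : ℤ}
    (ha : a ≤ -1) (hX : IsRepresentedIn E a 0 X) :
    ∃ (M : E.FullSubcategory) (i : (toDb E).obj M ⟶ X), ∀ (P : E.FullSubcategory) (p : P ⟶ M),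
      epis E p → ∃ (Y : Db E) (c : X ⟶ Y) (w : Y ⟶ ((toDb E).obj P)⟦(1 : ℤ)⟧),
        IsRepresentedIn E a (-1) Y ∧ Triangle.mk ((toDb E).map p ≫ i) c w ∈ distTriang (Db E) := by
  obtain ⟨K, hK, ⟨e⟩⟩ := hX
  refine ⟨K.obj.X 0, (Cb.toDb E).map (K.fromSingle hK.le) ≫ e.hom, fun P p hp => ?_⟩
  let f := (Cb.single E).map p ≫ K.fromSingle hK.le
  have hf : Epi (E.ι.map (f.hom.f 0)) := by
    have := K.isIso_fromSingle_f hK.le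
    have := Cb.epi_single_map_f hp
    change Epi (E.ι.map (((Cb.single E).map p).hom.f 0 ≫ (K.fromSingle hK.le).hom.f 0))
    rw [CategoryTheory.Functor.map_comp]
    infer_instance
  obtain ⟨L, q, hL, hq⟩ := Cb.exists_truncation hE1 (Cb.cone f) a (-1)
    ((Cb.isIn_single P).cone f hK a 0 (by lia) le_rfl (by lia) le_rfl).ge
    (Cb.isLE_cone f (Cb.isIn_single P).le hK.le hf)
  have := Cb.isIso_toDb_map hE1 q hq
  obtain ⟨g, h, hT⟩ := Cb.exists_distinguished f
  refine ⟨_, e.inv ≫ g, h, ⟨L, hL, ⟨asIso ((Cb.toDb E).map q)⟩⟩, ?_⟩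
  refine isomorphic_distinguished _ hT _ (Triangle.isoMk _ _ (Iso.refl _) e.symm (Iso.refl _)
    ?_ ?_ ?_)
  · change ((Cb.toDb E).map ((Cb.single E).map p) ≫
      (Cb.toDb E).map (K.fromSingle hK.le) ≫ e.hom) ≫ e.inv = 𝟙 _ ≫ (Cb.toDb E).map f
    rw [assoc, assoc, e.hom_inv_id, comp_id, id_comp, ← CategoryTheory.Functor.map_comp]
  · change (e.inv ≫ g) ≫ 𝟙 _ = e.inv ≫ g
    rw [comp_id]
  · change h ≫ (𝟙 _)⟦(1 : ℤ)⟧' = 𝟙 _ ≫ h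
    rw [CategoryTheory.Functor.map_id, comp_id, id_comp]

/-- A roof Z → M with Z in nonpositive degrees is restricted to Z⁰, which maps onto M because Z → M
is a quasi-isomorphism. -/
lemma exists_epis_comp_eq (hE1 : ConditionE1 E) {M : E.FullSubcategory} {L : Cb E}
    (v : (Cb.toDb E).obj ((Cb.single E).obj M) ⟶ (Cb.toDb E).obj L) :
    ∃ (P : E.FullSubcategory) (p : P ⟶ M) (a : (Cb.single E).obj P ⟶ L), epis E p ∧
      (Cb.toDb E).map ((Cb.single E).map p) ≫ v = (Cb.toDb E).map a := by
  have hM := (Cb.isIn_single M).isStrictlyLE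
  obtain ⟨Z, s, a, hZ, hs, fac⟩ := Cb.exists_rightFraction hE1 0
    (K := (Cb.single E).obj M) (by infer_instance) v
  obtain ⟨p, hp⟩ : ∃ p : Z.obj.X 0 ⟶ M, (Cb.single E).map p = Z.fromSingle hZ ≫ s := by
    obtain ⟨p, hp⟩ := (CochainComplex.singleFunctor E.FullSubcategory 0).map_surjective
      (Z.fromSingle hZ ≫ s).hom
    exact ⟨p, by ext1; exact hp⟩
  refine ⟨Z.obj.X 0, p, Z.fromSingle hZ ≫ a, Z.epis_of_quasiIso hZ s hs p hp, ?_⟩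
  rw [hp, CategoryTheory.Functor.map_comp, CategoryTheory.Functor.map_comp, assoc, fac]

lemma IsRepresentedIn.exists_epis_comp_eq_zero (hE1 : ConditionE1 E) {X : Db E} {a b : ℤ}
    (hb : b < 0) (hX : IsRepresentedIn E a b X) {M : E.FullSubcategory}
    (v : (toDb E).obj M ⟶ X) :
    ∃ (P : E.FullSubcategory) (p : P ⟶ M), epis E p ∧ (toDb E).map p ≫ v = 0 := by
  obtain ⟨L, hL, ⟨e⟩⟩ := hX
  obtain ⟨P, p, c, hp, fac⟩ : ∃ (P : E.FullSubcategory) (p : P ⟶ M)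
      (c : (Cb.single E).obj P ⟶ L), epis E p ∧
        (toDb E).map p ≫ v ≫ e.inv = (Cb.toDb E).map c := exists_epis_comp_eq hE1 (v ≫ e.inv)
  have := hL.le
  have := (Cb.isIn_single P).ge
  have := (Cb.isIn_single P).le
  have hc : c = 0 := by
    refine ObjectProperty.hom_ext _ (HomologicalComplex.hom_ext _ _ fun n => ?_)
    by_cases hn : n ≤ b
    · exact (((Cb.single E).obj P).obj.isZero_of_isStrictlyGE 0 n (by lia)).eq_of_src _ _
    · exact (L.obj.isZero_of_isStrictlyLE b n (by lia)).eq_of_tgt _ _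
  refine ⟨P, p, hp, ?_⟩
  rw [← cancel_mono e.inv, assoc, fac, hc, CategoryTheory.Functor.map_zero, zero_comp]
  rfl

lemma full_toDb (hE1 : ConditionE1 E) : (toDb E).Full where
  map_surjective {M N} v := by
    have := faithful_toDb E
    obtain ⟨P, p, a, hp, fac⟩ := exists_epis_comp_eq hE1 (L := (Cb.single E).obj N) v
    obtain ⟨t, ht⟩ : ∃ t : P ⟶ N, (Cb.single E).map t = a := by
      obtain ⟨t, ht⟩ := (CochainComplex.singleFunctor E.FullSubcategory 0).map_surjective a.hom
      exact ⟨t, by ext1; exact ht⟩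
    have fac' : (toDb E).map p ≫ v = (toDb E).map t := by
      rw [← ht] at fac
      exact fac
    obtain ⟨Q, i, w, hS⟩ := hp.exists_kernel hE1
    obtain ⟨δ, hT⟩ := epis.exists_distinguished hE1 w hS
    have hit : i ≫ t = 0 := (toDb E).map_injective (by
      rw [CategoryTheory.Functor.map_comp, ← fac', CategoryTheory.Functor.map_zero,
        reassoc_of% (dist_comp₁₂ hT), zero_comp])
    -- `t` kills the kernel of `p`, so it descends in A. The difference of `v` and the descended map
    -- then factors through a map Q[1] → N, which is zero for degree reasons.
    obtain ⟨v₀, hv₀⟩ : ∃ v₀ : M ⟶ N, p ≫ v₀ = t := by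
      have := hS.epi_g
      have h := hS.exact.gIsCokernel
      refine ⟨ObjectProperty.homMk (h.desc (CokernelCofork.ofπ t.hom
        (congr_arg (fun f => f.hom) hit))), ?_⟩
      ext
      exact h.fac _ .one
    refine ⟨v₀, ?_⟩
    obtain ⟨y, hy⟩ := dist_desc₃ hT (v - (toDb E).map v₀) (by
      rw [Preadditive.comp_sub, fac', ← CategoryTheory.Functor.map_comp, hv₀, sub_self])
    have hy' : y = 0 := ((isRepresentedIn_toDb_obj Q).shift 1 (-1) (-1) rfl rfl).hom_eq_zero hE1
      (isRepresentedIn_toDb_obj N) (by lia) y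
    rw [hy', comp_zero, sub_eq_zero] at hy
    exact hy.symm

variable (E) in
/-- The filtration of `D^b(E)` by the length of complexes in nonpositive degrees. -/
abbrev lengthFiltration (n : ℕ) : ObjectProperty (Db E) := IsRepresentedIn E (-n) 0

theorem isResolving_toDb (hE1 : ConditionE1 E) :
    IsResolving (toDb E) (epis E) (lengthFiltration E) where
  full := full_toDb hE1
  faithful := faithful_toDb E
  additive := inferInstance
  comp p q hp hq := by
    have : Epi (E.ι.map p) := hp
    have : Epi (E.ι.map q) := hq
    change Epi (E.ι.map (p ≫ q))
    rw [CategoryTheory.Functor.map_comp]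
    infer_instance
  kernel p hp := by
    obtain ⟨N, i, w, hS⟩ := epis.exists_kernel hE1 hp
    obtain ⟨δ, hT⟩ := epis.exists_distinguished hE1 w hS
    exact ⟨N, i, δ, hT⟩
  iso n := inferInstance
  mono n X hX := hX.mono (by push_cast; lia) le_rfl
  shift n X hX := (hX.shift 1 (-n - 1) (-1) (by lia) (by lia)).mono (by push_cast; lia) (by lia)
  mem M := isRepresentedIn_toDb_obj M
  zero X hX := IsRepresentedIn.exists_toDb_obj_iso hX
  succ n X hX := by
    obtain ⟨M, i, h⟩ := hX.exists_distinguished hE1 (by push_cast; lia)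
    refine ⟨M, i, fun P p hp => ?_⟩
    obtain ⟨Y, c, w, hY, hT⟩ := h P p hp
    obtain ⟨C, hC, ⟨e⟩⟩ := hY.exists_shift 1 (-n) 0 (by push_cast; lia) (by lia)
    exact ⟨C, _, _, hC, dist_of_iso₃ hT e⟩
  kill n C M v hC := (hC.shift 1 (-n - 1) (-1) (by lia) (by lia)).exists_epis_comp_eq_zero hE1
    (by lia) v
  exhaust X := by
    obtain ⟨a, b, h⟩ := exists_isRepresentedIn X
    exact ⟨(b - a).toNat, b, (h.shift b (a - b) 0 (by lia) (by lia)).mono (by lia) le_rfl⟩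

end Resolving

/-! ### Finite direct sums of copies of an object -/

section Powers

attribute [local instance] Abelian.hasFiniteBiproducts

variable {A : Type u} [Category.{v} A] [Abelian A] {E : ObjectProperty A}
  [IsExactSubcategory E]

lemma prop_power {X : A} (hX : E X) (k : ℕ) : E (⨁ fun _ : Fin k => X) := by
  induction k with
  | zero => exact E.prop_of_isZero (by
      rw [IsZero.iff_id_eq_zero]
      ext j
      exact j.elim0)
  | succ k ih =>
    let e : X ⊞ (⨁ fun _ : Fin k => X) ≅ ⨁ fun _ : Fin (k + 1) => X :=
      { hom := biprod.desc (biproduct.ι (fun _ : Fin (k + 1) => X) 0)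
          (biproduct.desc fun j => biproduct.ι (fun _ : Fin (k + 1) => X) j.succ)
        inv := biproduct.desc fun j => Fin.cases biprod.inl
          (fun j => biproduct.ι (fun _ : Fin k => X) j ≫ biprod.inr) j
        hom_inv_id := by
          ext1
          · simp
          · apply biproduct.hom_ext'
            intro j
            simp
        inv_hom_id := by
          apply biproduct.hom_ext'
          intro j
          refine Fin.cases ?_ (fun j => ?_) j <;> simp }
    exact E.prop_of_iso e (E.prop_biprod hX ih)

/-- The direct sum of `k` copies of an object of `E`. -/
noncomputable def power (N : E.FullSubcategory) (k : ℕ) : E.FullSubcategory :=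
  ⟨⨁ fun _ : Fin k => N.obj, prop_power N.property k⟩

noncomputable def powerπ (N : E.FullSubcategory) {k : ℕ} (j : Fin k) : power N k ⟶ N :=
  ObjectProperty.homMk (biproduct.π (fun _ : Fin k => N.obj) j)

noncomputable def powerι (N : E.FullSubcategory) {k : ℕ} (j : Fin k) : N ⟶ power N k :=
  ObjectProperty.homMk (biproduct.ι (fun _ : Fin k => N.obj) j)

lemma power_total (N : E.FullSubcategory) (k : ℕ) :
    ∑ j : Fin k, powerπ N j ≫ powerι N j = 𝟙 (power N k) := by
  apply E.ι.map_injective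
  rw [Functor.map_sum]
  exact biproduct.total

lemma isFiniteSum_power {I : Type*} (P : I → E.FullSubcategory) (i : I) (k : ℕ) :
    IsFiniteSum P (power (P i) k) :=
  ⟨k, fun _ => i, fun j => powerπ (P i) j, fun j => powerι (P i) j, power_total _ _⟩

variable [HasDerivedCategory.{w} A]

section

variable (K : Type*) [Field K] [Linear K A]
  [∀ X Y : A, Module.Finite K (X ⟶ Y)] {I : Type*} {P : I → E.FullSubcategory}
  {T : Type*} [Category* T] [Preadditive T] [HasZeroObject T] [HasShift T ℤ]
    [∀ n : ℤ, (shiftFunctor T n).Additive] [Pretriangulated T]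
    (F₁ F₂ : Db E ⥤ T) [F₁.CommShift ℤ] [F₁.IsTriangulated]
    [F₂.CommShift ℤ] [F₂.IsTriangulated]

lemma IsRepresentedIn.isZero_cohomology {X : Db E} {a b : ℤ} (hX : IsRepresentedIn E a b X)
    (n : ℤ) (hn : b < n) : IsZero (cohomology E n X) := by
  obtain ⟨L, hL, ⟨e⟩⟩ := hX
  have := hL.isStrictlyLE
  exact IsZero.of_iso ((DerivedCategory.Q.obj ((Cb.toCochainComplex E).obj L)).isZero_of_isLE b n
    hn) ((DerivedCategory.homologyFunctor A n).mapIso ((comparison E).mapIso e.symm ≪≫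
      (Cb.toDbCompComparison E).app L))

/-- The zeroth cohomology of an object of `E`. -/
noncomputable def cohomologyToDbIso (M : E.FullSubcategory) :
    cohomology E 0 ((toDb E).obj M) ≅ M.obj :=
  (DerivedCategory.homologyFunctor A 0).mapIso ((toDbCompComparison E).app M) ≪≫
    (DerivedCategory.singleFunctorCompHomologyFunctorIso A 0).app M.obj

lemma HomVanishing.hasVanishingCovers (h : HomVanishing K E P F₁ F₂) :
    HasVanishingCovers (toDb E) P F₁ F₂ (epis E) (lengthFiltration E) := by
  intro n Y hY M
  let H (n : ℤ) : Db E ⥤ A := comparison E ⋙ DerivedCategory.homologyFunctor A n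
  -- Applying the condition to Y ⊕ M makes a single index serve both purposes: P i receives no
  -- nonzero map from F₁ Y, and its copies cover H⁰(Y ⊕ M), which maps onto M.
  obtain ⟨i, hi, hev, -⟩ := h (Y ⊞ (toDb E).obj M) (fun m hm => by
    have h₁ : (H m).map (biprod.fst : Y ⊞ (toDb E).obj M ⟶ _) = 0 :=
      (hY.isZero_cohomology m hm).eq_of_tgt _ _
    have h₂ : (H m).map (biprod.snd : Y ⊞ (toDb E).obj M ⟶ _) = 0 :=
      ((isRepresentedIn_toDb_obj M).isZero_cohomology m hm).eq_of_tgt _ _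
    rw [IsZero.iff_id_eq_zero]
    change 𝟙 ((H m).obj _) = 0
    rw [← CategoryTheory.Functor.map_id, ← biprod.total, CategoryTheory.Functor.map_add,
      CategoryTheory.Functor.map_comp, CategoryTheory.Functor.map_comp, h₁, h₂,
      zero_comp, zero_comp, add_zero])
  have h₀ : Epi ((H 0).map (biprod.snd : Y ⊞ (toDb E).obj M ⟶ _)) := inferInstance
  obtain ⟨q, hq⟩ : ∃ q : cohomology E 0 (Y ⊞ (toDb E).obj M) ⟶ M.obj, Epi q :=
    ⟨_, @epi_comp _ _ _ _ _ _ h₀ _ (IsIso.epi_of_iso (cohomologyToDbIso M).hom)⟩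
  let k := Module.finrank K ((P i).obj ⟶ cohomology E 0 (Y ⊞ (toDb E).obj M))
  let p : power (P i) k ⟶ M := ObjectProperty.homMk (homTensorEv K (P i).obj _ ≫ q)
  refine ⟨_, p, ?_, isFiniteSum_power P i k, fun φ => ?_⟩
  · have : Epi (homTensorEv K (P i).obj (cohomology E 0 (Y ⊞ (toDb E).obj M))) := hev
    exact epi_comp (homTensorEv K (P i).obj _) q
  · have h₁ (j) : φ ≫ F₂.map ((toDb E).map (powerπ (P i) j)) = 0 := by
      have h₂ := hi (F₁.map biprod.fst ≫ φ ≫ F₂.map ((toDb E).map (powerπ (P i) j)))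
      rwa [← comp_zero (f := F₁.map biprod.fst), cancel_epi] at h₂
    rw [← comp_id φ, ← CategoryTheory.Functor.map_id, ← CategoryTheory.Functor.map_id,
      ← power_total, Functor.map_sum, Functor.map_sum, Preadditive.comp_sum]
    refine Finset.sum_eq_zero fun j _ => ?_
    rw [CategoryTheory.Functor.map_comp, CategoryTheory.Functor.map_comp, ← assoc, h₁, zero_comp]

end

/-- A class in Hom(X, Y[m]) is viewed as an endomorphism class of X ⊕ Y of degree m. -/
lemma HasExtKillingEpi.exists_epi {X Y : A} {P : A} (h : HasExtKillingEpi P (X ⊞ Y)) :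
    ∃ (k : ℕ) (p : (⨁ fun _ : Fin k => P) ⟶ X), Epi p ∧ ∀ m : ℤ, m ≠ 0 →
      ∀ φ : (DerivedCategory.singleFunctor A 0).obj X ⟶
          ((DerivedCategory.singleFunctor A 0).obj Y)⟦m⟧,
        (DerivedCategory.singleFunctor A 0).map p ≫ φ = 0 := by
  obtain ⟨k, p, hp, hφ⟩ := h
  refine ⟨k, p ≫ biprod.fst, inferInstance, fun m hm φ => ?_⟩
  have h₁ := hφ m hm ((DerivedCategory.singleFunctor A 0).map biprod.fst ≫ φ ≫
    ((DerivedCategory.singleFunctor A 0).map biprod.inr)⟦m⟧')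
  rw [← cancel_mono (((DerivedCategory.singleFunctor A 0).map
    (biprod.inr : Y ⟶ X ⊞ Y))⟦m⟧'), zero_comp, ← h₁]
  simp

end Powers

/-! ### Comparison of extension groups in `D^b(E)` and `D(A)` -/

section FullyFaithful

/-- The functor `G` induces a bijection on morphisms from `X` to `Y`. -/
def IsBijectiveOn {C D : Type*} [Category* C] [Category* D] (G : C ⥤ D) (X Y : C) : Prop :=
  Function.Bijective (fun f : X ⟶ Y => G.map f)

lemma IsBijectiveOn.of_iso {C D : Type*} [Category* C] [Category* D] {G : C ⥤ D} {X Y Y' : C}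
    (h : IsBijectiveOn G X Y) (e : Y ≅ Y') : IsBijectiveOn G X Y' := by
  refine ⟨fun f g hfg => ?_, fun φ => ?_⟩
  · rw [← cancel_mono e.inv]
    refine h.1 ?_
    change G.map (f ≫ e.inv) = G.map (g ≫ e.inv)
    rw [G.map_comp, G.map_comp]
    exact congr_arg (fun k => k ≫ G.map e.inv) hfg
  · obtain ⟨f, hf⟩ := h.2 (φ ≫ G.map e.inv)
    refine ⟨f ≫ e.hom, ?_⟩
    change G.map f = _ at hf
    change G.map (f ≫ e.hom) = φ
    rw [G.map_comp, hf, assoc, ← G.map_comp, e.inv_hom_id, G.map_id, comp_id]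

lemma IsBijectiveOn.shift {C D : Type*} [Category* C] [Category* D] [HasShift C ℤ]
    [HasShift D ℤ] {G : C ⥤ D} [G.CommShift ℤ] {X Y : C}
    (h : IsBijectiveOn G X Y) (n : ℤ) : IsBijectiveOn G (X⟦n⟧) (Y⟦n⟧) := by
  have key (f : X ⟶ Y) : (G.map f)⟦n⟧' = (G.commShiftIso n).inv.app X ≫ G.map (f⟦n⟧') ≫
      (G.commShiftIso n).hom.app Y := by simp
  refine ⟨fun f g hfg => ?_, fun φ => ?_⟩
  · obtain ⟨f, rfl⟩ := (shiftFunctor C n).map_surjective f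
    obtain ⟨g, rfl⟩ := (shiftFunctor C n).map_surjective g
    congr 1
    refine h.1 ((shiftFunctor D n).map_injective ?_)
    change (G.map f)⟦n⟧' = (G.map g)⟦n⟧'
    change G.map _ = G.map _ at hfg
    rw [key, key, hfg]
  · obtain ⟨ψ, hψ⟩ := (shiftFunctor D n).map_surjective
      ((G.commShiftIso n).inv.app X ≫ φ ≫ (G.commShiftIso n).hom.app Y)
    obtain ⟨f, hf⟩ := h.2 ψ
    change G.map f = _ at hf
    refine ⟨f⟦n⟧', ?_⟩
    change G.map _ = φ
    rwa [← hf, key, cancel_epi, cancel_mono] at hψ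

/-- Dimension shifting. By `h₁` and `h₂`, maps from M on either side come from maps out of N[1],
with N the kernel of a cover P → M. The bijections for N[1] and P[1] then give surjectivity and
injectivity for M. -/
lemma IsBijectiveOn.of_distinguished {B C D : Type*} [Category* B]
    [Category* C] [Preadditive C] [HasZeroObject C] [HasShift C ℤ]
    [∀ n : ℤ, (shiftFunctor C n).Additive] [Pretriangulated C]
    [Category* D] [Preadditive D] [HasZeroObject D] [HasShift D ℤ]
    [∀ n : ℤ, (shiftFunctor D n).Additive] [Pretriangulated D]
    {J : B ⥤ C} {e : MorphismProperty B} {G : C ⥤ D} [G.CommShift ℤ] [G.IsTriangulated] {Y : C}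
    (hJ : ∀ {P M : B} (p : P ⟶ M), e p →
      ∃ (N : B) (i : N ⟶ P) (δ : J.obj M ⟶ (J.obj N)⟦(1 : ℤ)⟧),
        Triangle.mk (J.map i) (J.map p) δ ∈ distTriang C)
    (hY : ∀ N, IsBijectiveOn G ((J.obj N)⟦(1 : ℤ)⟧) Y)
    (h₁ : ∀ (M : B) (v : J.obj M ⟶ Y), ∃ (P : B) (p : P ⟶ M), e p ∧ J.map p ≫ v = 0)
    (h₂ : ∀ (M : B) (φ : G.obj (J.obj M) ⟶ G.obj Y),
      ∃ (P : B) (p : P ⟶ M), e p ∧ G.map (J.map p) ≫ φ = 0) (M : B) :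
    IsBijectiveOn G (J.obj M) Y := by
  refine ⟨?_, fun φ => ?_⟩
  · suffices ∀ v : J.obj M ⟶ Y, G.map v = 0 → v = 0 by
      intro f g hfg
      change G.map f = G.map g at hfg
      rw [← sub_eq_zero]
      exact this _ (by rw [G.map_sub, hfg, sub_self])
    intro v hv
    obtain ⟨P, p, hp, hpv⟩ := h₁ M v
    obtain ⟨N, i, δ, hT⟩ := hJ p hp
    obtain ⟨y, rfl⟩ := dist_desc₃ hT v hpv
    rw [G.map_comp] at hv
    obtain ⟨z, hz⟩ := dist_desc₁ (map_dist G hT) ((G.commShiftIso (1 : ℤ)).inv.app _ ≫ G.map y)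
      (by simpa using hv)
    obtain ⟨z', hz'⟩ := (hY P).2 ((G.commShiftIso (1 : ℤ)).hom.app _ ≫ z)
    change G.map z' = _ at hz'
    have : y = (J.map i)⟦(1 : ℤ)⟧' ≫ z' := (hY N).1 (by
      change G.map y = G.map _
      rw [G.map_comp, hz', G.commShiftIso_hom_naturality_assoc, ← hz]
      simp)
    rw [this, ← assoc, dist_comp₃₁ hT, zero_comp]
  · obtain ⟨P, p, hp, hpφ⟩ := h₂ M φ
    obtain ⟨N, i, δ, hT⟩ := hJ p hp
    obtain ⟨y, rfl⟩ := dist_desc₃ (map_dist G hT) φ hpφ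
    obtain ⟨y', hy'⟩ := (hY N).2 ((G.commShiftIso (1 : ℤ)).hom.app _ ≫ y)
    change G.map y' = _ at hy'
    refine ⟨δ ≫ y', ?_⟩
    change G.map _ = _
    rw [G.map_comp, hy', assoc]

end FullyFaithful

/-! ### Transfer of (E3) to D^b(E) -/

section Dimension

attribute [local instance] Abelian.hasFiniteBiproducts

variable {A : Type u} [Category.{v} A] [Abelian A] {E : ObjectProperty A}
  [IsExactSubcategory E] [HasDerivedCategory.{w} A]

/-- The image in `D(A)` of a shift of an object of `E`. -/
noncomputable def comparisonShiftIso (N : E.FullSubcategory) (j : ℤ) :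
    (comparison E).obj (((toDb E).obj N)⟦j⟧) ≅
      ((DerivedCategory.singleFunctor A 0).obj N.obj)⟦j⟧ :=
  ((comparison E).commShiftIso j).app _ ≪≫
    (shiftFunctor _ j).mapIso ((toDbCompComparison E).app N)

lemma isBijectiveOn_comparison_zero (hE1 : ConditionE1 E) (M N : E.FullSubcategory) :
    IsBijectiveOn (comparison E) ((toDb E).obj M) ((toDb E).obj N) := by
  have := full_toDb hE1
  have hα {M N : E.FullSubcategory} (f : M ⟶ N) := (toDbCompComparison E).hom.naturality f
  refine ⟨fun f g hfg => ?_, fun φ => ?_⟩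
  · obtain ⟨f, rfl⟩ := (toDb E).map_surjective f
    obtain ⟨g, rfl⟩ := (toDb E).map_surjective g
    congr 1
    refine (E.ι ⋙ DerivedCategory.singleFunctor A 0).map_injective ?_
    rw [← cancel_epi ((toDbCompComparison E).hom.app M), ← hα, ← hα]
    exact congr_arg (fun k => k ≫ (toDbCompComparison E).hom.app N) hfg
  · obtain ⟨f, hf⟩ := (E.ι ⋙ DerivedCategory.singleFunctor A 0).map_surjective
      ((toDbCompComparison E).inv.app M ≫ φ ≫ (toDbCompComparison E).hom.app N)
    refine ⟨(toDb E).map f, ?_⟩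
    have h := hα f
    rw [hf, Iso.hom_inv_id_app_assoc] at h
    exact (cancel_mono _).1 h

variable (K : Type*) [Field K] [Linear K A]
  [∀ X Y : A, Module.Finite K (X ⟶ Y)] {I : Type*} {P : I → E.FullSubcategory}

lemma ConditionE2.exists_epis (hE2 : ConditionE2 K E P) (M N : E.FullSubcategory) :
    ∃ (Q : E.FullSubcategory) (p : Q ⟶ M), epis E p ∧ IsFiniteSum P Q ∧ ∀ m : ℤ, m ≠ 0 →
      ∀ φ : (DerivedCategory.singleFunctor A 0).obj M.obj ⟶
          ((DerivedCategory.singleFunctor A 0).obj N.obj)⟦m⟧,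
        (DerivedCategory.singleFunctor A 0).map p.hom ≫ φ = 0 := by
  obtain ⟨i, -, hi⟩ := hE2 (M.obj ⊞ N.obj)
  obtain ⟨k, p, hp, h⟩ := hi.exists_epi
  exact ⟨power (P i) k, ObjectProperty.homMk p, hp, isFiniteSum_power P i k, h⟩

/-- Induction on the degree. Positive classes are effaceable in D^b(E) by roofs, and in D(A) by
property (2). -/
lemma isBijectiveOn_comparison (hE1 : ConditionE1 E) (hE2 : ConditionE2 K E P)
    (M N : E.FullSubcategory) (j : ℕ) :
    IsBijectiveOn (comparison E) ((toDb E).obj M) (((toDb E).obj N)⟦(j : ℤ)⟧) := by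
  induction j generalizing M N with
  | zero =>
    exact (isBijectiveOn_comparison_zero hE1 M N).of_iso ((shiftFunctorZero (Db E) ℤ).symm.app _)
  | succ j ih =>
    refine IsBijectiveOn.of_distinguished (e := epis E) (fun p hp =>
      (isResolving_toDb hE1).kernel p hp) (fun L => ?_) (fun L v => ?_) (fun L φ => ?_) M
    · exact ((ih L N).shift 1).of_iso ((shiftFunctorAdd' (Db E) (j : ℤ) 1 ((j + 1 : ℕ) : ℤ)
        (by push_cast; rfl)).symm.app _)
    · exact ((isRepresentedIn_toDb_obj N).shift ((j + 1 : ℕ) : ℤ) (-((j + 1 : ℕ) : ℤ))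
        (-((j + 1 : ℕ) : ℤ)) (by lia) (by lia)).exists_epis_comp_eq_zero hE1 (by lia) v
    · obtain ⟨Q, p, hp, -, h⟩ := hE2.exists_epis K L N
      refine ⟨Q, p, hp, ?_⟩
      have h' := h ((j + 1 : ℕ) : ℤ) (by lia) ((toDbCompComparison E).inv.app L ≫ φ ≫
        (comparisonShiftIso N ((j + 1 : ℕ) : ℤ)).hom)
      have h'' := (toDbCompComparison E).inv.naturality p
      change (DerivedCategory.singleFunctor A 0).map p.hom ≫ _ = _ ≫ (comparison E).map _ at h''
      rw [reassoc_of% h''] at h'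
      rw [← cancel_epi ((toDbCompComparison E).inv.app Q),
        ← cancel_mono (comparisonShiftIso N ((j + 1 : ℕ) : ℤ)).hom, assoc, assoc]
      exact h'.trans (by simp)

lemma hasFiniteDimension_toDb (hE1 : ConditionE1 E) (hE2 : ConditionE2 K E P)
    (hE3 : ConditionE3 E) : HasFiniteDimension (toDb E) := by
  intro M
  obtain ⟨k, hk⟩ := hE3 _ (isInHeart_toDb_obj E M)
  -- The bound is kept nonnegative because the comparison of Hom groups is available for natural
  -- degrees.
  refine ⟨max k 0, fun j hj N v => ?_⟩
  obtain ⟨j, rfl⟩ := Int.eq_ofNat_of_zero_le (show 0 ≤ j by lia)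
  refine (isBijectiveOn_comparison K hE1 hE2 M N j).1 ?_
  change (comparison E).map v = (comparison E).map 0
  have := hk j (by lia) _ (isInHeart_toDb_obj E N)
    ((comparison E).map v ≫ ((comparison E).commShiftIso (j : ℤ)).hom.app _)
  rw [CategoryTheory.Functor.map_zero, ← cancel_mono (((comparison E).commShiftIso
    (j : ℤ)).hom.app _), this, zero_comp]

end Dimension

/-! ### Extensions of natural transformations to exact functors -/

section Extension

variable {K : Type*} [Field K] {A : Type u} [Category.{v} A] [Abelian A] [Linear K A]
  [∀ X Y : A, Module.Finite K (X ⟶ Y)] [HasDerivedCategory.{w} A]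
  {E : ObjectProperty A} [IsExactSubcategory E] {I : Type*} {P : I → E.FullSubcategory}
  {T : Type*} [Category* T] [Preadditive T] [HasZeroObject T] [HasShift T ℤ]
  [∀ n : ℤ, (shiftFunctor T n).Additive] [Pretriangulated T]
  {F₁ F₂ : Db E ⥤ T} [F₁.CommShift ℤ] [F₁.IsTriangulated] [F₂.CommShift ℤ] [F₂.IsTriangulated]

lemma NoNegativeHoms.eq_zero (h : NoNegativeHoms E F₁ F₂) (M N : E.FullSubcategory) (s : ℤ)
    (hs : 0 < s) (φ : F₁.obj (((toDb E).obj M)⟦s⟧) ⟶ F₂.obj ((toDb E).obj N)) : φ = 0 := by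
  have h₁ (ψ : F₁.obj ((toDb E).obj M) ⟶ F₂.obj (((toDb E).obj N)⟦-s⟧)) : ψ = 0 := by
    have := h _ _ (isInHeart_toDb_obj E M) (isInHeart_toDb_obj E N) (-s) (by lia)
      (ψ ≫ (F₂.commShiftIso (-s)).hom.app _)
    rw [← cancel_mono ((F₂.commShiftIso (-s)).hom.app _), this, zero_comp]
  let e : (((toDb E).obj N)⟦-s⟧)⟦s⟧ ≅ (toDb E).obj N := (shiftEquiv (Db E) s).counitIso.app _
  have h₂ := eq_zero_shift h₁ s (φ ≫ F₂.map e.inv)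
  rw [← cancel_mono (F₂.map e.inv), h₂, zero_comp]

lemma NoNegativeHoms.hasNoShiftedHoms (h : NoNegativeHoms E F₁ F₂) :
    HasNoShiftedHoms (toDb E) F₁ F₂ :=
  fun M N φ => h.eq_zero M N 1 (by lia) φ

/-- The components of a natural transformation on the full subcategory of the objects `P i`. -/
def familyOfNatTrans (f : inclusionDb E P ⋙ F₁ ⟶ inclusionDb E P ⋙ F₂) (i : I) :
    F₁.obj ((toDb E).obj (P i)) ⟶ F₂.obj ((toDb E).obj (P i)) :=
  f.app ⟨P i, ObjectProperty.ofObj_apply P i⟩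

lemma isNaturalFamily_familyOfNatTrans (f : inclusionDb E P ⋙ F₁ ⟶ inclusionDb E P ⋙ F₂) :
    IsNaturalFamily (toDb E) (familyOfNatTrans f) := fun i j u =>
  f.naturality (ObjectProperty.homMk u :
    (⟨P i, ObjectProperty.ofObj_apply P i⟩ : (ObjectProperty.ofObj P).FullSubcategory) ⟶
      ⟨P j, ObjectProperty.ofObj_apply P j⟩)

lemma isExactExtension_iff (f : inclusionDb E P ⋙ F₁ ⟶ inclusionDb E P ⋙ F₂) (g : F₁ ⟶ F₂) :
    IsExactExtension E P f g ↔
      NatTrans.CommShift g ℤ ∧ ∀ i, g.app ((toDb E).obj (P i)) = familyOfNatTrans f i := by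
  refine and_congr_right fun _ => ⟨fun h i => ?_, fun h => ?_⟩
  · rw [← h]
    rfl
  · ext ⟨X, hX⟩
    obtain ⟨i⟩ := hX
    exact h i

lemma HomVanishing.of_isIso (h : HomVanishing K E P F₁ F₁)
    {fam : ∀ i, F₁.obj ((toDb E).obj (P i)) ⟶ F₂.obj ((toDb E).obj (P i))}
    (hfam : ∀ i, IsIso (fam i)) : HomVanishing K E P F₁ F₂ := fun C hC => by
  obtain ⟨i, hi, h'⟩ := h C hC
  have := hfam i
  exact ⟨i, fun φ => by rw [← cancel_mono (inv (fam i)), hi (φ ≫ inv (fam i)), zero_comp], h'⟩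

end Extension

end ExactCat

/-! ### The extension theorem -/

theorem proposition3p5
    {K : Type*} [Field K] {A : Type u} [Category.{v} A] [Abelian A] [Linear K A]
    [∀ X Y : A, Module.Finite K (X ⟶ Y)] [HasDerivedCategory.{w} A]
    (E : ObjectProperty A) [ExactCat.IsExactSubcategory E]
    {I : Type*} (P : I → E.FullSubcategory)
    (hE1 : ExactCat.ConditionE1 E) (hE2 : ExactCat.ConditionE2 K E P)
    (hE3 : ExactCat.ConditionE3 E)
    {T : Type*} [Category* T] [Preadditive T] [HasZeroObject T] [HasShift T ℤ]
    [∀ n : ℤ, (shiftFunctor T n).Additive] [Pretriangulated T] [IsTriangulated T]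
    (F₁ F₂ : ExactCat.Db E ⥤ T) [F₁.CommShift ℤ] [F₁.IsTriangulated]
    [F₂.CommShift ℤ] [F₂.IsTriangulated]
    (f : ExactCat.inclusionDb E P ⋙ F₁ ⟶ ExactCat.inclusionDb E P ⋙ F₂) :
    (ExactCat.NoNegativeHoms E F₁ F₁ → ExactCat.NoNegativeHoms E F₂ F₂ →
      ExactCat.NoNegativeHoms E F₁ F₂ → ExactCat.HomVanishing K E P F₁ F₂ →
        ∃! g : F₁ ⟶ F₂, ExactCat.IsExactExtension E P f g) ∧
    (IsIso f → ExactCat.ConditionTriangle K E P F₁ →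
      ∃ g : F₁ ⟶ F₂, ExactCat.IsExactExtension E P f g ∧ IsIso g ∧
        ∀ g' : F₁ ⟶ F₂, ExactCat.IsExactExtension E P f g' → g' = g) := by
  have S := ExactCat.isResolving_toDb hE1
  have hfam := ExactCat.isNaturalFamily_familyOfNatTrans f
  simp only [ExactCat.isExactExtension_iff]
  refine ⟨fun _ _ hneg hvan => ?_, fun hf ⟨hneg, hvan⟩ => ?_⟩
  · exact ExactCat.existsUnique_natTrans_of_family S hneg.hasNoShiftedHoms
      (hvan.hasVanishingCovers K F₁ F₂) hfam
  · have hiso (i : I) : IsIso (ExactCat.familyOfNatTrans f i) :=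
      inferInstanceAs (IsIso (f.app _))
    have hcov := (hvan.of_isIso hiso).hasVanishingCovers K F₁ F₂
    have hgen := fun M => hcov.exists_cover S M
    -- Approximations supply what separates (b) from (a): the vanishing of maps F₁(M[1]) → F₂(N),
    -- and the passage of isomorphisms from the objects P i to all of E.
    obtain ⟨hneg', hg⟩ := ExactCat.exists_retract (ExactCat.toDb E) P F₁ F₂ S hgen
      (ExactCat.hasFiniteDimension_toDb K hE1 hE2 hE3) hfam hiso hneg.eq_zero
    obtain ⟨g, ⟨hgs, hgf⟩, huniq⟩ :=
      ExactCat.existsUnique_natTrans_of_family S hneg' hcov hfam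
    have hgM (M : E.FullSubcategory) : IsIso (g.app ((ExactCat.toDb E).obj M)) :=
      hg M g hgs fun i => by
        rw [hgf]
        exact hiso i
    exact ⟨g, ⟨hgs, hgf⟩, ExactCat.isIso_of_isIso_app S hgs
      (fun M => (hgen M).imp fun Q ⟨p, hp, _⟩ => ⟨p, hp⟩) hgM, huniq⟩
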